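/- Let $\Sigma\subset\mathbb{R}^3$ be the unit sphere with surface measure and let $B\ge 0$ be the (positive, self-adjoint) Laplace--Beltrami operator on $L^2(\Sigma)$. For $k\in\mathbb{R}\setminus\{0\}$ and a real-valued function $V(\tau,\theta)$, $\tau\ge 1$, $\theta\in\Sigma$, let $U(k,1,\tau)f$ denote the solution $y$ of $$ik\,y_\tau=\frac{By}{\tau^2}+V(\tau,\cdot)\,y,\qquad y(1)=f\in L^2(\Sigma),$$ defined as the sum $\sum_{n\ge 0}T_n(\tau)$ of its Duhamel expansion $$T_0(\tau)=U_0(k,1,\tau)f,\qquad T_{n+1}(\tau)=\frac1{ik}\int_1^\tau U_0(k,s,\tau)V(s,\cdot)T_n(s)\,ds,\qquad U_0(k,s,\tau)=\exp\Big[\frac1{ik}\,\frac{\tau-s}{\tau s}\,B\Big].$$ A real-valued function $F$ is said to satisfy Conditions A1 with exponent $\gamma$ if $\frac12<\gamma<1$, $F\in C^2([1,\infty)\times\Sigma)$, and there is a constant $C$ such that for all $\tau\ge 1$ $$\|F(\tau,\cdot)\|_{L^\infty(\Sigma)}<C\tau^{-\gamma},\quad \|F_\tau(\tau,\cdot)\|_{L^\infty(\Sigma)}<C\tau^{-1-\gamma},\quad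 \|F_{\tau\tau}(\tau,\cdot)\|_{L^\infty(\Sigma)}<C\tau^{-1-2\gamma}.$$ Suppose that $V(\tau,\cdot)=\tau^{-2}BQ(\tau,\cdot)$ for all $\tau\ge1$, where both $V$ and $Q$ satisfy Conditions A1 with some exponent $\gamma>2/3$. Then for every $f\in L^2(\Sigma)$ the Duhamel expansion of $U(k,1,\tau)f$ converges absolutely in $L^2(\Sigma)$ for every $\tau\ge1$, and $U(k,1,\tau)f$ converges in $L^2(\Sigma)$ as $\tau\to\infty$; that is, the limit $U(k,1,\infty)f$ exists. -/

import Mathlib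

open MeasureTheory Set Filter Topology
open scoped Manifold ContDiff InnerProductSpace Laplacian

noncomputable section

namespace SphereEvolution

/-- Euclidean three-space. -/
abbrev E3 : Type := EuclideanSpace ℝ (Fin 3)

/-- The unit sphere `Σ` of `ℝ³`, a two-dimensional manifold. -/
abbrev S2 : Type := Metric.sphere (0 : E3) 1

/-- Surface measure on the unit sphere (total mass `4π`). -/
def surf : Measure S2 := (volume : Measure E3).toSphere

/-- The Hilbert space `L²(Σ)` of complex-valued functions. -/
abbrev L2S : Type := Lp ℂ 2 surf

/-- The radial projection `x ↦ x / |x|` of `ℝ³ ∖ {0}` onto the sphere (an arbitrary value at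
the origin). -/
def toS2 (x : E3) : S2 :=
  if h : x = 0 then ⟨EuclideanSpace.single 0 1, by simp⟩
  else ⟨‖x‖⁻¹ • x, by
    rw [mem_sphere_zero_iff_norm, norm_smul, norm_inv, norm_norm,
      inv_mul_cancel₀ (norm_ne_zero_iff.mpr h)]⟩

/-- The positive Laplace–Beltrami operator `B` of the unit sphere on functions of class `C²`:
minus the Euclidean Laplacian of the extension `x ↦ u (x / |x|)`, constant along rays,
evaluated on the sphere. -/
def LB {F : Type*} [NormedAddCommGroup F] [NormedSpace ℝ F] (u : S2 → F) (θ : S2) : F :=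
  -(Laplacian.laplacian (fun x : E3 => u (toS2 x)) (θ : E3))

/-- The subspace of `L²(Σ)` spanned by the functions `B φ - μ φ`, `φ ∈ C^∞(Σ)`. -/
def rangeLB (μ : ℝ) : Submodule ℂ L2S :=
  Submodule.span ℂ {ψ : L2S | ∃ φ : S2 → ℂ, ContMDiff (𝓡 2) 𝓘(ℝ, ℂ) ∞ φ ∧
    ⇑ψ =ᵐ[surf] fun θ => LB φ θ - (μ : ℂ) * φ θ}

/-- The eigenspace of the self-adjoint operator `B` in `L²(Σ)` for the real number `μ`
(trivial if `μ` is not an eigenvalue): all `y ∈ L²(Σ)` with `⟨(B - μ) φ, y⟩ = 0` for every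
`φ ∈ C^∞(Σ)`, i.e. all `y` with `B y = μ y` in the sense of distributions. -/
abbrev eigenspaceLB (μ : ℝ) : Submodule ℂ L2S := (rangeLB μ)ᗮ

/-- The operator `exp (z B)` on `L²(Σ)`, `z ∈ ℂ` purely imaginary, by functional calculus for
the self-adjoint operator `B`, whose spectrum is pure point: `∑_μ e^{z μ} P_μ`, where `P_μ` is
the orthogonal projection onto the eigenspace for `μ`. -/
def expLB (z : ℂ) (f : L2S) : L2S :=
  ∑' μ : ℝ, Complex.exp (z * μ) • (eigenspaceLB μ).starProjection f

/-- The free evolution `U₀(k, τ₀, τ) = exp [ (ik)⁻¹ ((τ - τ₀) / (τ τ₀)) B ]`, which solves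
`i k y_τ = τ⁻² B y`. -/
def U0 (k τ₀ τ : ℝ) (f : L2S) : L2S :=
  expLB ((Complex.I * k)⁻¹ * (((τ - τ₀) / (τ * τ₀) : ℝ) : ℂ)) f

open Classical in
/-- Multiplication of an element of `L²(Σ)` by a (bounded measurable) real function. -/
def mulL2 (v : S2 → ℝ) (y : L2S) : L2S :=
  if h : MemLp (fun θ => (v θ : ℂ) * y θ) 2 surf then h.toLp else 0

/-- The `n`-th term, evaluated at `f`, of the Duhamel expansion of the evolution generated by
`i k y_τ = τ⁻² B y + V y` with initial time `τ₀`: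
`T₀(τ) = U₀(k, τ₀, τ) f`,
`T_{n+1}(τ) = (ik)⁻¹ ∫_{τ₀}^{τ} U₀(k, s, τ) V(s) T_n(s) ds`. -/
def duhamelTerm (k : ℝ) (V : ℝ → S2 → ℝ) (τ₀ : ℝ) (f : L2S) : ℕ → ℝ → L2S
  | 0, τ => U0 k τ₀ τ f
  | n + 1, τ => (Complex.I * k)⁻¹ •
      ∫ s in τ₀..τ, U0 k s τ (mulL2 (V s) (duhamelTerm k V τ₀ f n s))

/-- The Duhamel expansion is meaningful at time `τ`: all the integrals in it exist as Bochner
integrals in `L²(Σ)`, and the series converges absolutely in `L²(Σ)`. -/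
def DuhamelConverges (k : ℝ) (V : ℝ → S2 → ℝ) (τ₀ τ : ℝ) (f : L2S) : Prop :=
  (∀ n, IntervalIntegrable (fun s => U0 k s τ (mulL2 (V s) (duhamelTerm k V τ₀ f n s)))
    volume τ₀ τ) ∧
  Summable fun n => ‖duhamelTerm k V τ₀ f n τ‖

/-- The evolution `U(k, τ₀, τ) f`, the sum of its Duhamel expansion. -/
def U (k : ℝ) (V : ℝ → S2 → ℝ) (τ₀ τ : ℝ) (f : L2S) : L2S :=
  ∑' n, duhamelTerm k V τ₀ f n τ

/-- Conditions A1 with exponent `γ`: `V ∈ C²([1,∞) × Σ)` real-valued, `1/2 < γ < 1`, and, with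
some constant `C`, for all `τ ≥ 1`, the sup norms over the sphere of `V(τ, ·)`, `V_τ(τ, ·)` and
`V_ττ(τ, ·)` are bounded by `C τ^{-γ}`, `C τ^{-1-γ}` and `C τ^{-1-2γ}` (the derivatives at
`τ = 1` being one-sided). -/
structure ConditionsA1 (V : ℝ → S2 → ℝ) (γ : ℝ) : Prop where
  half_lt : 1 / 2 < γ
  lt_one : γ < 1
  contMDiffOn : ContMDiffOn (𝓘(ℝ, ℝ).prod (𝓡 2)) 𝓘(ℝ, ℝ) 2
    (fun p : ℝ × S2 => V p.1 p.2) (Ici 1 ×ˢ univ)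
  bounds : ∃ C : ℝ, ∀ τ : ℝ, 1 ≤ τ → ∀ θ : S2,
    |V τ θ| < C * τ ^ (-γ) ∧
    |derivWithin (fun s => V s θ) (Ici 1) τ| < C * τ ^ (-1 - γ) ∧
    |iteratedDerivWithin 2 (fun s => V s θ) (Ici 1) τ| < C * τ ^ (-1 - 2 * γ)

end SphereEvolution

end

open scoped ComplexConjugate

namespace SphereEvolution

/-! ### Functions of class `C²` on the sphere and their extensions constant along rays -/

/-! The phase of `U0 k s τ` involves `(τ - s) / (τ s) = s⁻¹ - τ⁻¹`, so `U0` factors as `group k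
(-τ⁻¹)` after `group k s⁻¹`. Writing `y(s) = group k (-s⁻¹) (w s)` turns the equation into `w' =
A(s) w` with `A(s)` bounded and strongly continuous (`interGen`). The Duhamel terms of `y` are the
Dyson terms of `w` (`duhamelTerm_eq`), which gives absolute convergence; and since `group k (-τ⁻¹)`
tends strongly to the identity, it suffices that `w(τ)` converges.

Fix `a` and let `z(s) = group k (-s⁻¹) (w a)` be the free evolution agreeing with `y` at time `a`.
Then `‖w b - w a‖ = ‖y b - z b‖`, and by conservation of norms this is controlled by the change of
`⟪z, y⟫`. Its derivative, of the size of `V`, is `O(s^(-γ))`, which is not integrable. Adding the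
correction `⟪z, Q y⟫` brings in the commutator of `B` with `Q`, and because `s² V = B Q` the
zeroth-order terms cancel: `(BQ) u - B(Qu) + Q(Bu) = 2 ∇Q·∇u`. The remaining main term is `s⁻²`
times the integral of `conj z ∇Q·∇y`.

Three estimates finish (`norm_sub_sq_le_of_flows`). The energy `⟪y, B y⟫` grows at most like
`s^(2-γ)` (`ProjectedFlow.norm_inner_le`). The integral of `|z|² |∇Q|²` is `O(s^(2-2γ))`, by one
integration by parts from the sup bounds on `Q` and `B Q` (`integral_normSq_mul_gradSq_le`).
Weighted AM–GM with weight `s^(γ/2)` balances the two and makes the derivative of the corrected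
correlation `O(s^(-3γ/2))`, integrable exactly when `γ > 2/3`.

Unboundedness of `B` is avoided by truncation. Polynomials of degree at most `n` on the sphere form
a finite-dimensional `B`-invariant space of smooth functions, and the potential is followed by the
orthogonal projection onto it. The bounds depend on the initial datum only through its norm and
energy, hence survive `n → ∞`; density of polynomials and uniform boundedness cover all of `L²`. The
same polynomials diagonalise `B`, so that `expLB` really is a unitary group. -/

lemma toS2_coe (θ : S2) : toS2 (θ : E3) = θ := by
  have h1 : ‖(θ : E3)‖ = 1 := mem_sphere_zero_iff_norm.mp θ.2
  have h : (θ : E3) ≠ 0 := by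
    intro h0
    rw [h0, norm_zero] at h1
    exact zero_ne_one h1
  ext1
  simp [toS2, h, h1]

lemma coe_ne_zero (θ : S2) : (θ : E3) ≠ 0 := by
  intro h0
  have h1 : ‖(θ : E3)‖ = 1 := mem_sphere_zero_iff_norm.mp θ.2
  rw [h0, norm_zero] at h1
  exact zero_ne_one h1

lemma toS2_smul {c : ℝ} (hc : 0 < c) (x : E3) : toS2 (c • x) = toS2 x := by
  by_cases hx : x = 0
  · simp [hx]
  · have h2 : c • x ≠ 0 := smul_ne_zero hc.ne' hx
    ext1
    simp only [toS2, hx, h2, dif_neg, not_false_iff, norm_smul, smul_smul, Real.norm_eq_abs,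
      abs_of_pos hc]
    congr 1
    field_simp

lemma coe_toS2 {x : E3} (hx : x ≠ 0) : (toS2 x : E3) = ‖x‖⁻¹ • x := by
  simp [toS2, hx]

/-- A function on the sphere whose extension constant along rays is of class `C²`. -/
def IsC2 {F : Type*} [NormedAddCommGroup F] [NormedSpace ℝ F] (a : S2 → F) : Prop :=
  ∀ x : E3, x ≠ 0 → ContDiffAt ℝ 2 (fun y => a (toS2 y)) x

lemma two_le_smooth : (2 : ℕ∞ω) ≤ ∞ := by
  have h : ((2 : ℕ∞) : ℕ∞ω) ≤ ((⊤ : ℕ∞) : ℕ∞ω) := WithTop.coe_le_coe.mpr le_top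
  exact h

/-- Links manifold regularity on the sphere with Euclidean regularity of radial extensions. The
punctured space is treated as an open submanifold so that `x ↦ x / |x|` is smooth everywhere before
its codomain is restricted to the sphere. -/
lemma contMDiffAt_toS2 {x : E3} (hx : x ≠ 0) : ContMDiffAt 𝓘(ℝ, E3) (𝓡 2) ∞ toS2 x := by
  let W : TopologicalSpace.Opens E3 := ⟨{0}ᶜ, isOpen_compl_singleton⟩
  have hW : ContMDiff 𝓘(ℝ, E3) 𝓘(ℝ, E3) ∞ (fun y : W => ‖(y : E3)‖⁻¹ • (y : E3)) := by
    intro y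
    have h : ContMDiffAt 𝓘(ℝ, E3) 𝓘(ℝ, E3) ∞ (fun z : E3 => ‖z‖⁻¹ • z) (y : E3) := by
      have hy : (y : E3) ≠ 0 := y.2
      refine ContDiffAt.contMDiffAt ?_
      exact ((contDiffAt_norm ℝ hy).inv (norm_ne_zero_iff.mpr hy)).smul contDiffAt_id
    exact contMDiffAt_subtype_iff.mpr h
  have hmem : ∀ y : W, ‖(y : E3)‖⁻¹ • (y : E3) ∈ Metric.sphere (0 : E3) 1 := by
    intro y
    have hy : (y : E3) ≠ 0 := y.2
    rw [← coe_toS2 hy]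
    exact (toS2 (y : E3)).2
  have : Fact (Module.finrank ℝ E3 = 2 + 1) := ⟨finrank_euclideanSpace_fin⟩
  have h1 := hW.codRestrict_sphere (n := 2) hmem
  have h2 : (Set.codRestrict (fun y : W => ‖(y : E3)‖⁻¹ • (y : E3)) _ hmem)
      = fun y : W => toS2 (y : E3) := by
    funext y
    ext1
    have hy : (y : E3) ≠ 0 := y.2
    rw [coe_toS2 hy]; rfl
  rw [h2] at h1
  exact contMDiffAt_subtype_iff.mp (h1 ⟨x, hx⟩)

section

variable {F : Type*} [NormedAddCommGroup F] [NormedSpace ℝ F]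

lemma IsC2.of_contMDiff {a : S2 → F} {n : ℕ∞ω} (hn : 2 ≤ n)
    (ha : ContMDiff (𝓡 2) 𝓘(ℝ, F) n a) : IsC2 a := by
  intro x hx
  have h := ContMDiffAt.comp x ((ha.of_le hn) (toS2 x))
    ((contMDiffAt_toS2 hx).of_le (m := 2) two_le_smooth)
  exact h.contDiffAt

lemma IsC2.continuous {a : S2 → F} (ha : IsC2 a) : Continuous a := by
  have h : a = fun θ : S2 => a (toS2 (θ : E3)) := by
    funext θ
    rw [toS2_coe]
  rw [h, continuous_iff_continuousAt]
  intro θ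
  exact ContinuousAt.comp (f := fun θ : S2 => (θ : E3)) (g := fun y => a (toS2 y))
    (ha θ (coe_ne_zero θ)).continuousAt continuous_subtype_val.continuousAt

lemma IsC2.const (c : F) : IsC2 (fun _ : S2 => c) := fun _ _ => contDiffAt_const

lemma IsC2.add {a b : S2 → F} (ha : IsC2 a) (hb : IsC2 b) : IsC2 (fun θ => a θ + b θ) :=
  fun x hx => (ha x hx).add (hb x hx)

lemma IsC2.mul {a b : S2 → ℂ} (ha : IsC2 a) (hb : IsC2 b) : IsC2 (fun θ => a θ * b θ) :=
  fun x hx => (ha x hx).mul (hb x hx)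

lemma IsC2.clm_comp {G : Type*} [NormedAddCommGroup G] [NormedSpace ℝ G] (l : F →L[ℝ] G)
    {a : S2 → F} (ha : IsC2 a) : IsC2 (fun θ => l (a θ)) :=
  fun x hx => l.contDiff.contDiffAt.comp x (ha x hx)

lemma IsC2.ofReal {q : S2 → ℝ} (hq : IsC2 q) : IsC2 (fun θ => (q θ : ℂ)) :=
  hq.clm_comp Complex.ofRealCLM

lemma IsC2.conj {a : S2 → ℂ} (ha : IsC2 a) : IsC2 (fun θ => (starRingEnd ℂ) (a θ)) :=
  ha.clm_comp (Complex.conjCLE : ℂ →L[ℝ] ℂ)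

lemma LB_clm_comp {G : Type*} [NormedAddCommGroup G] [NormedSpace ℝ G] (l : F →L[ℝ] G)
    {a : S2 → F} (ha : IsC2 a) (θ : S2) : LB (fun θ => l (a θ)) θ = l (LB a θ) := by
  have := (ha θ (coe_ne_zero θ)).laplacian_CLM_comp_left (l := l)
  rw [LB, LB, map_neg]
  congr 1

lemma LB_ofReal {q : S2 → ℝ} (hq : IsC2 q) (θ : S2) :
    LB (fun θ => (q θ : ℂ)) θ = ((LB q θ : ℝ) : ℂ) := LB_clm_comp Complex.ofRealCLM hq θ

lemma LB_conj {a : S2 → ℂ} (ha : IsC2 a) (θ : S2) :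
    LB (fun θ => (starRingEnd ℂ) (a θ)) θ = (starRingEnd ℂ) (LB a θ) :=
  LB_clm_comp (Complex.conjCLE : ℂ →L[ℝ] ℂ) ha θ

lemma LB_add {a b : S2 → F} (ha : IsC2 a) (hb : IsC2 b) (θ : S2) :
    LB (fun θ => a θ + b θ) θ = LB a θ + LB b θ := by
  have := (ha θ (coe_ne_zero θ)).laplacian_add (hb θ (coe_ne_zero θ))
  rw [LB, LB, LB, ← neg_add]
  congr 1

lemma LB_const (c : F) (θ : S2) : LB (fun _ : S2 => c) θ = 0 := by
  simp [LB, InnerProductSpace.laplacian_const]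

/-! ### Coordinate derivatives -/

/-- The partial derivative in the `i`-th coordinate direction. -/
noncomputable def pd (i : Fin 3) (g : E3 → F) (x : E3) : F :=
  fderiv ℝ g x (EuclideanSpace.single i 1)

lemma laplacian_eq_sum_pd {g : E3 → F} {x : E3} (hg : ContDiffAt ℝ 2 g x) :
    Laplacian.laplacian g x = ∑ i, pd i (pd i g) x := by
  rw [congrFun (InnerProductSpace.laplacian_eq_iteratedFDeriv_orthonormalBasis g
    (EuclideanSpace.basisFun (Fin 3) ℝ)) x]
  refine Finset.sum_congr rfl fun i _ => ?_
  rw [iteratedFDeriv_two_apply]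
  have h : DifferentiableAt ℝ (fderiv ℝ g) x :=
    (hg.fderiv_right (m := 1) (by norm_num)).differentiableAt (by norm_num)
  unfold pd
  rw [fderiv_clm_apply h (differentiableAt_const _)]
  simp

lemma contDiffAt_pd {g : E3 → F} {x : E3} (hg : ContDiffAt ℝ 2 g x) (i : Fin 3) :
    ContDiffAt ℝ 1 (pd i g) x :=
  (hg.fderiv_right (m := 1) (by norm_num)).clm_apply contDiffAt_const

/-- Differentiating a homogeneous function lowers its degree by one. The factor `m` is free so that
the rule iterates: `m = 1` for a radial extension, `m = c⁻¹` for its first derivatives. -/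
lemma pd_smul_of_homogeneous {g : E3 → F} {c m : ℝ} (hc : 0 < c) (hm : m ≠ 0)
    (hg : ∀ x, g (c • x) = m • g x) (i : Fin 3) (x : E3) :
    pd i g (c • x) = (c⁻¹ * m) • pd i g x := by
  have h1 : fderiv ℝ (fun y => g (c • y)) x = c • fderiv ℝ g (c • x) := by
    exact fderiv_comp_smul (𝕜 := ℝ) (f := g) (c := c)
  have h2 : (fun y => g (c • y)) = fun y => m • g y := funext hg
  have h3 : fderiv ℝ (fun y => m • g y) x = m • fderiv ℝ g x := by
    have := invertibleOfNonzero hm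
    exact fderiv_const_smul_of_invertible m
  rw [h2, h3] at h1
  have h4 := congrArg (fun l : E3 →L[ℝ] F => c⁻¹ • l (EuclideanSpace.single i 1)) h1
  simp only [_root_.smul_apply, smul_smul, inv_mul_cancel₀ hc.ne', one_smul] at h4
  exact h4.symm

lemma pd_mul {g h : E3 → ℂ} {x : E3} (hg : DifferentiableAt ℝ g x) (hh : DifferentiableAt ℝ h x)
    (i : Fin 3) : pd i (fun y => g y * h y) x = g x * pd i h x + h x * pd i g x := by
  simp [pd, fderiv_fun_mul hg hh]

/-- Euler's identity in degree zero: the extension is constant along the ray `t ↦ (1 + t) • x`. -/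
lemma radial_pd {a : S2 → ℂ} (ha : IsC2 a) {x : E3} (hx : x ≠ 0) :
    ∑ i, (x i : ℂ) * pd i (fun y => a (toS2 y)) x = 0 := by
  have hd : DifferentiableAt ℝ (fun y => a (toS2 y)) x := (ha x hx).differentiableAt (by norm_num)
  have h1 : HasDerivAt (fun t : ℝ => (1 + t) • x) x 0 := by
    simpa using ((hasDerivAt_id (0 : ℝ)).const_add 1).smul_const x
  have h2 : HasDerivAt (fun t : ℝ => a (toS2 ((1 + t) • x)))
      (fderiv ℝ (fun y => a (toS2 y)) x x) 0 := by
    refine HasFDerivAt.comp_hasDerivAt (0 : ℝ) (f := fun t : ℝ => (1 + t) • x)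
      (l := fun y => a (toS2 y)) ?_ h1
    simpa using hd.hasFDerivAt
  have h3 : HasDerivAt (fun t : ℝ => a (toS2 ((1 + t) • x))) 0 0 := by
    refine (hasDerivAt_const (0 : ℝ) (a (toS2 x))).congr_of_eventuallyEq ?_
    filter_upwards [lt_mem_nhds (show (-1 : ℝ) < 0 by norm_num)] with t ht
    rw [toS2_smul (by linarith)]
  have h4 := h2.unique h3
  have h5 : x = ∑ i, x i • EuclideanSpace.single i (1 : ℝ) := by
    have := (EuclideanSpace.basisFun (Fin 3) ℝ).sum_repr x
    simpa using this.symm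
  rw [← h4]
  conv_rhs => rw [h5]
  rw [map_sum]
  refine Finset.sum_congr rfl fun i _ => ?_
  rw [map_smul, pd, Complex.real_smul, ← h5]

end

/-! ### Green's formula on the sphere -/

instance : IsFiniteMeasure surf := by unfold surf; infer_instance

/-- Polar coordinates for a product of a radial and an angular factor. No integrability is required,
since Fubini for a product function also holds with the convention that divergent Bochner integrals
vanish. -/
lemma integral_radial_mul (κ : ℝ → ℂ) (h : S2 → ℂ) :
    ∫ x : E3, κ ‖x‖ * h (toS2 x) =
      (∫ r : Ioi (0 : ℝ), κ r ∂(Measure.volumeIoiPow 2)) * ∫ θ, h θ ∂surf := by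
  have hdim : Module.finrank ℝ E3 - 1 = 2 := by simp
  calc
    ∫ x : E3, κ ‖x‖ * h (toS2 x)
      = ∫ x : ({(0)}ᶜ : Set E3), κ ‖x.1‖ * h (toS2 x.1) ∂((volume : Measure E3).comap Subtype.val) := by
      rw [integral_subtype_comap (measurableSet_singleton _).compl
        fun x : E3 => κ ‖x‖ * h (toS2 x), restrict_compl_singleton]
    _ = ∫ p, h p.1 * κ p.2 ∂(surf.prod (.volumeIoiPow 2)) := by
      have := (volume : Measure E3).measurePreserving_homeomorphUnitSphereProd.integral_comp
        (Homeomorph.measurableEmbedding _) (fun p : S2 × Ioi (0 : ℝ) => h p.1 * κ p.2)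
      rw [hdim] at this
      rw [surf, ← this]
      congr 1
      funext x
      have hx : (x : E3) ≠ 0 := x.2
      have h1 : (homeomorphUnitSphereProd E3 x).1 = toS2 x := by
        ext1
        rw [homeomorphUnitSphereProd_apply_fst_coe, coe_toS2 hx]
      rw [h1, homeomorphUnitSphereProd_apply_snd_coe, mul_comm]
    _ = _ := by
      rw [integral_prod_mul (f := h) (g := fun r : Ioi (0 : ℝ) => κ r), mul_comm]

/-- A radial cutoff function supported in the shell `1/2 ≤ |x|² ≤ 3/2`. -/
noncomputable def shellBump : ContDiffBump (1 : ℝ) := ⟨1 / 4, 1 / 2, by norm_num, by norm_num⟩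

/-- The cutoff function, as a function on space. -/
noncomputable def shell (x : E3) : ℂ := (shellBump (‖x‖ ^ 2) : ℝ)

lemma shellBump_eq_zero {t : ℝ} (ht : t ∉ Ioo (1 / 2 : ℝ) (3 / 2)) : shellBump t = 0 := by
  refine shellBump.zero_of_le_dist ?_
  rw [Real.dist_eq]
  change (1 / 2 : ℝ) ≤ |t - 1|
  by_contra hcon
  push Not at hcon
  rw [abs_lt] at hcon
  exact ht ⟨by linarith, by linarith⟩

lemma shell_contDiff : ContDiff ℝ 2 shell := by
  have h : ContDiff ℝ 2 (fun x : E3 => (shellBump (‖x‖ ^ 2) : ℝ)) :=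
    shellBump.contDiff.comp (contDiff_norm_sq ℝ)
  exact Complex.ofRealCLM.contDiff.comp h

lemma shell_eventually_zero : shell =ᶠ[𝓝 0] 0 := by
  filter_upwards [Metric.ball_mem_nhds (0 : E3) (show (0 : ℝ) < 1 / 2 by norm_num)] with x hx
  rw [mem_ball_zero_iff] at hx
  have : shellBump (‖x‖ ^ 2) = 0 := by
    refine shellBump_eq_zero fun h => ?_
    nlinarith [h.1, norm_nonneg x]
  simp [shell, this]

lemma shell_eq_zero_of_two_le {x : E3} (hx : 2 ≤ ‖x‖) : shell x = 0 := by
  have : shellBump (‖x‖ ^ 2) = 0 := by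
    refine shellBump_eq_zero fun h => ?_
    nlinarith [h.2, norm_nonneg x]
  simp [shell, this]

lemma pd_shell (i : Fin 3) (x : E3) :
    pd i shell x = ((2 * deriv shellBump (‖x‖ ^ 2) : ℝ) : ℂ) * (x i : ℂ) := by
  have h1 : HasFDerivAt (fun y : E3 => ‖y‖ ^ 2) (2 • innerSL ℝ x) x :=
    (hasStrictFDerivAt_norm_sq x).hasFDerivAt
  have h2 : HasDerivAt shellBump (deriv shellBump (‖x‖ ^ 2)) (‖x‖ ^ 2) :=
    ((shellBump.contDiff (n := 1)).differentiable (by norm_num) _).hasDerivAt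
  have h3 := Complex.ofRealCLM.hasFDerivAt.comp x (h2.comp_hasFDerivAt x h1)
  have h4 : HasFDerivAt shell _ x := h3
  rw [pd, h4.fderiv]
  simp [EuclideanSpace.inner_single_right]
  ring

/-- The gradient form `Γ(a, b) = ∇a · ∇b` (complex bilinear) on the sphere. -/
noncomputable def gradForm (a b : S2 → ℂ) (θ : S2) : ℂ :=
  ∑ i, pd i (fun y => a (toS2 y)) θ * pd i (fun y => b (toS2 y)) θ

lemma integral_pd_eq_zero {G : E3 → ℂ} (hG : ContDiff ℝ 1 G) (hc : HasCompactSupport G)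
    (i : Fin 3) : Integrable (pd i G) ∧ ∫ x, pd i G x = 0 := by
  have hi : Integrable (pd i G) := by
    refine Continuous.integrable_of_hasCompactSupport ?_ ?_
    · exact (hG.continuous_fderiv (by norm_num)).clm_apply continuous_const
    · exact (hc.fderiv_apply ℝ (EuclideanSpace.single i (1 : ℝ)))
  refine ⟨hi, ?_⟩
  have := integral_mul_fderiv_eq_neg_fderiv_mul_of_integrable (μ := (volume : Measure E3))
    (f := fun _ : E3 => (1 : ℂ)) (g := G) (v := EuclideanSpace.single i (1 : ℝ))
    (by simp) (by simp only [one_mul]; exact hi)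
    (by simpa using hG.continuous.integrable_of_hasCompactSupport hc)
    (fun x _ => differentiableAt_const _) (fun x _ => hG.differentiable (by norm_num) x)
  simp only [one_mul, fderiv_fun_const, Pi.zero_apply, _root_.zero_apply, zero_mul,
    integral_zero, neg_zero] at this
  exact this

lemma continuous_pd_coe {a : S2 → ℂ} (ha : IsC2 a) (i : Fin 3) :
    Continuous fun θ : S2 => pd i (fun y => a (toS2 y)) θ := by
  rw [continuous_iff_continuousAt]
  intro θ
  exact ContinuousAt.comp (f := fun θ : S2 => (θ : E3)) (g := pd i (fun y => a (toS2 y)))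
    (contDiffAt_pd (ha θ (coe_ne_zero θ)) i).continuousAt continuous_subtype_val.continuousAt

lemma LB_eq_sum_pd {b : S2 → ℂ} (hb : IsC2 b) (θ : S2) :
    LB b θ = -∑ i, pd i (pd i (fun y => b (toS2 y))) (θ : E3) := by
  rw [LB, laplacian_eq_sum_pd (hb _ (coe_ne_zero _))]

lemma continuous_LB {b : S2 → ℂ} (hb : IsC2 b) : Continuous (LB b) := by
  have h1 : LB b = fun θ : S2 => -∑ i, pd i (pd i (fun y => b (toS2 y))) (θ : E3) :=
    funext (LB_eq_sum_pd hb)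
  rw [h1]
  refine Continuous.neg (continuous_finsetSum _ fun i _ => ?_)
  rw [continuous_iff_continuousAt]
  intro θ
  refine ContinuousAt.comp (f := fun θ : S2 => (θ : E3))
    (g := pd i (pd i (fun y => b (toS2 y)))) ?_ continuous_subtype_val.continuousAt
  exact (((contDiffAt_pd (hb θ (coe_ne_zero θ)) i).fderiv_right (m := 0)
    (by norm_num)).clm_apply contDiffAt_const).continuousAt

lemma continuous_gradForm {a b : S2 → ℂ} (ha : IsC2 a) (hb : IsC2 b) :
    Continuous (gradForm a b) :=
  continuous_finsetSum _ fun i _ => (continuous_pd_coe ha i).mul (continuous_pd_coe hb i)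

lemma integrable_surf {F : Type*} [NormedAddCommGroup F] {f : S2 → F} (hf : Continuous f) :
    Integrable f surf :=
  hf.integrable_of_hasCompactSupport (HasCompactSupport.of_compactSpace f)

/-- The Euclidean divergence theorem for the field `χ A ∇B`, where `A`, `B` are the radial
extensions and `χ` is the shell cutoff. Its divergence is a radial function times `Γ(a, b) - a LB
b`, so polar coordinates split its vanishing integral into a nonzero radial factor and the desired
spherical integral. -/
theorem green {a b : S2 → ℂ} (ha : IsC2 a) (hb : IsC2 b) :
    ∫ θ, a θ * LB b θ ∂surf = ∫ θ, gradForm a b θ ∂surf := by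
  set A : E3 → ℂ := fun y => a (toS2 y) with hA
  set B : E3 → ℂ := fun y => b (toS2 y) with hB
  set G : Fin 3 → E3 → ℂ := fun i x => shell x * (A x * pd i B x) with hGdef
  have hG0 : ∀ i, G i =ᶠ[𝓝 0] 0 := fun i => by
    filter_upwards [shell_eventually_zero] with x hx
    simp [G, hx]
  have hG : ∀ i, ContDiff ℝ 1 (G i) := by
    intro i
    rw [contDiff_iff_contDiffAt]
    intro x
    by_cases hx : x = 0
    · subst hx
      exact contDiffAt_const.congr_of_eventuallyEq (hG0 i)
    · exact (shell_contDiff.contDiffAt.of_le (by norm_num)).mul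
        (((ha x hx).of_le (by norm_num)).mul (contDiffAt_pd (hb x hx) i))
  have hGc : ∀ i, HasCompactSupport (G i) := by
    intro i
    refine HasCompactSupport.of_support_subset_isCompact
      (isCompact_closedBall (0 : E3) 2) fun x hx => ?_
    rw [mem_closedBall_zero_iff]
    by_contra hcon
    exact hx (by simp [G, shell_eq_zero_of_two_le (not_le.mp hcon).le])
  set h : S2 → ℂ := fun θ => gradForm a b θ - a θ * LB b θ with hh
  have hdiv : ∀ x : E3, x ≠ 0 → ∑ i, pd i (G i) x = ((shellBump (‖x‖ ^ 2) * (‖x‖ ^ 2)⁻¹ : ℝ) : ℂ)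
      * h (toS2 x) := by
    intro x hx
    have hAx : DifferentiableAt ℝ A x := (ha x hx).differentiableAt (by norm_num)
    have hBx : ∀ i, DifferentiableAt ℝ (pd i B) x := fun i =>
      (contDiffAt_pd (hb x hx) i).differentiableAt (by norm_num)
    have hsx : DifferentiableAt ℝ shell x :=
      shell_contDiff.contDiffAt.differentiableAt (by norm_num)
    have h1 : ∀ i, pd i (G i) x = shell x * (A x * pd i (pd i B) x + pd i B x * pd i A x)
        + A x * ((2 * deriv shellBump (‖x‖ ^ 2) : ℝ) : ℂ) * ((x i : ℂ) * pd i B x) := by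
      intro i
      rw [hGdef]
      simp only
      rw [pd_mul (g := shell) (h := fun x => A x * pd i B x) hsx (hAx.mul (hBx i)),
        pd_mul (g := A) (h := pd i B) hAx (hBx i), pd_shell]
      ring
    have hn : 0 < ‖x‖ := norm_pos_iff.mpr hx
    have hxs : x = ‖x‖ • (toS2 x : E3) := by
      rw [coe_toS2 hx, smul_smul, mul_inv_cancel₀ hn.ne', one_smul]
    have hA1 : ∀ i, pd i A x = (‖x‖⁻¹ * 1) • pd i A (toS2 x) := by
      intro i
      conv_lhs => rw [hxs]
      exact pd_smul_of_homogeneous hn one_ne_zero (fun y => by simp [A, toS2_smul hn]) i _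
    have hB1 : ∀ (i : Fin 3) (y : E3), pd i B (‖x‖ • y) = (‖x‖⁻¹ * 1) • pd i B y := by
      intro i y
      exact pd_smul_of_homogeneous hn one_ne_zero (fun y => by simp [B, toS2_smul hn]) i _
    have hB2 : ∀ i, pd i (pd i B) x = (‖x‖⁻¹ * (‖x‖⁻¹ * 1)) • pd i (pd i B) (toS2 x) := by
      intro i
      conv_lhs => rw [hxs]
      exact pd_smul_of_homogeneous hn (by positivity) (hB1 i) i _
    have hB3 : ∀ i, pd i B x = (‖x‖⁻¹ * 1) • pd i B (toS2 x) := by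
      intro i
      conv_lhs => rw [hxs]
      exact hB1 i _
    have hL : LB b (toS2 x) = -∑ i, pd i (pd i B) (toS2 x) := LB_eq_sum_pd hb _
    simp only [h1, Finset.sum_add_distrib, ← Finset.mul_sum]
    -- The derivative of the cutoff is radial, and the extension of `b` has no radial derivative.
    rw [radial_pd hb hx]
    rw [hh]
    simp only
    rw [hL, gradForm]
    simp only [hA1, hB2, hB3]
    simp only [mul_one, Complex.real_smul, shell, ← Finset.mul_sum, Complex.ofReal_mul,
      Complex.ofReal_inv, Complex.ofReal_pow, mul_zero, add_zero]
    have hAx' : A x = a (toS2 x) := rfl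
    rw [hAx']
    simp only [Fin.sum_univ_three]
    ring
  have hint : ∫ x, ∑ i, pd i (G i) x = 0 := by
    rw [integral_finsetSum _ fun i _ => (integral_pd_eq_zero (hG i) (hGc i) i).1]
    exact Finset.sum_eq_zero fun i _ => (integral_pd_eq_zero (hG i) (hGc i) i).2
  have hae : ∀ᵐ x : E3, x ≠ 0 := by
    have : (volume : Measure E3) {0} = 0 := measure_singleton _
    exact measure_eq_zero_iff_ae_notMem.mp this
  set κ : ℝ → ℂ := fun r => ((shellBump (r ^ 2) * (r ^ 2)⁻¹ : ℝ) : ℂ) with hκ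
  have hint2 : ∫ x : E3, κ ‖x‖ * h (toS2 x) = 0 := by
    rw [← hint]
    refine integral_congr_ae ?_
    filter_upwards [hae] with x hx
    rw [hdiv x hx]
  rw [integral_radial_mul] at hint2
  -- The polar formula with angular factor `1` would otherwise make the integral of a nonnegative
  -- continuous function, equal to `1` on the unit sphere, vanish.
  have hκ0 : (∫ r : Ioi (0 : ℝ), κ r ∂(Measure.volumeIoiPow 2)) ≠ 0 := by
    intro h0
    have h1 := integral_radial_mul κ (fun _ => 1)
    rw [h0, zero_mul] at h1
    simp only [mul_one, hκ] at h1
    rw [integral_complex_ofReal, Complex.ofReal_eq_zero] at h1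
    have hcont : Continuous fun x : E3 => shellBump (‖x‖ ^ 2) * (‖x‖ ^ 2)⁻¹ := by
      rw [continuous_iff_continuousAt]
      intro x
      by_cases hx : x = 0
      · subst hx
        refine (continuousAt_const (y := (0 : ℝ))).congr ?_
        filter_upwards [shell_eventually_zero] with x hx
        have : shellBump (‖x‖ ^ 2) = 0 := by
          simpa [shell] using hx
        simp [this]
      · exact (shellBump.continuous.comp (continuous_norm.pow 2)).continuousAt.mul
          ((continuous_norm.pow 2).continuousAt.inv₀ (by simpa using hx))
    have hpos := hcont.integral_pos_of_hasCompactSupport_nonneg_nonzero (μ := volume)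
      (x := ((toS2 0 : S2) : E3)) ?_ ?_ ?_
    · exact hpos.ne' h1
    · refine HasCompactSupport.of_support_subset_isCompact
        (isCompact_closedBall (0 : E3) 2) fun x hx => ?_
      rw [mem_closedBall_zero_iff]
      by_contra hcon
      have := shell_eq_zero_of_two_le (not_le.mp hcon).le
      refine hx ?_
      have h2 : shellBump (‖x‖ ^ 2) = 0 := by simpa [shell] using this
      simp [h2]
    · intro x
      exact mul_nonneg shellBump.nonneg (by positivity)
    · have h2 : ‖((toS2 0 : S2) : E3)‖ = 1 := mem_sphere_zero_iff_norm.mp (toS2 0).2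
      have h3 : shellBump (1 : ℝ) = 1 :=
        shellBump.one_of_mem_closedBall (by simp [shellBump.rIn_pos.le])
      rw [h2]
      simp [h3]
  have hfin := (mul_eq_zero.mp hint2).resolve_left hκ0
  have hsub := integral_sub (integrable_surf (continuous_gradForm ha hb))
    (integrable_surf (ha.continuous.mul (continuous_LB hb)))
  rw [show ∫ θ, h θ ∂surf = _ from hsub] at hfin
  exact (sub_eq_zero.mp hfin).symm

/-! ### Leibniz rules -/

lemma gradForm_comm (a b : S2 → ℂ) (θ : S2) : gradForm a b θ = gradForm b a θ := by
  simp [gradForm, mul_comm]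

lemma IsC2.differentiableAt {a : S2 → ℂ} (ha : IsC2 a) {x : E3} (hx : x ≠ 0) :
    DifferentiableAt ℝ (fun y => a (toS2 y)) x := (ha x hx).differentiableAt (by norm_num)

lemma IsC2.differentiableAt_pd {a : S2 → ℂ} (ha : IsC2 a) {x : E3} (hx : x ≠ 0) (i : Fin 3) :
    DifferentiableAt ℝ (pd i (fun y => a (toS2 y))) x :=
  (contDiffAt_pd (ha x hx) i).differentiableAt (by norm_num)

lemma gradForm_mul_left {a b : S2 → ℂ} (ha : IsC2 a) (hb : IsC2 b) (c : S2 → ℂ) (θ : S2) :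
    gradForm (fun θ => a θ * b θ) c θ = a θ * gradForm b c θ + b θ * gradForm a c θ := by
  simp only [gradForm]
  have h : ∀ i, pd i (fun y => a (toS2 y) * b (toS2 y)) (θ : E3)
      = a θ * pd i (fun y => b (toS2 y)) θ + b θ * pd i (fun y => a (toS2 y)) θ := by
    intro i
    rw [pd_mul (g := fun y => a (toS2 y)) (h := fun y => b (toS2 y))
      (ha.differentiableAt (coe_ne_zero θ)) (hb.differentiableAt (coe_ne_zero θ)), toS2_coe]
  simp only [h, Fin.sum_univ_three]
  ring

lemma gradForm_add_left {a b : S2 → ℂ} (ha : IsC2 a) (hb : IsC2 b) (c : S2 → ℂ) (θ : S2) :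
    gradForm (fun θ => a θ + b θ) c θ = gradForm a c θ + gradForm b c θ := by
  simp only [gradForm]
  have h : ∀ i, pd i (fun y => a (toS2 y) + b (toS2 y)) (θ : E3)
      = pd i (fun y => a (toS2 y)) θ + pd i (fun y => b (toS2 y)) θ := by
    intro i
    simp only [pd]
    rw [fderiv_fun_add (ha.differentiableAt (coe_ne_zero θ)) (hb.differentiableAt (coe_ne_zero θ))]
    rfl
  simp only [h, Fin.sum_univ_three]
  ring

lemma pd_const {F : Type*} [NormedAddCommGroup F] [NormedSpace ℝ F] (c : F) (i : Fin 3) (x : E3) :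
    pd i (fun _ : E3 => c) x = 0 := by
  simp [pd]

lemma pd_congr {F : Type*} [NormedAddCommGroup F] [NormedSpace ℝ F] {g h : E3 → F} {x : E3}
    (e : g =ᶠ[𝓝 x] h) (i : Fin 3) : pd i g x = pd i h x := by
  rw [pd, pd, e.fderiv_eq]

lemma pd_add {g h : E3 → ℂ} {x : E3} (hg : DifferentiableAt ℝ g x) (hh : DifferentiableAt ℝ h x)
    (i : Fin 3) : pd i (fun y => g y + h y) x = pd i g x + pd i h x := by
  simp [pd, fderiv_fun_add hg hh]

/-- `g` is differentiable at `x` with `i`-th partial derivative `d`. -/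
def HasPD (i : Fin 3) (g : E3 → ℂ) (d : ℂ) (x : E3) : Prop :=
  DifferentiableAt ℝ g x ∧ pd i g x = d

lemma HasPD.mul {i : Fin 3} {g h : E3 → ℂ} {d e : ℂ} {x : E3} (hg : HasPD i g d x)
    (hh : HasPD i h e x) : HasPD i (fun y => g y * h y) (g x * e + h x * d) x :=
  ⟨hg.1.mul hh.1, by rw [pd_mul hg.1 hh.1, hg.2, hh.2]⟩

lemma HasPD.add {i : Fin 3} {g h : E3 → ℂ} {d e : ℂ} {x : E3} (hg : HasPD i g d x)
    (hh : HasPD i h e x) : HasPD i (fun y => g y + h y) (d + e) x :=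
  ⟨hg.1.add hh.1, by rw [pd_add hg.1 hh.1, hg.2, hh.2]⟩

lemma HasPD.const (i : Fin 3) (c : ℂ) (x : E3) : HasPD i (fun _ => c) 0 x :=
  ⟨differentiableAt_const _, pd_const c i x⟩

lemma gradForm_const_left (c : ℂ) (b : S2 → ℂ) (θ : S2) : gradForm (fun _ => c) b θ = 0 := by
  simp [gradForm, pd_const]

/-- The gradient term carries a minus sign because `LB` is minus the Laplacian. -/
lemma LB_mul {a b : S2 → ℂ} (ha : IsC2 a) (hb : IsC2 b) (θ : S2) :
    LB (fun θ => a θ * b θ) θ = a θ * LB b θ + b θ * LB a θ - 2 * gradForm a b θ := by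
  have h : ∀ i, pd i (pd i (fun y => a (toS2 y) * b (toS2 y))) (θ : E3)
      = a θ * pd i (pd i (fun y => b (toS2 y))) θ + b θ * pd i (pd i (fun y => a (toS2 y))) θ
        + 2 * (pd i (fun y => a (toS2 y)) θ * pd i (fun y => b (toS2 y)) θ) := by
    intro i
    have hθ := coe_ne_zero θ
    have e : pd i (fun y => a (toS2 y) * b (toS2 y)) =ᶠ[𝓝 (θ : E3)]
        fun y => a (toS2 y) * pd i (fun y => b (toS2 y)) y
          + b (toS2 y) * pd i (fun y => a (toS2 y)) y := by
      filter_upwards [isOpen_ne.mem_nhds hθ] with y hy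
      exact pd_mul (ha.differentiableAt hy) (hb.differentiableAt hy) i
    have da : HasPD i (fun y => a (toS2 y)) _ (θ : E3) := ⟨ha.differentiableAt hθ, rfl⟩
    have db : HasPD i (fun y => b (toS2 y)) _ (θ : E3) := ⟨hb.differentiableAt hθ, rfl⟩
    have da' : HasPD i (pd i (fun y => a (toS2 y))) _ (θ : E3) :=
      ⟨ha.differentiableAt_pd hθ i, rfl⟩
    have db' : HasPD i (pd i (fun y => b (toS2 y))) _ (θ : E3) :=
      ⟨hb.differentiableAt_pd hθ i, rfl⟩
    rw [pd_congr e, ((da.mul db').add (db.mul da')).2, toS2_coe]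
    ring
  rw [LB_eq_sum_pd (ha.mul hb), LB_eq_sum_pd ha, LB_eq_sum_pd hb, gradForm]
  simp only [h, Fin.sum_univ_three]
  ring

/-! ### Coordinate functions -/

/-- The coordinate functions on the sphere, with complex values. -/
noncomputable def coordS (i : Fin 3) (θ : S2) : ℂ := (((θ : E3) i : ℝ) : ℂ)

lemma coordS_contMDiff (i : Fin 3) : ContMDiff (𝓡 2) 𝓘(ℝ, ℂ) ∞ (coordS i) := by
  have : Fact (Module.finrank ℝ E3 = 2 + 1) := ⟨finrank_euclideanSpace_fin⟩
  have h1 : ContMDiff (𝓡 2) 𝓘(ℝ, E3) ∞ (fun θ : S2 => (θ : E3)) := contMDiff_coe_sphere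
  have h2 : ContDiff ℝ ∞ (fun x : E3 => ((x i : ℝ) : ℂ)) :=
    (Complex.ofRealCLM.comp (EuclideanSpace.proj i : E3 →L[ℝ] ℝ)).contDiff
  exact h2.contMDiff.comp h1

lemma coordS_isC2 (i : Fin 3) : IsC2 (coordS i) := .of_contMDiff two_le_smooth (coordS_contMDiff i)

/-- The coordinate functions on space, with complex values. -/
noncomputable def coordE (i : Fin 3) (x : E3) : ℂ := ((x i : ℝ) : ℂ)

/-- The function `1 / |x|`, with complex values. -/
noncomputable def invNorm (x : E3) : ℂ := ((‖x‖⁻¹ : ℝ) : ℂ)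

lemma coordE_hasFDerivAt (i : Fin 3) (x : E3) :
    HasFDerivAt (coordE i) (Complex.ofRealCLM.comp (EuclideanSpace.proj i : E3 →L[ℝ] ℝ)) x :=
  (Complex.ofRealCLM.comp (EuclideanSpace.proj i : E3 →L[ℝ] ℝ)).hasFDerivAt

lemma pd_coordE (i j : Fin 3) (x : E3) : pd j (coordE i) x = if i = j then 1 else 0 := by
  rw [pd, (coordE_hasFDerivAt i x).fderiv]
  by_cases h : i = j <;> simp [h]

lemma invNorm_hasFDerivAt {x : E3} (hx : x ≠ 0) :
    HasFDerivAt invNorm (Complex.ofRealCLM.comp (-(‖x‖ ^ 3)⁻¹ • innerSL ℝ x)) x := by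
  have hn : ‖x‖ ≠ 0 := norm_ne_zero_iff.mpr hx
  have h1 : HasFDerivAt (fun y : E3 => ‖y‖ ^ 2) (2 • innerSL ℝ x) x :=
    (hasStrictFDerivAt_norm_sq x).hasFDerivAt
  have h2 := (h1.sqrt (by positivity))
  have h3 : HasFDerivAt (fun y : E3 => ‖y‖) (‖x‖⁻¹ • innerSL ℝ x) x := by
    have e : (fun y : E3 => √(‖y‖ ^ 2)) = fun y => ‖y‖ := by
      funext y
      exact Real.sqrt_sq (norm_nonneg y)
    rw [e, Real.sqrt_sq (norm_nonneg x)] at h2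
    refine h2.congr_fderiv ?_
    ext v
    simp
    field_simp
  have h4 := (hasDerivAt_inv hn).comp_hasFDerivAt x h3
  have h5 := Complex.ofRealCLM.hasFDerivAt.comp x h4
  have h6 : HasFDerivAt invNorm _ x := h5
  refine h6.congr_fderiv ?_
  ext v
  simp
  field_simp

lemma pd_invNorm {x : E3} (hx : x ≠ 0) (j : Fin 3) :
    pd j invNorm x = -(coordE j x * (invNorm x * (invNorm x * invNorm x))) := by
  rw [pd, (invNorm_hasFDerivAt hx).fderiv]
  simp [coordE, invNorm, EuclideanSpace.inner_single_right]
  ring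

lemma coordE_differentiableAt (i : Fin 3) (x : E3) : DifferentiableAt ℝ (coordE i) x :=
  (coordE_hasFDerivAt i x).differentiableAt

lemma invNorm_differentiableAt {x : E3} (hx : x ≠ 0) : DifferentiableAt ℝ invNorm x :=
  (invNorm_hasFDerivAt hx).differentiableAt

lemma coordS_toS2 (i : Fin 3) {x : E3} (hx : x ≠ 0) :
    coordS i (toS2 x) = coordE i x * invNorm x := by
  simp only [coordS, coordE, invNorm, coe_toS2 hx]
  simp [mul_comm]

lemma pd_coordS (i j : Fin 3) {x : E3} (hx : x ≠ 0) :
    pd j (fun y => coordS i (toS2 y)) x = (if i = j then 1 else 0) * invNorm x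
      - coordE i x * (coordE j x * (invNorm x * (invNorm x * invNorm x))) := by
  have e : (fun y => coordS i (toS2 y)) =ᶠ[𝓝 x] fun y => coordE i y * invNorm y := by
    filter_upwards [isOpen_ne.mem_nhds hx] with y hy
    exact coordS_toS2 i hy
  rw [pd_congr e, pd_mul (coordE_differentiableAt i x) (invNorm_differentiableAt hx), pd_coordE,
    pd_invNorm hx]
  ring

lemma invNorm_coe (θ : S2) : invNorm (θ : E3) = 1 := by
  have h1 : ‖(θ : E3)‖ = 1 := mem_sphere_zero_iff_norm.mp θ.2
  simp [invNorm, h1]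

lemma sum_coordS_sq (θ : S2) :
    coordS 0 θ * coordS 0 θ + coordS 1 θ * coordS 1 θ + coordS 2 θ * coordS 2 θ = 1 := by
  have h1 : ‖(θ : E3)‖ = 1 := mem_sphere_zero_iff_norm.mp θ.2
  have h2 := EuclideanSpace.real_norm_sq_eq (θ : E3)
  rw [h1, Fin.sum_univ_three] at h2
  simp only [coordS]
  norm_cast
  nlinarith

/-- The gradient of the radially extended coordinate is the tangential part `eᵢ - xᵢ x` of `eᵢ`. -/
lemma gradForm_coordS (i j : Fin 3) (θ : S2) :
    gradForm (coordS i) (coordS j) θ = (if i = j then 1 else 0) - coordS i θ * coordS j θ := by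
  have h := sum_coordS_sq θ
  have e : ∀ i, coordE i (θ : E3) = coordS i θ := fun _ => rfl
  simp only [gradForm, pd_coordS _ _ (coe_ne_zero θ), invNorm_coe, e, Fin.sum_univ_three]
  -- The two sides differ by `xᵢ xⱼ (|x|² - 1)`. Naming the product `c` lets one linear combination
  -- serve all nine index pairs.
  obtain ⟨c, hc⟩ : ∃ c, c = coordS i θ * coordS j θ := ⟨_, rfl⟩
  fin_cases i <;> fin_cases j <;> simp at hc ⊢ <;> linear_combination c * h -
    (coordS 0 θ * coordS 0 θ + coordS 1 θ * coordS 1 θ + coordS 2 θ * coordS 2 θ - 1) * hc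

/-- Coordinates are spherical harmonics of degree `ℓ = 1`, with eigenvalue `ℓ(ℓ + 1) = 2`. -/
lemma LB_coordS (i : Fin 3) (θ : S2) : LB (coordS i) θ = 2 * coordS i θ := by
  have hθ := coe_ne_zero θ
  have h : ∀ j, pd j (pd j (fun y => coordS i (toS2 y))) (θ : E3)
      = - (2 * ((if i = j then 1 else 0) * coordS j θ)) - coordS i θ
        + 3 * (coordS i θ * (coordS j θ * coordS j θ)) := by
    intro j
    have e : pd j (fun y => coordS i (toS2 y)) =ᶠ[𝓝 (θ : E3)]
        fun x => (if i = j then 1 else 0) * invNorm x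
          + (-1) * (coordE i x * (coordE j x * (invNorm x * (invNorm x * invNorm x)))) := by
      filter_upwards [isOpen_ne.mem_nhds hθ] with y hy
      rw [pd_coordS i j hy]
      ring
    have dn : HasPD j invNorm _ (θ : E3) := ⟨invNorm_differentiableAt hθ, pd_invNorm hθ j⟩
    have dx : ∀ i, HasPD j (coordE i) _ (θ : E3) :=
      fun i => ⟨coordE_differentiableAt i (θ : E3), pd_coordE i j _⟩
    rw [pd_congr e, (((HasPD.const j _ _).mul dn).add ((HasPD.const j _ _).mul
      ((dx i).mul ((dx j).mul (dn.mul (dn.mul dn)))))).2, invNorm_coe]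
    have e : ∀ i, coordE i (θ : E3) = coordS i θ := fun _ => rfl
    simp only [e, if_true]
    by_cases hij : i = j
    · subst hij; simp; ring
    · simp [hij]; ring
  have hs := sum_coordS_sq θ
  rw [LB_eq_sum_pd (coordS_isC2 i)]
  simp only [h, Fin.sum_univ_three]
  obtain ⟨c, hc⟩ : ∃ c, c = coordS i θ := ⟨_, rfl⟩
  fin_cases i <;> simp at hc ⊢ <;> linear_combination (-3 * c) * hs +
    3 * (coordS 0 θ * coordS 0 θ + coordS 1 θ * coordS 1 θ + coordS 2 θ * coordS 2 θ - 1) * hc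

/-! ### The Dirichlet form and the commutator estimate -/

lemma pd_conj {a : S2 → ℂ} (ha : IsC2 a) (i : Fin 3) (θ : S2) :
    pd i (fun y => conj (a (toS2 y))) (θ : E3) = conj (pd i (fun y => a (toS2 y)) (θ : E3)) := by
  have h : HasFDerivAt (fun y => conj (a (toS2 y))) _ (θ : E3) :=
    (Complex.conjCLE : ℂ →L[ℝ] ℂ).hasFDerivAt.comp (θ : E3)
      (ha.differentiableAt (coe_ne_zero θ)).hasFDerivAt
  rw [pd, h.fderiv]
  rfl

/-- The squared length of the gradient of a function on the sphere. -/
noncomputable def gradSq (a : S2 → ℂ) (θ : S2) : ℝ := ∑ i, ‖pd i (fun y => a (toS2 y)) (θ : E3)‖ ^ 2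

lemma gradSq_nonneg (a : S2 → ℂ) (θ : S2) : 0 ≤ gradSq a θ :=
  Finset.sum_nonneg fun _ _ => by positivity

lemma continuous_gradSq {a : S2 → ℂ} (ha : IsC2 a) : Continuous (gradSq a) :=
  continuous_finsetSum _ fun i _ => (continuous_pd_coe ha i).norm.pow 2

lemma gradForm_conj_self {a : S2 → ℂ} (ha : IsC2 a) (θ : S2) :
    gradForm (fun θ => conj (a θ)) a θ = (gradSq a θ : ℂ) := by
  simp only [gradForm, gradSq, Complex.ofReal_sum]
  refine Finset.sum_congr rfl fun i _ => ?_
  rw [pd_conj ha, Complex.conj_mul', Complex.ofReal_pow]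

lemma gradForm_ofReal_self {q : S2 → ℝ} (hq : IsC2 q) (θ : S2) :
    gradForm (fun θ => (q θ : ℂ)) (fun θ => (q θ : ℂ)) θ = (gradSq (fun θ => (q θ : ℂ)) θ : ℂ) := by
  rw [← gradForm_conj_self hq.ofReal]
  congr 1
  funext θ
  rw [Complex.conj_ofReal]

lemma gradSq_conj {a : S2 → ℂ} (ha : IsC2 a) (θ : S2) :
    gradSq (fun θ => conj (a θ)) θ = gradSq a θ := by
  simp only [gradSq]
  refine Finset.sum_congr rfl fun i _ => ?_
  rw [pd_conj ha, RCLike.norm_conj]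

/-- The Dirichlet integral of a function on the sphere. -/
noncomputable def dirichlet (a : S2 → ℂ) : ℝ := ∫ θ, gradSq a θ ∂surf

lemma dirichlet_nonneg (a : S2 → ℂ) : 0 ≤ dirichlet a := integral_nonneg (gradSq_nonneg a)

lemma integral_conj_mul_LB_self {a : S2 → ℂ} (ha : IsC2 a) :
    ∫ θ, conj (a θ) * LB a θ ∂surf = (dirichlet a : ℂ) := by
  rw [green ha.conj ha, dirichlet, ← integral_complex_ofReal]
  exact integral_congr_ae (.of_forall fun θ => gradForm_conj_self ha θ)

lemma integral_mul_LB_comm {a b : S2 → ℂ} (ha : IsC2 a) (hb : IsC2 b) :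
    ∫ θ, a θ * LB b θ ∂surf = ∫ θ, b θ * LB a θ ∂surf := by
  rw [green ha hb, green hb ha]
  exact integral_congr_ae (.of_forall fun θ => gradForm_comm a b θ)

/-- Cauchy–Schwarz with a free AM–GM weight `ε`. The weight is used twice: to absorb a gradient
term, and later, with a power of the time, to balance two growth rates. -/
lemma norm_mul_gradForm_le (c : ℂ) (a b : S2 → ℂ) (θ : S2) {ε : ℝ} (hε : 0 < ε) :
    2 * ‖c * gradForm a b θ‖ ≤ ε * (‖c‖ ^ 2 * gradSq a θ) + ε⁻¹ * gradSq b θ := by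
  have hpt : ∀ x y z : ℝ, 2 * (x * (y * z)) ≤ ε * (x ^ 2 * y ^ 2) + ε⁻¹ * z ^ 2 := by
    intro x y z
    have h : 0 ≤ ε⁻¹ * (ε * (x * y) - z) ^ 2 := by positivity
    have h2 : ε⁻¹ * (ε * (x * y) - z) ^ 2
        = ε * (x ^ 2 * y ^ 2) + ε⁻¹ * z ^ 2 - 2 * (x * (y * z)) := by
      field_simp
      ring
    linarith
  rw [norm_mul]
  calc 2 * (‖c‖ * ‖gradForm a b θ‖)
      ≤ 2 * (‖c‖ * ∑ i, ‖pd i (fun y => a (toS2 y)) (θ : E3)‖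
          * ‖pd i (fun y => b (toS2 y)) (θ : E3)‖) := by
        gcongr
        refine (norm_sum_le _ _).trans_eq ?_
        simp
    _ = ∑ i, 2 * (‖c‖ * (‖pd i (fun y => a (toS2 y)) (θ : E3)‖
          * ‖pd i (fun y => b (toS2 y)) (θ : E3)‖)) := by
        rw [Finset.mul_sum, Finset.mul_sum]
    _ ≤ ∑ i, (ε * (‖c‖ ^ 2 * ‖pd i (fun y => a (toS2 y)) (θ : E3)‖ ^ 2)
          + ε⁻¹ * ‖pd i (fun y => b (toS2 y)) (θ : E3)‖ ^ 2) :=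
        Finset.sum_le_sum fun i _ => hpt _ _ _
    _ = _ := by
        rw [Finset.sum_add_distrib, gradSq, gradSq, Finset.mul_sum, Finset.mul_sum, Finset.mul_sum]

/-- Conditions A1 give no bound on `∇Q`, so one gradient is moved by Green's formula: the integral
of `|v|² |∇Q|²` equals that of `Q |v|² BQ` minus that of `Q ∇Q·∇|v|²`. Half of the left side absorbs
the part of the last term that still contains `∇Q`. -/
lemma integral_normSq_mul_gradSq_le {v : S2 → ℂ} {Q : S2 → ℝ} (hv : IsC2 v) (hQ : IsC2 Q)
    {q b : ℝ} (hq : ∀ θ, |Q θ| ≤ q) (hb : ∀ θ, |LB Q θ| ≤ b) :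
    ∫ θ, ‖v θ‖ ^ 2 * gradSq (fun θ => (Q θ : ℂ)) θ ∂surf
      ≤ 2 * (q * b) * ∫ θ, ‖v θ‖ ^ 2 ∂surf + 4 * q ^ 2 * dirichlet v := by
  have hq0 : 0 ≤ q := (abs_nonneg _).trans (hq (toS2 0))
  set R : S2 → ℂ := fun θ => (Q θ : ℂ) with hR
  set w : S2 → ℂ := fun θ => conj (v θ) with hw
  have hRC : IsC2 R := hQ.ofReal
  have hwC : IsC2 w := hv.conj
  have hg := green (hRC.mul (hwC.mul hv)) hRC
  have c1 : Continuous fun θ => ‖v θ‖ ^ 2 * gradSq R θ :=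
    (hv.continuous.norm.pow 2).mul (continuous_gradSq hRC)
  have hpt2 : ∀ θ, ‖v θ‖ ^ 2 * gradSq R θ ≤ (gradForm (fun θ => R θ * (w θ * v θ)) R θ).re
      + (1 / 2 * (‖v θ‖ ^ 2 * gradSq R θ) + 2 * q ^ 2 * gradSq v θ) := by
    intro θ
    have e1 : gradForm (fun θ => R θ * (w θ * v θ)) R θ = ((‖v θ‖ ^ 2 * gradSq R θ : ℝ) : ℂ)
        + (R θ * v θ * gradForm R w θ + R θ * w θ * gradForm R v θ) := by
      rw [gradForm_mul_left hRC (hwC.mul hv), gradForm_mul_left hwC hv, hR,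
        gradForm_ofReal_self hQ, ← hR, gradForm_comm v R, gradForm_comm w R]
      have e2 : w θ * v θ = ((‖v θ‖ ^ 2 : ℝ) : ℂ) := by
        rw [hw, Complex.ofReal_pow]
        exact Complex.conj_mul' (v θ)
      rw [e2]
      push_cast
      ring
    -- This serves both halves of `∇|v|² = v ∇(conj v) + conj v ∇v`; a quarter from each adds up to
    -- the half that is absorbed.
    have key : ∀ s : S2 → ℂ, ∀ z : ℂ, ‖z‖ = ‖v θ‖ → gradSq s θ = gradSq v θ →
        ‖R θ * z * gradForm R s θ‖ ≤ 1 / 4 * (‖v θ‖ ^ 2 * gradSq R θ) + q ^ 2 * gradSq v θ := by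
      intro s z hz hs
      have hRq : ‖R θ‖ ≤ q := by
        rw [hR, Complex.norm_real]
        exact hq θ
      have h1 : ‖R θ * z * gradForm R s θ‖ ≤ q * ‖z * gradForm R s θ‖ := by
        rw [mul_assoc, norm_mul]
        gcongr
      rcases hq0.eq_or_lt with h0 | hpos
      · rw [← h0] at h1 ⊢
        have := mul_nonneg (sq_nonneg ‖v θ‖) (gradSq_nonneg R θ)
        nlinarith
      -- After multiplication by `q`, the weight `(2q)⁻¹` leaves the coefficient `1/4` on the term
      -- to be absorbed. The case `q = 0` is trivial and was split off above.
      · have h2 := norm_mul_gradForm_le z R s θ (ε := (2 * q)⁻¹) (by positivity)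
        rw [hz, hs, inv_inv] at h2
        have h3 : q * (2 * ‖z * gradForm R s θ‖) ≤ q * ((2 * q)⁻¹ * (‖v θ‖ ^ 2 * gradSq R θ)
          + 2 * q * gradSq v θ) := by gcongr
        have h4 : q * ((2 * q)⁻¹ * (‖v θ‖ ^ 2 * gradSq R θ) + 2 * q * gradSq v θ)
          = 1 / 2 * (‖v θ‖ ^ 2 * gradSq R θ) + 2 * q ^ 2 * gradSq v θ := by
          field_simp
        linarith
    have k1 := key w (v θ) rfl (gradSq_conj hv θ)
    have k2 := key v (w θ) (RCLike.norm_conj _) rfl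
    have r1 := (abs_le.mp (Complex.abs_re_le_norm (R θ * v θ * gradForm R w θ))).1
    have r2 := (abs_le.mp (Complex.abs_re_le_norm (R θ * w θ * gradForm R v θ))).1
    rw [e1, Complex.add_re, Complex.add_re, Complex.ofReal_re]
    linarith
  have cg : Continuous (gradForm (fun θ => R θ * (w θ * v θ)) R) :=
    continuous_gradForm (hRC.mul (hwC.mul hv)) hRC
  have hI : ∫ θ, ‖v θ‖ ^ 2 * gradSq R θ ∂surf ≤
      (∫ θ, gradForm (fun θ => R θ * (w θ * v θ)) R θ ∂surf).re
      + (1 / 2 * ∫ θ, ‖v θ‖ ^ 2 * gradSq R θ ∂surf + 2 * q ^ 2 * dirichlet v) := by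
    have := integral_mono (integrable_surf c1) (integrable_surf
      ((Complex.continuous_re.comp cg).add ((c1.const_mul (1 / 2)).add
        ((continuous_gradSq hv).const_mul (2 * q ^ 2))))) hpt2
    refine this.trans_eq ?_
    have k1 : Integrable (fun θ => (gradForm (fun θ => R θ * (w θ * v θ)) R θ).re) surf :=
      integrable_surf (Complex.continuous_re.comp cg)
    have k2 : Integrable (fun θ => 1 / 2 * (‖v θ‖ ^ 2 * gradSq R θ)) surf :=
      integrable_surf (c1.const_mul (1 / 2))
    have k3 : Integrable (fun θ => 2 * q ^ 2 * gradSq v θ) surf :=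
      integrable_surf ((continuous_gradSq hv).const_mul (2 * q ^ 2))
    refine (integral_add k1 (k2.add k3)).trans ?_
    refine congrArg₂ (· + ·) (integral_re (integrable_surf cg)) ((integral_add k2 k3).trans ?_)
    rw [integral_const_mul, integral_const_mul, dirichlet]
  rw [← hg] at hI
  have hJ : (∫ θ, R θ * (w θ * v θ) * LB R θ ∂surf).re ≤ q * b * ∫ θ, ‖v θ‖ ^ 2 ∂surf := by
    refine (Complex.re_le_norm _).trans ?_
    rw [← integral_const_mul]
    refine norm_integral_le_of_norm_le
      (integrable_surf ((hv.continuous.norm.pow 2).const_mul (q * b))) (.of_forall fun θ => ?_)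
    rw [norm_mul, norm_mul, norm_mul, hR, LB_ofReal hQ, hw, Complex.norm_real, Complex.norm_real,
      RCLike.norm_conj, Real.norm_eq_abs, Real.norm_eq_abs]
    calc |Q θ| * (‖v θ‖ * ‖v θ‖) * |LB Q θ| = |Q θ| * |LB Q θ| * ‖v θ‖ ^ 2 := by ring
      _ ≤ q * b * ‖v θ‖ ^ 2 := by
        gcongr
        · exact hq θ
        · exact hb θ
  linarith

/-- The weak form of `(BQ) u - B(Qu) + Q(Bu) = 2 Γ(Q, u)`: Green's formula applied to each integral
leaves only the first-order term. The estimate then combines weighted AM–GM with the bound on `|v|²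
|∇Q|²`. -/
theorem commutator_bound {u v : S2 → ℂ} {Q : S2 → ℝ} (hu : IsC2 u) (hv : IsC2 v) (hQ : IsC2 Q)
    {q b ε : ℝ} (hq : ∀ θ, |Q θ| ≤ q) (hb : ∀ θ, |LB Q θ| ≤ b) (hε : 0 < ε) :
    ‖∫ θ, conj (v θ) * (((LB Q θ : ℝ) : ℂ) * u θ) ∂surf - ∫ θ, conj (LB v θ) * ((Q θ : ℂ) * u θ) ∂surf
        + ∫ θ, conj (v θ) * ((Q θ : ℂ) * LB u θ) ∂surf‖
      ≤ ε * (2 * (q * b) * ∫ θ, ‖v θ‖ ^ 2 ∂surf + 4 * q ^ 2 * dirichlet v)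
        + ε⁻¹ * dirichlet u := by
  set R : S2 → ℂ := fun θ => (Q θ : ℂ) with hR
  set w : S2 → ℂ := fun θ => conj (v θ) with hw
  have hRC : IsC2 R := hQ.ofReal
  have hwC : IsC2 w := hv.conj
  have i1 : ∫ θ, w θ * (((LB Q θ : ℝ) : ℂ) * u θ) ∂surf
      = ∫ θ, (u θ * gradForm R w θ + w θ * gradForm R u θ) ∂surf := by
    refine (integral_congr_ae (.of_forall fun θ => ?_)).trans
      ((green (hu.mul hwC) hRC).trans (integral_congr_ae (.of_forall fun θ => ?_)))
    · rw [show LB R θ = ((LB Q θ : ℝ) : ℂ) from LB_ofReal hQ θ]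
      ring
    · rw [gradForm_mul_left hu hwC, gradForm_comm w R, gradForm_comm u R]
  have i2 : ∫ θ, conj (LB v θ) * (R θ * u θ) ∂surf
      = ∫ θ, (R θ * gradForm u w θ + u θ * gradForm R w θ) ∂surf := by
    refine (integral_congr_ae (.of_forall fun θ => ?_)).trans
      ((green (hRC.mul hu) hwC).trans (integral_congr_ae (.of_forall fun θ => ?_)))
    · rw [show LB w θ = conj (LB v θ) from LB_conj hv θ]
      ring
    · rw [gradForm_mul_left hRC hu]
  have i3 : ∫ θ, w θ * (R θ * LB u θ) ∂surf
      = ∫ θ, (R θ * gradForm u w θ + w θ * gradForm R u θ) ∂surf := by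
    refine (integral_congr_ae (.of_forall fun θ => ?_)).trans
      ((green (hRC.mul hwC) hu).trans (integral_congr_ae (.of_forall fun θ => ?_)))
    · ring
    · rw [gradForm_mul_left hRC hwC, gradForm_comm w u]
  have c1 := (hu.continuous.mul (continuous_gradForm hRC hwC))
  have c2 := (hwC.continuous.mul (continuous_gradForm hRC hu))
  have c3 := (hRC.continuous.mul (continuous_gradForm hu hwC))
  have e : ∫ θ, w θ * (((LB Q θ : ℝ) : ℂ) * u θ) ∂surf - ∫ θ, conj (LB v θ) * (R θ * u θ) ∂surf
        + ∫ θ, w θ * (R θ * LB u θ) ∂surf = 2 * ∫ θ, w θ * gradForm R u θ ∂surf := by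
    have s1 := integral_add (integrable_surf c1) (integrable_surf c2)
    have s2 := integral_add (integrable_surf c3) (integrable_surf c1)
    have s3 := integral_add (integrable_surf c3) (integrable_surf c2)
    simp only [Pi.mul_apply] at s1 s2 s3
    rw [i1, i2, i3, s1, s2, s3]
    ring
  rw [e, norm_mul]
  have hb2 : ‖∫ θ, w θ * gradForm R u θ ∂surf‖ ≤
      ∫ θ, 1 / 2 * (ε * (‖v θ‖ ^ 2 * gradSq R θ) + ε⁻¹ * gradSq u θ) ∂surf := by
    refine norm_integral_le_of_norm_le (integrable_surf ?_) (.of_forall fun θ => ?_)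
    · exact ((((hv.continuous.norm.pow 2).mul (continuous_gradSq hRC)).const_mul ε).add
        ((continuous_gradSq hu).const_mul ε⁻¹)).const_mul (1 / 2)
    · have := norm_mul_gradForm_le (w θ) R u θ hε
      rw [show ‖w θ‖ = ‖v θ‖ from RCLike.norm_conj _] at this
      linarith
  have s := integral_add (integrable_surf
    (((hv.continuous.norm.pow 2).mul (continuous_gradSq hRC)).const_mul ε))
    (integrable_surf ((continuous_gradSq hu).const_mul ε⁻¹))
  simp only [Pi.mul_apply, Pi.pow_apply] at s
  rw [integral_const_mul, s, integral_const_mul, integral_const_mul] at hb2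
  have h3 := integral_normSq_mul_gradSq_le hv hQ hq hb
  have h4 := mul_le_mul_of_nonneg_left h3 hε.le
  have h5 : ‖(2 : ℂ)‖ = 2 := by simp
  rw [h5]
  rw [show ∫ θ, gradSq u θ ∂surf = dirichlet u from rfl] at hb2
  linarith

/-! ### Polynomials on the sphere -/

/-- The coordinate functions on the sphere, as continuous maps. -/
noncomputable def coordC (i : Fin 3) : C(S2, ℂ) := ⟨coordS i, (coordS_isC2 i).continuous⟩

/-- The span of the constants and the coordinate functions. -/
noncomputable def affineS : Submodule ℂ C(S2, ℂ) := Submodule.span ℂ (insert 1 (range coordC))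

/-- Restrictions to the sphere of polynomials of degree at most `n`. -/
noncomputable def polyS (n : ℕ) : Submodule ℂ C(S2, ℂ) := affineS ^ n

lemma one_mem_affineS : (1 : C(S2, ℂ)) ∈ affineS := Submodule.subset_span (mem_insert _ _)

lemma coordC_mem_affineS (i : Fin 3) : coordC i ∈ affineS :=
  Submodule.subset_span (mem_insert_of_mem _ (mem_range_self i))

lemma polyS_add (m n : ℕ) : polyS (m + n) = polyS m * polyS n := pow_add affineS m n

lemma polyS_one : polyS 1 = affineS := pow_one affineS

lemma polyS_mono {m n : ℕ} (h : m ≤ n) : polyS m ≤ polyS n :=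
  pow_le_pow_right₀ (Submodule.one_le.mpr one_mem_affineS) h

lemma polyS_fg (n : ℕ) : (polyS n).FG := by
  refine Submodule.FG.pow ?_ n
  exact Submodule.fg_span ((finite_range coordC).insert 1)

lemma coordC_mul_mem {n : ℕ} {p : C(S2, ℂ)} (i : Fin 3) (hp : p ∈ polyS n) :
    coordC i * p ∈ polyS (n + 1) := by
  rw [add_comm, polyS_add, polyS_one]
  exact Submodule.mul_mem_mul (coordC_mem_affineS i) hp

lemma contMDiff_mul {a b : S2 → ℂ} (ha : ContMDiff (𝓡 2) 𝓘(ℝ, ℂ) ∞ a)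
    (hb : ContMDiff (𝓡 2) 𝓘(ℝ, ℂ) ∞ b) : ContMDiff (𝓡 2) 𝓘(ℝ, ℂ) ∞ (fun θ => a θ * b θ) :=
  (contDiff_mul (𝕜 := ℝ) (𝔸 := ℂ)).comp_contMDiff (ha.prodMk_space hb)

/-- `p` is smooth, and `LB p` and the `Γ(xᵢ, p)` are polynomials of the expected degrees. -/
structure PolyRegular (n : ℕ) (p : C(S2, ℂ)) : Prop where
  smooth : ContMDiff (𝓡 2) 𝓘(ℝ, ℂ) ∞ p
  lb : ∃ l ∈ polyS n, ∀ θ, l θ = LB p θ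
  grad : ∀ i, ∃ l ∈ polyS (n + 1), ∀ θ, l θ = gradForm (coordS i) p θ

lemma PolyRegular.isC2 {n : ℕ} {p : C(S2, ℂ)} (h : PolyRegular n p) : IsC2 p :=
  .of_contMDiff two_le_smooth h.smooth

lemma PolyRegular.const (n : ℕ) (c : ℂ) : PolyRegular n (algebraMap ℂ C(S2, ℂ) c) where
  smooth := contMDiff_const
  lb := ⟨0, zero_mem _, fun θ => (LB_const c θ).symm⟩
  grad i := ⟨0, zero_mem _, fun θ => by
    rw [gradForm_comm]
    exact (gradForm_const_left c _ θ).symm⟩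

lemma PolyRegular.mono {m n : ℕ} (h : m ≤ n) {p : C(S2, ℂ)} (hp : PolyRegular m p) :
    PolyRegular n p where
  smooth := hp.smooth
  lb := by
    obtain ⟨l, hl, e⟩ := hp.lb
    exact ⟨l, polyS_mono h hl, e⟩
  grad i := by
    obtain ⟨l, hl, e⟩ := hp.grad i
    exact ⟨l, polyS_mono (by lia) hl, e⟩

lemma PolyRegular.add {n : ℕ} {p q : C(S2, ℂ)} (hp : PolyRegular n p) (hq : PolyRegular n q) :
    PolyRegular n (p + q) where
  smooth := hp.smooth.add hq.smooth
  lb := by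
    obtain ⟨l, hl, e⟩ := hp.lb
    obtain ⟨m, hm, f⟩ := hq.lb
    exact ⟨l + m, add_mem hl hm, fun θ => by
      rw [ContinuousMap.add_apply, e, f]
      exact (LB_add hp.isC2 hq.isC2 θ).symm⟩
  grad i := by
    obtain ⟨l, hl, e⟩ := hp.grad i
    obtain ⟨m, hm, f⟩ := hq.grad i
    exact ⟨l + m, add_mem hl hm, fun θ => by
      rw [ContinuousMap.add_apply, e, f, gradForm_comm _ p, gradForm_comm _ q,
        gradForm_comm _ (p + q : C(S2, ℂ))]
      exact (gradForm_add_left hp.isC2 hq.isC2 _ θ).symm⟩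

lemma PolyRegular.smul {n : ℕ} {p : C(S2, ℂ)} (c : ℂ) (hp : PolyRegular n p) :
    PolyRegular n (c • p) where
  smooth := contMDiff_mul contMDiff_const hp.smooth
  lb := by
    obtain ⟨l, hl, e⟩ := hp.lb
    refine ⟨c • l, Submodule.smul_mem _ _ hl, fun θ => ?_⟩
    have h := LB_mul (IsC2.const c) hp.isC2 θ
    rw [LB_const, gradForm_const_left] at h
    rw [ContinuousMap.smul_apply, e, smul_eq_mul]
    refine Eq.trans ?_ h.symm
    ring
  grad i := by
    obtain ⟨l, hl, e⟩ := hp.grad i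
    refine ⟨c • l, Submodule.smul_mem _ _ hl, fun θ => ?_⟩
    have h := gradForm_mul_left (IsC2.const c) hp.isC2 (coordS i) θ
    rw [gradForm_const_left] at h
    rw [ContinuousMap.smul_apply, e, smul_eq_mul, gradForm_comm _ (c • p : C(S2, ℂ)),
      gradForm_comm _ p]
    refine Eq.trans ?_ h.symm
    ring

/-- The Leibniz rule gives `B(xᵢ p) = xᵢ Bp + 2 xᵢ p - 2 Γ(xᵢ, p)`, so controlling the degree of `B
p` by induction forces the induction to carry `Γ(xᵢ, p)` as well. -/
lemma PolyRegular.coord_mul {n : ℕ} {p : C(S2, ℂ)} (hpn : p ∈ polyS n) (hp : PolyRegular n p)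
    (i : Fin 3) : PolyRegular (n + 1) (coordC i * p) where
  smooth := contMDiff_mul (coordS_contMDiff i) hp.smooth
  lb := by
    obtain ⟨l, hl, e⟩ := hp.lb
    obtain ⟨m, hm, f⟩ := hp.grad i
    refine ⟨coordC i * l + (2 : ℂ) • (coordC i * p) - (2 : ℂ) • m,
      sub_mem (add_mem (coordC_mul_mem i hl) (Submodule.smul_mem _ _ (coordC_mul_mem i hpn)))
        (Submodule.smul_mem _ _ hm), fun θ => ?_⟩
    have h := LB_mul (coordS_isC2 i) hp.isC2 θ
    rw [LB_coordS] at h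
    simp only [ContinuousMap.sub_apply, ContinuousMap.add_apply, ContinuousMap.smul_apply,
      ContinuousMap.mul_apply, e, f, smul_eq_mul]
    refine Eq.trans ?_ h.symm
    simp only [coordC, ContinuousMap.coe_mk]
    ring
  grad j := by
    obtain ⟨m, hm, f⟩ := hp.grad j
    refine ⟨coordC i * m + ((if i = j then (1 : ℂ) else 0) • p - coordC j * (coordC i * p)),
      add_mem (coordC_mul_mem i hm) (sub_mem (Submodule.smul_mem _ _ (polyS_mono (by lia) hpn))
        (coordC_mul_mem j (coordC_mul_mem i hpn))), fun θ => ?_⟩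
    have h := gradForm_mul_left (coordS_isC2 i) hp.isC2 (coordS j) θ
    rw [gradForm_coordS, gradForm_comm] at h
    simp only [ContinuousMap.sub_apply, ContinuousMap.add_apply, ContinuousMap.smul_apply,
      ContinuousMap.mul_apply, f, smul_eq_mul]
    rw [gradForm_comm]
    refine Eq.trans ?_ h.symm
    simp only [coordC, ContinuousMap.coe_mk]
    ring

lemma polyRegular_of_mem {n : ℕ} {p : C(S2, ℂ)} (hp : p ∈ polyS n) : PolyRegular n p := by
  induction hp using Submodule.pow_induction_on_left' with
  | algebraMap r => exact .const 0 r
  | add x y i hx hy h1 h2 => exact h1.add h2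
  | mem_mul m hm i x hx h =>
    have : ∀ m ∈ affineS, PolyRegular (i + 1) (m * x) := by
      intro m hm
      induction hm using Submodule.span_induction with
      | mem z hz =>
        rcases hz with rfl | ⟨j, rfl⟩
        · rw [one_mul]
          exact h.mono (by lia)
        · exact h.coord_mul hx j
      | zero => simpa using PolyRegular.const (i + 1) 0
      | add y z _ _ hy hz =>
        rw [add_mul]
        exact hy.add hz
      | smul c y _ hy =>
        rw [smul_mul_assoc]
        exact hy.smul c
    exact this m hm

lemma exists_mem_polyS_of_mem_adjoin {p : C(S2, ℂ)}
    (hp : p ∈ StarAlgebra.adjoin ℂ (range coordC)) : ∃ n, p ∈ polyS n := by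
  -- Carrying `p` and `star p` together makes the `star` case of the induction immediate.
  have key : (∃ n, p ∈ polyS n) ∧ ∃ n, star p ∈ polyS n := by
    induction hp using StarAlgebra.adjoin_induction with
    | mem x hx =>
      obtain ⟨i, rfl⟩ := hx
      have h1 : coordC i ∈ polyS 1 := by
        rw [polyS_one]
        exact coordC_mem_affineS i
      have h2 : star (coordC i) = coordC i := by
        ext θ
        simp [coordC, coordS]
      exact ⟨⟨1, h1⟩, ⟨1, by rwa [h2]⟩⟩
    | algebraMap r =>
      have h1 : ∀ r : ℂ, algebraMap ℂ C(S2, ℂ) r ∈ polyS 0 := fun r => by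
        rw [polyS, Submodule.pow_zero]
        exact Submodule.algebraMap_mem r
      refine ⟨⟨0, h1 r⟩, ⟨0, ?_⟩⟩
      have h2 : star (algebraMap ℂ C(S2, ℂ) r) = algebraMap ℂ C(S2, ℂ) (star r) := by
        ext θ
        simp
      rw [h2]
      exact h1 _
    | add x y _ _ hx hy =>
      obtain ⟨⟨a, ha⟩, ⟨b, hb⟩⟩ := hx
      obtain ⟨⟨c, hc⟩, ⟨d, hd⟩⟩ := hy
      refine ⟨⟨max a c, add_mem (polyS_mono (le_max_left _ _) ha)
        (polyS_mono (le_max_right _ _) hc)⟩, ⟨max b d, ?_⟩⟩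
      rw [star_add]
      exact add_mem (polyS_mono (le_max_left _ _) hb) (polyS_mono (le_max_right _ _) hd)
    | mul x y _ _ hx hy =>
      obtain ⟨⟨a, ha⟩, ⟨b, hb⟩⟩ := hx
      obtain ⟨⟨c, hc⟩, ⟨d, hd⟩⟩ := hy
      refine ⟨⟨a + c, ?_⟩, ⟨d + b, ?_⟩⟩
      · rw [polyS_add]
        exact Submodule.mul_mem_mul ha hc
      · rw [polyS_add, star_mul]
        exact Submodule.mul_mem_mul hd hb
    | star x _ hx => exact ⟨hx.2, by simpa using hx.1⟩
  exact key.1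

/-- The inclusion of continuous functions on the sphere into `L²(Σ)`. -/
noncomputable def toL2 : C(S2, ℂ) →L[ℂ] L2S := ContinuousMap.toLp 2 surf ℂ

lemma coeFn_toL2 (a : C(S2, ℂ)) : ⇑(toL2 a) =ᵐ[surf] a := ContinuousMap.coeFn_toLp surf a

lemma inner_toL2 (a b : C(S2, ℂ)) : ⟪toL2 a, toL2 b⟫_ℂ = ∫ θ, conj (a θ) * b θ ∂surf := by
  rw [toL2, ContinuousMap.inner_toLp]
  exact integral_congr_ae (.of_forall fun θ => mul_comm _ _)

/-- The image in `L²(Σ)` of the polynomials of degree at most `n`. -/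
noncomputable def polyL2 (n : ℕ) : Submodule ℂ L2S := (polyS n).map (toL2 : C(S2, ℂ) →ₗ[ℂ] L2S)

instance (n : ℕ) : FiniteDimensional ℂ (polyL2 n) :=
  Module.Finite.iff_fg.mpr ((polyS_fg n).map _)

lemma polyL2_mono {m n : ℕ} (h : m ≤ n) : polyL2 m ≤ polyL2 n := Submodule.map_mono (polyS_mono h)

/-- Stone–Weierstrass in the uniform norm, then density of continuous functions in `L²`. -/
lemma dense_iUnion_polyL2 : Dense (⋃ n, (polyL2 n : Set L2S)) := by
  have hA : (StarAlgebra.adjoin ℂ (range coordC)).topologicalClosure = ⊤ := by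
    refine ContinuousMap.starSubalgebra_topologicalClosure_eq_top_of_separatesPoints _ ?_
    intro x y hxy
    by_contra hcon
    refine hxy (Subtype.ext ?_)
    ext i
    by_contra hne
    refine hcon ⟨coordC i, ⟨coordC i, StarAlgebra.subset_adjoin ℂ _ (mem_range_self i), rfl⟩, ?_⟩
    intro h
    exact hne (Complex.ofReal_injective h)
  have hd : DenseRange toL2 := ContinuousMap.toLp_denseRange ℂ surf ℂ (by norm_num)
  have hd2 : Dense ((StarAlgebra.adjoin ℂ (range coordC) : StarSubalgebra ℂ C(S2, ℂ)) :
      Set C(S2, ℂ)) := by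
    rw [dense_iff_closure_eq, ← StarSubalgebra.topologicalClosure_coe, hA]
    rfl
  refine (hd.dense_image toL2.continuous hd2).mono ?_
  rintro _ ⟨p, hp, rfl⟩
  obtain ⟨n, hn⟩ := exists_mem_polyS_of_mem_adjoin hp
  exact mem_iUnion.mpr ⟨n, p, hn, rfl⟩

/-! ### The Laplace–Beltrami operator on polynomials, as an operator on `L²(Σ)` -/

open Classical in
/-- The operator `LB` on continuous functions (zero on functions which are not `C²`). -/
noncomputable def lbC (a : C(S2, ℂ)) : C(S2, ℂ) :=
  if h : IsC2 a then ⟨LB a, continuous_LB h⟩ else 0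

lemma lbC_apply {a : C(S2, ℂ)} (h : IsC2 a) (θ : S2) : lbC a θ = LB a θ := by
  simp [lbC, h]

lemma isC2_of_mem_polyS {n : ℕ} {p : C(S2, ℂ)} (hp : p ∈ polyS n) : IsC2 p :=
  (polyRegular_of_mem hp).isC2

lemma lbC_mem {n : ℕ} {p : C(S2, ℂ)} (hp : p ∈ polyS n) : lbC p ∈ polyS n := by
  obtain ⟨l, hl, e⟩ := (polyRegular_of_mem hp).lb
  have : lbC p = l := by
    ext θ
    rw [lbC_apply (isC2_of_mem_polyS hp), e]
  rwa [this]

lemma inner_lbC_comm {a b : C(S2, ℂ)} (ha : IsC2 a) (hb : IsC2 b) :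
    ⟪toL2 (lbC a), toL2 b⟫_ℂ = ⟪toL2 a, toL2 (lbC b)⟫_ℂ := by
  rw [inner_toL2, inner_toL2]
  have h := integral_mul_LB_comm ha.conj hb
  refine Eq.trans (integral_congr_ae (.of_forall fun θ => ?_))
    (h.symm.trans (integral_congr_ae (.of_forall fun θ => ?_)))
  · simp only [lbC_apply ha, LB_conj ha]
    ring
  · simp only [lbC_apply hb]

lemma inner_lbC_self {a : C(S2, ℂ)} (ha : IsC2 a) :
    ⟪toL2 a, toL2 (lbC a)⟫_ℂ = (dirichlet a : ℂ) := by
  rw [inner_toL2, ← integral_conj_mul_LB_self ha]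
  exact integral_congr_ae (.of_forall fun θ => by simp only [lbC_apply ha])

lemma lbC_add {a b : C(S2, ℂ)} (ha : IsC2 a) (hb : IsC2 b) : lbC (a + b) = lbC a + lbC b := by
  ext θ
  have hab : IsC2 (a + b : C(S2, ℂ)) := ha.add hb
  rw [lbC_apply hab, ContinuousMap.add_apply, lbC_apply ha, lbC_apply hb]
  exact LB_add ha hb θ

lemma lbC_smul {a : C(S2, ℂ)} (c : ℂ) (ha : IsC2 a) : lbC (c • a) = c • lbC a := by
  ext θ
  have hca : IsC2 (c • a : C(S2, ℂ)) := (IsC2.const c).mul ha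
  have h := LB_mul (IsC2.const c) ha θ
  rw [LB_const, gradForm_const_left] at h
  rw [lbC_apply hca, ContinuousMap.smul_apply, lbC_apply ha, smul_eq_mul]
  refine h.trans ?_
  ring

/-- `LB` on polynomials of degree at most `n`. -/
noncomputable def lbPoly (n : ℕ) : polyS n →ₗ[ℂ] polyS n where
  toFun p := ⟨lbC p, lbC_mem p.2⟩
  map_add' p q := Subtype.ext (lbC_add (isC2_of_mem_polyS p.2) (isC2_of_mem_polyS q.2))
  map_smul' c p := Subtype.ext (lbC_smul c (isC2_of_mem_polyS p.2))

/-- The map from polynomials to their classes in `L²(Σ)`. -/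
noncomputable def polyClass (n : ℕ) : polyS n →ₗ[ℂ] polyL2 n :=
  (toL2 : C(S2, ℂ) →ₗ[ℂ] L2S).submoduleMap (polyS n)

lemma polyClass_range (n : ℕ) : (polyClass n).range = ⊤ :=
  LinearMap.range_eq_top.mpr (LinearMap.submoduleMap_surjective _ _)

/-- A linear choice of polynomial representatives. -/
noncomputable def polyRep (n : ℕ) : polyL2 n →ₗ[ℂ] polyS n :=
  (LinearMap.exists_rightInverse_of_surjective (polyClass n) (polyClass_range n)).choose

lemma polyClass_polyRep (n : ℕ) (y : polyL2 n) : polyClass n (polyRep n y) = y :=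
  LinearMap.congr_fun
    (LinearMap.exists_rightInverse_of_surjective (polyClass n) (polyClass_range n)).choose_spec y

lemma toL2_polyRep (n : ℕ) (y : polyL2 n) : toL2 (polyRep n y : C(S2, ℂ)) = y :=
  congrArg Subtype.val (polyClass_polyRep n y)

/-- `LB` on classes of polynomials of degree at most `n`. -/
noncomputable def lbPolyL2 (n : ℕ) : polyL2 n →ₗ[ℂ] polyL2 n :=
  polyClass n ∘ₗ lbPoly n ∘ₗ polyRep n

lemma coe_lbPolyL2 (n : ℕ) (y : polyL2 n) :
    (lbPolyL2 n y : L2S) = toL2 (lbC (polyRep n y : C(S2, ℂ))) := rfl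

/-- Independence of the chosen representative follows from symmetry: the discrepancy lies in `polyL2
n` and is orthogonal to all of it. Injectivity of `toL2` is not needed. -/
lemma lbPolyL2_toL2 {n : ℕ} {p : C(S2, ℂ)} (hp : p ∈ polyS n) :
    (lbPolyL2 n ⟨toL2 p, ⟨p, hp, rfl⟩⟩ : L2S) = toL2 (lbC p) := by
  set y : polyL2 n := ⟨toL2 p, ⟨p, hp, rfl⟩⟩ with hy
  set d : polyL2 n := lbPolyL2 n y - ⟨toL2 (lbC p), ⟨lbC p, lbC_mem hp, rfl⟩⟩ with hd
  have key : ∀ z : polyL2 n, ⟪(d : L2S), (z : L2S)⟫_ℂ = 0 := by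
    intro z
    have e : (d : L2S) = toL2 (lbC (polyRep n y : C(S2, ℂ))) - toL2 (lbC p) := rfl
    have h1 : IsC2 (polyRep n y : C(S2, ℂ)) := isC2_of_mem_polyS (polyRep n y).2
    have h2 : IsC2 (polyRep n z : C(S2, ℂ)) := isC2_of_mem_polyS (polyRep n z).2
    rw [e, ← toL2_polyRep n z, inner_sub_left, inner_lbC_comm h1 h2,
      inner_lbC_comm (isC2_of_mem_polyS hp) h2, toL2_polyRep, ← inner_sub_left]
    simp [hy]
  have h0 : (d : L2S) = 0 := inner_self_eq_zero.mp (key d)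
  exact sub_eq_zero.mp h0

lemma lbPolyL2_isSymmetric (n : ℕ) : (lbPolyL2 n).IsSymmetric := by
  intro x y
  rw [Submodule.coe_inner, Submodule.coe_inner, coe_lbPolyL2, coe_lbPolyL2]
  conv_lhs => rw [← toL2_polyRep n y]
  conv_rhs => rw [← toL2_polyRep n x]
  exact inner_lbC_comm (isC2_of_mem_polyS (polyRep n x).2) (isC2_of_mem_polyS (polyRep n y).2)

/-- The Laplace–Beltrami operator cut off to polynomials of degree at most `n`. -/
noncomputable def lbTrunc (n : ℕ) : L2S →L[ℂ] L2S :=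
  (polyL2 n).subtypeL ∘L (lbPolyL2 n).toContinuousLinearMap ∘L (polyL2 n).orthogonalProjectionOnto

lemma lbTrunc_coe (n : ℕ) (y : polyL2 n) : lbTrunc n y = lbPolyL2 n y := by
  simp [lbTrunc]

lemma lbTrunc_toL2 {n : ℕ} {p : C(S2, ℂ)} (hp : p ∈ polyS n) :
    lbTrunc n (toL2 p) = toL2 (lbC p) := by
  rw [← lbPolyL2_toL2 hp, ← lbTrunc_coe]

lemma exists_eq_toL2 {n : ℕ} {y : L2S} (hy : y ∈ polyL2 n) : ∃ p ∈ polyS n, toL2 p = y := hy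

lemma lbTrunc_mem (n : ℕ) (y : L2S) : lbTrunc n y ∈ polyL2 n := by
  simp [lbTrunc]

lemma inner_lbTrunc_comm {n : ℕ} {x y : L2S} (hx : x ∈ polyL2 n) (hy : y ∈ polyL2 n) :
    ⟪lbTrunc n x, y⟫_ℂ = ⟪x, lbTrunc n y⟫_ℂ := by
  obtain ⟨p, hp, rfl⟩ := exists_eq_toL2 hx
  obtain ⟨q, hq, rfl⟩ := exists_eq_toL2 hy
  rw [lbTrunc_toL2 hp, lbTrunc_toL2 hq]
  exact inner_lbC_comm (isC2_of_mem_polyS hp) (isC2_of_mem_polyS hq)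

lemma lbTrunc_eq_of_le {m n : ℕ} (h : m ≤ n) {y : L2S} (hy : y ∈ polyL2 m) :
    lbTrunc n y = lbTrunc m y := by
  obtain ⟨p, hp, rfl⟩ := exists_eq_toL2 hy
  rw [lbTrunc_toL2 hp, lbTrunc_toL2 (polyS_mono h hp)]

/-- An orthonormal basis of the space of classes of polynomials, consisting of eigenvectors. -/
lemma exists_eigenbasis (n : ℕ) : ∃ (N : ℕ) (b : Fin N → L2S) (l : Fin N → ℝ),
    (∀ i, b i ∈ polyL2 n) ∧ (∀ x ∈ polyL2 n, ∑ i, ⟪b i, x⟫_ℂ • b i = x) ∧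
    ∀ i, lbTrunc n (b i) = (l i : ℂ) • b i := by
  have hT := lbPolyL2_isSymmetric n
  refine ⟨_, fun i => (hT.eigenvectorBasis rfl i : L2S), hT.eigenvalues rfl,
    fun i => (hT.eigenvectorBasis rfl i).2, fun x hx => ?_, fun i => ?_⟩
  · have := congrArg Subtype.val ((hT.eigenvectorBasis rfl).sum_repr' ⟨x, hx⟩)
    simpa using this
  · rw [lbTrunc_coe, hT.apply_eigenvectorBasis]
    rfl

/-! ### Eigenspaces -/

lemma mem_rangeLB {φ : C(S2, ℂ)} (hφ : ContMDiff (𝓡 2) 𝓘(ℝ, ℂ) ∞ φ) (μ : ℝ) :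
    toL2 (lbC φ) - (μ : ℂ) • toL2 φ ∈ rangeLB μ := by
  refine Submodule.subset_span ⟨φ, hφ, ?_⟩
  rw [← map_smul, ← map_sub]
  filter_upwards [coeFn_toL2 (lbC φ - (μ : ℂ) • φ)] with θ h
  rw [h]
  simp [lbC_apply (IsC2.of_contMDiff two_le_smooth hφ)]

/-- By Green's formula, a classical polynomial eigenfunction is an eigenvector in the distributional
sense that defines `eigenspaceLB`. -/
lemma mem_eigenspaceLB {n : ℕ} {y : L2S} (hy : y ∈ polyL2 n) {μ : ℝ}
    (h : lbTrunc n y = (μ : ℂ) • y) : y ∈ eigenspaceLB μ := by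
  obtain ⟨p, hp, rfl⟩ := exists_eq_toL2 hy
  rw [lbTrunc_toL2 hp] at h
  have hspan : ∀ ψ ∈ rangeLB μ, ⟪ψ, toL2 p⟫_ℂ = 0 := by
    intro ψ hψ
    induction hψ using Submodule.span_induction with
    | mem ψ hψ =>
      obtain ⟨φ, hφ, e⟩ := hψ
      have hφ2 : IsC2 φ := .of_contMDiff two_le_smooth hφ
      set φc : C(S2, ℂ) := ⟨φ, hφ2.continuous⟩ with hφc
      have e2 : ψ = toL2 (lbC φc - (μ : ℂ) • φc) := by
        refine Lp.ext ?_
        filter_upwards [e, coeFn_toL2 (lbC φc - (μ : ℂ) • φc)] with θ h1 h2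
        rw [h1, h2]
        simp only [ContinuousMap.sub_apply, ContinuousMap.smul_apply, smul_eq_mul,
          lbC_apply (a := φc) hφ2]
        rfl
      rw [e2, map_sub, map_smul, inner_sub_left, inner_lbC_comm hφ2 (isC2_of_mem_polyS hp), h,
        inner_smul_left, inner_smul_right, Complex.conj_ofReal, sub_self]
    | zero => exact inner_zero_left _
    | add x y _ _ hx hy => rw [inner_add_left, hx, hy, add_zero]
    | smul c x _ hx => rw [inner_smul_left, hx, mul_zero]
  exact (Submodule.mem_orthogonal _ _).mpr hspan

/-- The polynomial is itself an admissible test function, and `(B - μ)` multiplies it by `ν - μ ≠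
0`. -/
lemma inner_eq_zero_of_mem_eigenspaceLB {n : ℕ} {y : L2S} (hy : y ∈ polyL2 n) {μ ν : ℝ}
    (h : lbTrunc n y = (ν : ℂ) • y) (hne : ν ≠ μ) {x : L2S} (hx : x ∈ eigenspaceLB μ) :
    ⟪y, x⟫_ℂ = 0 := by
  obtain ⟨p, hp, rfl⟩ := exists_eq_toL2 hy
  rw [lbTrunc_toL2 hp] at h
  have h1 := (Submodule.mem_orthogonal _ _).mp hx _ (mem_rangeLB (polyRegular_of_mem hp).smooth μ)
  rw [h, ← sub_smul, inner_smul_left, mul_eq_zero] at h1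
  refine h1.resolve_left fun h2 => hne ?_
  rw [map_eq_zero, sub_eq_zero] at h2
  exact_mod_cast h2

lemma top_le_iSup_polyL2 : ⊤ ≤ (⨆ n, polyL2 n).topologicalClosure := by
  intro x _
  have h : closure (⋃ n, (polyL2 n : Set L2S)) ⊆ closure ((⨆ n, polyL2 n : Submodule ℂ L2S)) :=
    closure_mono (iUnion_subset fun n => le_iSup polyL2 n)
  exact h (dense_iUnion_polyL2 x)

lemma tendsto_starProjection_polyL2 (x : L2S) :
    Tendsto (fun n => (polyL2 n).starProjection x) atTop (𝓝 x) :=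
  Submodule.starProjection_tendsto_self polyL2 (fun _ _ h => polyL2_mono h) x top_le_iSup_polyL2

/-- Elements of `eigenspaceLB` are only distributional eigenvectors, so symmetry of `B` cannot be
applied to a pair of them. Instead one of them is projected to polynomials and expanded in an
eigenbasis: each basis vector is orthogonal to `y` if its eigenvalue is `μ`, and to `x` otherwise.
-/
lemma orthogonalFamily_eigenspaceLB :
    OrthogonalFamily ℂ (fun μ => eigenspaceLB μ) fun μ => (eigenspaceLB μ).subtypeₗᵢ := by
  refine OrthogonalFamily.of_pairwise fun μ ν hμν => ?_
  change eigenspaceLB μ ⟂ eigenspaceLB ν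
  rw [Submodule.isOrtho_iff_inner_eq]
  intro x hx y hy
  have h0 : ∀ n, ⟪(polyL2 n).starProjection x, y⟫_ℂ = 0 := by
    intro n
    obtain ⟨N, b, l, hb, hsum, hl⟩ := exists_eigenbasis n
    rw [← hsum _ (Submodule.starProjection_apply_mem _ x), sum_inner]
    refine Finset.sum_eq_zero fun i _ => ?_
    rw [inner_smul_left]
    by_cases hi : l i = μ
    · rw [inner_eq_zero_of_mem_eigenspaceLB (hb i) (hl i) (hi ▸ hμν) hy, mul_zero]
    · rw [← Submodule.inner_starProjection_left_eq_right,
        Submodule.starProjection_eq_self_iff.mpr (hb i),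
        inner_eq_zero_of_mem_eigenspaceLB (hb i) (hl i) hi hx, map_zero, zero_mul]
  have ht := (tendsto_starProjection_polyL2 x).inner (𝕜 := ℂ) (tendsto_const_nhds (x := y))
  simp only [h0] at ht
  exact (tendsto_nhds_unique ht tendsto_const_nhds)

/-- Polynomial eigenvectors already span a dense subspace. This justifies the definition of `expLB`
as a sum over eigenvalues. -/
lemma isHilbertSum_eigenspaceLB :
    IsHilbertSum ℂ (fun μ => eigenspaceLB μ) fun μ => (eigenspaceLB μ).subtypeₗᵢ := by
  refine IsHilbertSum.mkInternal _ orthogonalFamily_eigenspaceLB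
    (top_le_iSup_polyL2.trans (Submodule.topologicalClosure_mono (iSup_le fun n => ?_)))
  obtain ⟨N, b, l, hb, hsum, hl⟩ := exists_eigenbasis n
  intro x hx
  rw [← hsum x hx]
  exact Submodule.sum_mem _ fun i _ => Submodule.smul_mem _ _
    (Submodule.mem_iSup_of_mem (l i) (mem_eigenspaceLB (hb i) (hl i)))

/-! ### The unitary group generated by the Laplace–Beltrami operator -/

/-- The orthogonal projection onto an eigenspace. -/
noncomputable abbrev eigenProj (μ : ℝ) : L2S →L[ℂ] L2S := (eigenspaceLB μ).starProjection

lemma eigenProj_of_mem {μ : ℝ} {y : L2S} (hy : y ∈ eigenspaceLB μ) : eigenProj μ y = y :=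
  Submodule.starProjection_eq_self_iff.mpr hy

lemma eigenProj_of_mem_ne {μ ν : ℝ} (hne : ν ≠ μ) {y : L2S} (hy : y ∈ eigenspaceLB μ) :
    eigenProj ν y = 0 := by
  rw [Submodule.starProjection_apply_eq_zero_iff, Submodule.mem_orthogonal]
  intro u hu
  exact orthogonalFamily_eigenspaceLB hne ⟨u, hu⟩ ⟨y, hy⟩

lemma hasSum_eigenProj (f : L2S) : HasSum (fun μ => eigenProj μ f) f := by
  set w := isHilbertSum_eigenspaceLB.linearIsometryEquiv f with hw
  have h := isHilbertSum_eigenspaceLB.hasSum_linearIsometryEquiv_symm w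
  rw [hw, LinearIsometryEquiv.symm_apply_apply, ← hw] at h
  convert h using 1
  funext ν
  have h2 := (eigenProj ν).hasSum h
  refine h2.unique ?_
  convert hasSum_single ν ?_ using 1
  · exact (eigenProj_of_mem (w ν).2).symm
  · intro μ hμ
    exact eigenProj_of_mem_ne hμ.symm (w μ).2

lemma eigenProj_sum {c : ℝ → ℂ} {f g : L2S} (h : HasSum (fun μ => c μ • eigenProj μ f) g) (ν : ℝ) :
    eigenProj ν g = c ν • eigenProj ν f := by
  refine ((eigenProj ν).hasSum h).unique ?_
  convert hasSum_single ν ?_ using 1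
  · rw [map_smul, eigenProj_of_mem (Submodule.starProjection_apply_mem _ f)]
  · intro μ hμ
    rw [map_smul, eigenProj_of_mem_ne hμ.symm (Submodule.starProjection_apply_mem _ f), smul_zero]

lemma hasSum_norm_sq_eigenProj (f : L2S) : HasSum (fun μ => ‖eigenProj μ f‖ ^ 2) (‖f‖ ^ 2) := by
  have h := (innerSL ℂ f).hasSum (hasSum_eigenProj f)
  have h2 := Complex.reCLM.hasSum h
  convert h2 using 1
  · funext μ
    have h3 := Submodule.re_inner_starProjection_eq_normSq (eigenspaceLB μ) f
    change _ = RCLike.re ⟪f, eigenProj μ f⟫_ℂ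
    rw [← Submodule.inner_starProjection_left_eq_right, h3]
    rfl
  · change _ = RCLike.re ⟪f, f⟫_ℂ
    rw [inner_self_eq_norm_sq]

/-- For imaginary `z` the coefficients are unimodular, so summability is Parseval. It also ensures
that the `tsum` in `expLB` is not the default value `0`. -/
lemma hasSum_expLB {z : ℂ} (hz : z.re = 0) (f : L2S) :
    HasSum (fun μ : ℝ => Complex.exp (z * μ) • eigenProj μ f) (expLB z f) := by
  have h : Summable (fun μ : ℝ => Complex.exp (z * μ) • eigenProj μ f) := by
    have h1 := orthogonalFamily_eigenspaceLB.summable_iff_norm_sq_summable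
      (fun μ => Complex.exp (z * μ) • (eigenspaceLB μ).orthogonalProjectionOnto f)
    refine h1.mpr ?_
    convert (hasSum_norm_sq_eigenProj f).summable using 1
    funext μ
    rw [norm_smul, Complex.norm_exp]
    simp [hz]
  exact h.hasSum

lemma eigenProj_expLB {z : ℂ} (hz : z.re = 0) (f : L2S) (μ : ℝ) :
    eigenProj μ (expLB z f) = Complex.exp (z * μ) • eigenProj μ f :=
  eigenProj_sum (hasSum_expLB hz f) μ

lemma norm_expLB {z : ℂ} (hz : z.re = 0) (f : L2S) : ‖expLB z f‖ = ‖f‖ := by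
  have h1 := hasSum_norm_sq_eigenProj (expLB z f)
  have h2 := hasSum_norm_sq_eigenProj f
  have h3 : (fun μ => ‖eigenProj μ (expLB z f)‖ ^ 2) = fun μ => ‖eigenProj μ f‖ ^ 2 := by
    funext μ
    rw [eigenProj_expLB hz, norm_smul, Complex.norm_exp]
    simp [hz]
  rw [h3] at h1
  exact (sq_eq_sq₀ (norm_nonneg _) (norm_nonneg _)).mp (h1.unique h2)

lemma ext_eigenProj {f g : L2S} (h : ∀ μ, eigenProj μ f = eigenProj μ g) : f = g := by
  refine (hasSum_eigenProj f).unique ?_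
  simp only [h]
  exact hasSum_eigenProj g

lemma expLB_eigen {z : ℂ} (hz : z.re = 0) {μ : ℝ} {y : L2S} (hy : y ∈ eigenspaceLB μ) :
    expLB z y = Complex.exp (z * μ) • y := by
  refine ext_eigenProj fun ν => ?_
  rw [eigenProj_expLB hz, map_smul]
  by_cases h : ν = μ
  · rw [h]
  · rw [eigenProj_of_mem_ne h hy, smul_zero, smul_zero]

lemma groupArg_re (k t : ℝ) : ((Complex.I * k)⁻¹ * (t : ℂ)).re = 0 := by
  simp [mul_inv_rev]

/-- The unitary group `exp (t B / (i k))`. -/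
noncomputable def group (k t : ℝ) : L2S →ₗᵢ[ℂ] L2S where
  toFun := expLB ((Complex.I * k)⁻¹ * (t : ℂ))
  map_add' f g := ext_eigenProj fun μ => by
    simp only [eigenProj_expLB (groupArg_re k t), map_add, smul_add]
  map_smul' c f := ext_eigenProj fun μ => by
    simp only [eigenProj_expLB (groupArg_re k t), map_smul, RingHom.id_apply]
    rw [smul_comm]
  norm_map' f := norm_expLB (groupArg_re k t) f

lemma group_apply (k t : ℝ) (f : L2S) : group k t f = expLB ((Complex.I * k)⁻¹ * (t : ℂ)) f := rfl

lemma group_add (k s t : ℝ) (f : L2S) : group k (s + t) f = group k s (group k t f) := by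
  refine ext_eigenProj fun μ => ?_
  simp only [group_apply, eigenProj_expLB (groupArg_re k _), smul_smul, ← Complex.exp_add]
  congr 2
  push_cast
  ring

lemma group_zero (k : ℝ) (f : L2S) : group k 0 f = f := by
  refine ext_eigenProj fun μ => ?_
  simp [group_apply, eigenProj_expLB]

lemma group_neg_group (k t : ℝ) (f : L2S) : group k (-t) (group k t f) = f := by
  rw [← group_add, neg_add_cancel, group_zero]

lemma group_eigen (k t : ℝ) {n : ℕ} {y : L2S} (hy : y ∈ polyL2 n) {μ : ℝ}
    (h : lbTrunc n y = (μ : ℂ) • y) :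
    group k t y = Complex.exp ((Complex.I * k)⁻¹ * (t : ℂ) * μ) • y :=
  expLB_eigen (groupArg_re k t) (mem_eigenspaceLB hy h)

lemma group_mem (k t : ℝ) {n : ℕ} {y : L2S} (hy : y ∈ polyL2 n) : group k t y ∈ polyL2 n := by
  obtain ⟨N, b, l, hb, hsum, hl⟩ := exists_eigenbasis n
  rw [← hsum y hy, map_sum]
  refine Submodule.sum_mem _ fun i _ => ?_
  rw [map_smul, group_eigen k t (hb i) (hl i)]
  exact Submodule.smul_mem _ _ (Submodule.smul_mem _ _ (hb i))

lemma group_lbTrunc (k t : ℝ) {n : ℕ} {y : L2S} (hy : y ∈ polyL2 n) :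
    group k t (lbTrunc n y) = lbTrunc n (group k t y) := by
  obtain ⟨N, b, l, hb, hsum, hl⟩ := exists_eigenbasis n
  rw [← hsum y hy]
  simp only [map_sum, map_smul]
  refine Finset.sum_congr rfl fun i _ => ?_
  rw [group_eigen k t (hb i) (hl i), hl, map_smul, map_smul, hl, group_eigen k t (hb i) (hl i),
    smul_comm (l i : ℂ)]

/-- In an eigenbasis of the finite-dimensional space containing the curve, this is a finite sum of
scalar product rules. The time change `t` will be `s ↦ -s⁻¹`, whose derivative produces the factor
`s⁻²` in front of `B`. -/
lemma hasDerivAt_group (k : ℝ) {n : ℕ} {t : ℝ → ℝ} {t' : ℝ} {w : ℝ → L2S} {w' : L2S} {s : ℝ}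
    (ht : HasDerivAt t t' s) (hw : HasDerivAt w w' s) (hmem : ∀ s, w s ∈ polyL2 n)
    (hmem' : w' ∈ polyL2 n) :
    HasDerivAt (fun s => group k (t s) (w s))
      (((Complex.I * k)⁻¹ * (t' : ℂ)) • lbTrunc n (group k (t s) (w s)) + group k (t s) w') s := by
  obtain ⟨N, b, l, hb, hsum, hl⟩ := exists_eigenbasis n
  set c : ℂ := (Complex.I * k)⁻¹ with hc
  have hg : ∀ (τ : ℝ) (x : L2S), x ∈ polyL2 n →
      group k τ x = ∑ i, (Complex.exp (c * (τ : ℂ) * l i) * ⟪b i, x⟫_ℂ) • b i := by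
    intro τ x hx
    conv_lhs => rw [← hsum x hx]
    rw [map_sum]
    refine Finset.sum_congr rfl fun i _ => ?_
    rw [map_smul, group_eigen k τ (hb i) (hl i), smul_smul, mul_comm]
  have e1 : (fun s => group k (t s) (w s))
      = fun s => ∑ i, (Complex.exp (c * (t s : ℂ) * l i) * ⟪b i, w s⟫_ℂ) • b i :=
    funext fun s => hg _ _ (hmem s)
  rw [e1]
  have hd : ∀ i, HasDerivAt (fun s => (Complex.exp (c * (t s : ℂ) * l i) * ⟪b i, w s⟫_ℂ) • b i)
      ((Complex.exp (c * (t s : ℂ) * l i) * (c * (t' : ℂ) * l i) * ⟪b i, w s⟫_ℂ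
        + Complex.exp (c * (t s : ℂ) * l i) * ⟪b i, w'⟫_ℂ) • b i) s := by
    intro i
    have h1 : HasDerivAt (fun s => c * (t s : ℂ) * l i) (c * (t' : ℂ) * l i) s :=
      (ht.ofReal_comp.const_mul c).mul_const _
    have h2 : HasDerivAt (fun s => ⟪b i, w s⟫_ℂ) ⟪b i, w'⟫_ℂ s := by
      simpa using (hasDerivAt_const s (b i)).inner ℂ hw
    exact (h1.cexp.mul h2).smul_const (b i)
  refine (HasDerivAt.fun_sum fun i _ => hd i).congr_deriv ?_
  rw [hg _ _ hmem', hg _ _ (hmem s), map_sum, Finset.smul_sum, ← Finset.sum_add_distrib]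
  refine Finset.sum_congr rfl fun i _ => ?_
  rw [map_smul, hl, smul_smul, smul_smul, ← add_smul]
  congr 1
  ring

/-- Differentiability on polynomials passes to all of `L²`, because isometries make the
approximation uniform in `t`. -/
lemma continuous_group_apply (k : ℝ) (f : L2S) : Continuous fun t => group k t f := by
  have hd : ∀ n, ∀ y ∈ polyL2 n, Continuous fun t => group k t y := by
    intro n y hy
    rw [continuous_iff_continuousAt]
    intro t
    exact (hasDerivAt_group k (hasDerivAt_id t) (hasDerivAt_const t y) (fun _ => hy)
      (zero_mem _)).continuousAt
  refine continuous_of_uniform_approx_of_continuous fun u hu => ?_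
  obtain ⟨ε, hε, hεu⟩ := Metric.mem_uniformity_dist.mp hu
  obtain ⟨y, hy, hfy⟩ := Metric.mem_closure_iff.mp (dense_iUnion_polyL2 f) ε hε
  obtain ⟨n, hn⟩ := mem_iUnion.mp hy
  refine ⟨fun t => group k t y, hd n y hn, fun t => hεu ?_⟩
  rw [(group k t).isometry.dist_eq]
  exact hfy

lemma continuous_group (k : ℝ) : Continuous fun p : ℝ × L2S => group k p.1 p.2 := by
  rw [continuous_iff_continuousAt]
  rintro ⟨t, f⟩
  rw [ContinuousAt, tendsto_iff_norm_sub_tendsto_zero]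
  have h1 : Tendsto (fun p : ℝ × L2S => ‖p.2 - f‖ + ‖group k p.1 f - group k t f‖) (𝓝 (t, f))
      (𝓝 0) := by
    have h2 : Continuous fun p : ℝ × L2S => ‖p.2 - f‖ + ‖group k p.1 f - group k t f‖ :=
      (continuous_snd.sub continuous_const).norm.add
        (((continuous_group_apply k f).comp continuous_fst).sub continuous_const).norm
    simpa using h2.tendsto (t, f)
  refine squeeze_zero (fun _ => norm_nonneg _) (fun p => ?_) h1
  have : group k p.1 p.2 - group k t f = group k p.1 (p.2 - f) + (group k p.1 f - group k t f) := by
    rw [map_sub]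
    abel
  rw [this]
  refine (norm_add_le _ _).trans ?_
  rw [(group k p.1).norm_map]

/-- The identity `(τ - s) / (τ s) = s⁻¹ - τ⁻¹` separates the two times; the interaction picture
rests on it. -/
lemma U0_eq_group (k : ℝ) {s τ : ℝ} (hs : s ≠ 0) (hτ : τ ≠ 0) (f : L2S) :
    U0 k s τ f = group k (-τ⁻¹) (group k s⁻¹ f) := by
  rw [← group_add, group_apply, U0]
  congr 3
  field_simp
  ring

/-! ### Dyson series -/

section Dyson

variable {H : Type*} [NormedAddCommGroup H] [NormedSpace ℝ H]

/-- The terms of the Dyson series of `w' = A w`, `w 1 = x`. -/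
noncomputable def dyson (A : ℝ → H → H) (x : H) : ℕ → ℝ → H
  | 0, _ => x
  | n + 1, τ => ∫ s in (1 : ℝ)..τ, A s (dyson A x n s)

/-- The sum of the Dyson series. -/
noncomputable def dysonSum (A : ℝ → H → H) (x : H) (τ : ℝ) : H := ∑' n, dyson A x n τ

lemma dyson_one_succ (A : ℝ → H → H) (x : H) (n : ℕ) : dyson A x (n + 1) 1 = 0 := by
  simp [dyson]

lemma dysonSum_one (A : ℝ → H → H) (x : H) : dysonSum A x 1 = x := by
  rw [dysonSum, tsum_eq_single 0]
  · rfl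
  · intro n hn
    obtain ⟨m, rfl⟩ := Nat.exists_eq_succ_of_ne_zero hn
    exact dyson_one_succ A x m

variable {A : ℝ → H → H} {M : ℝ}

lemma norm_dyson_le (hM : ∀ s y, ‖A s y‖ ≤ M * ‖y‖) (x : H) (n : ℕ) (τ : ℝ) :
    ‖dyson A x n τ‖ ≤ ‖x‖ * ((|M| * |τ - 1|) ^ n / n.factorial) := by
  have hM' : ∀ s y, ‖A s y‖ ≤ |M| * ‖y‖ := fun s y =>
    (hM s y).trans (mul_le_mul_of_nonneg_right (le_abs_self M) (norm_nonneg y))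
  induction n generalizing τ with
  | zero => simp [dyson]
  | succ n ih =>
    rw [dyson]
    have hc : Continuous fun s : ℝ =>
        |M| * (‖x‖ * (|M| ^ n / n.factorial)) * |s - 1| ^ n := by fun_prop
    refine (intervalIntegral.norm_integral_le_abs_of_norm_le (g := fun s =>
      |M| * (‖x‖ * (|M| ^ n / n.factorial)) * |s - 1| ^ n) (.of_forall fun s => ?_)
      (hc.intervalIntegrable _ _)).trans_eq ?_
    · refine (hM' s _).trans ?_
      rw [mul_assoc |M|]
      refine mul_le_mul_of_nonneg_left ((ih s).trans_eq ?_) (abs_nonneg M)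
      rw [mul_pow]
      ring
    · rw [intervalIntegral.abs_integral_eq_abs_integral_uIoc, integral_const_mul,
        integral_pow_abs_sub_uIoc, abs_of_nonneg (by positivity), mul_pow, Nat.factorial_succ]
      push_cast
      field_simp
      ring

lemma summable_norm_dyson (hM : ∀ s y, ‖A s y‖ ≤ M * ‖y‖) (x : H) (τ : ℝ) :
    Summable fun n => ‖dyson A x n τ‖ :=
  Summable.of_nonneg_of_le (fun _ => norm_nonneg _) (fun n => norm_dyson_le hM x n τ)
    ((Real.summable_pow_div_factorial (|M| * |τ - 1|)).mul_left ‖x‖)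

variable [CompleteSpace H]

lemma hasDerivAt_dyson_succ (hA : Continuous fun p : ℝ × H => A p.1 p.2) (x : H) (n : ℕ)
    (hn : Continuous (dyson A x n)) (τ : ℝ) :
    HasDerivAt (dyson A x (n + 1)) (A τ (dyson A x n τ)) τ :=
  ((hA.comp (continuous_id.prodMk hn)).integral_hasStrictDerivAt 1 τ).hasDerivAt

lemma continuous_dyson (hA : Continuous fun p : ℝ × H => A p.1 p.2) (x : H) (n : ℕ) :
    Continuous (dyson A x n) := by
  induction n with
  | zero => exact continuous_const
  | succ n ih =>
    rw [continuous_iff_continuousAt]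
    exact fun τ => (hasDerivAt_dyson_succ hA x n ih τ).continuousAt

lemma hasDerivAt_dysonSum {A : ℝ → H →L[ℝ] H} (hA : Continuous fun p : ℝ × H => A p.1 p.2)
    (hM : ∀ s y, ‖A s y‖ ≤ M * ‖y‖) (x : H) (τ : ℝ) :
    HasDerivAt (dysonSum (fun s => A s) x) (A τ (dysonSum (fun s => A s) x τ)) τ := by
  set d := dyson (fun s => A s) x with hd
  have hs : ∀ τ, Summable fun n => d n τ := fun τ => (summable_norm_dyson hM x τ).of_norm
  have e : dysonSum (fun s => A s) x = fun τ => x + ∑' n, d (n + 1) τ := by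
    funext τ
    rw [dysonSum, (hs τ).tsum_eq_zero_add]
    rfl
  have e2 : A τ (dysonSum (fun s => A s) x τ) = ∑' n, A τ (d n τ) := (A τ).map_tsum (hs τ)
  rw [e2, e]
  refine HasDerivAt.const_add x ?_
  -- The ball of this radius about `1` contains both the base point, where the series is trivially
  -- summable, and `τ`.
  set R : ℝ := |τ - 1| + 1 with hR
  have hR0 : 0 < R := by positivity
  have hu : Summable fun n : ℕ => |M| * (‖x‖ * ((|M| * R) ^ n / n.factorial)) :=
    ((Real.summable_pow_div_factorial (|M| * R)).mul_left ‖x‖).mul_left |M|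
  have hg : ∀ n, ∀ y ∈ Metric.ball (1 : ℝ) R, HasDerivAt (d (n + 1)) (A y (d n y)) y :=
    fun n y _ => hasDerivAt_dyson_succ hA x n (continuous_dyson hA x n) y
  have hg' : ∀ n, ∀ y ∈ Metric.ball (1 : ℝ) R,
      ‖A y (d n y)‖ ≤ |M| * (‖x‖ * ((|M| * R) ^ n / n.factorial)) := by
    intro n y hy
    have hy' : |y - 1| ≤ R := by
      rw [Metric.mem_ball, Real.dist_eq] at hy
      exact hy.le
    have h1 : ‖d n y‖ ≤ ‖x‖ * ((|M| * |y - 1|) ^ n / n.factorial) := norm_dyson_le hM x n y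
    have h2 : ‖x‖ * ((|M| * |y - 1|) ^ n / n.factorial) ≤ ‖x‖ * ((|M| * R) ^ n / n.factorial) := by
      gcongr
    calc ‖A y (d n y)‖ ≤ M * ‖d n y‖ := hM y _
      _ ≤ |M| * ‖d n y‖ := mul_le_mul_of_nonneg_right (le_abs_self M) (norm_nonneg _)
      _ ≤ _ := mul_le_mul_of_nonneg_left (h1.trans h2) (abs_nonneg M)
  have hg0 : Summable fun n => d (n + 1) 1 := by
    have : (fun n => d (n + 1) 1) = fun _ => (0 : H) := funext fun n => dyson_one_succ _ x n
    rw [this]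
    exact summable_zero
  have hτ : τ ∈ Metric.ball (1 : ℝ) R := by
    rw [Metric.mem_ball, Real.dist_eq, hR]
    linarith
  exact hasDerivAt_tsum_of_isPreconnected hu Metric.isOpen_ball
    (convex_ball (1 : ℝ) R).isPreconnected hg hg' (Metric.mem_ball_self hR0) hg0 hτ

/-- Strong convergence of uniformly bounded generators suffices: dominated convergence in each
integral, then in the sum. -/
lemma tendsto_dysonSum {A : ℝ → H →L[ℝ] H} {AN : ℕ → ℝ → H →L[ℝ] H}
    (hAN : ∀ N, Continuous fun p : ℝ × H => AN N p.1 p.2)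
    (hM : ∀ N s y, ‖AN N s y‖ ≤ M * ‖y‖)
    (hlim : ∀ s y, Tendsto (fun N => AN N s y) atTop (𝓝 (A s y)))
    {x : H} {xN : ℕ → H} (hx : Tendsto xN atTop (𝓝 x)) {K : ℝ} (hK : ∀ N, ‖xN N‖ ≤ K) (τ : ℝ) :
    Tendsto (fun N => dysonSum (fun s => AN N s) (xN N) τ) atTop
      (𝓝 (dysonSum (fun s => A s) x τ)) := by
  have hM' : ∀ N s y, ‖AN N s y‖ ≤ |M| * ‖y‖ := fun N s y =>
    (hM N s y).trans (mul_le_mul_of_nonneg_right (le_abs_self M) (norm_nonneg y))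
  have hK0 : 0 ≤ K := (norm_nonneg _).trans (hK 0)
  have hbd : ∀ n N τ, ‖dyson (fun s => AN N s) (xN N) n τ‖
      ≤ K * ((|M| * |τ - 1|) ^ n / n.factorial) := fun n N τ =>
    (norm_dyson_le (hM N) (xN N) n τ).trans (mul_le_mul_of_nonneg_right (hK N) (by positivity))
  have hn : ∀ n τ, Tendsto (fun N => dyson (fun s => AN N s) (xN N) n τ) atTop
      (𝓝 (dyson (fun s => A s) x n τ)) := by
    intro n
    induction n with
    | zero => exact fun _ => hx
    | succ n ih =>
      intro τ
      simp only [dyson]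
      refine intervalIntegral.tendsto_integral_filter_of_dominated_convergence
        (fun s => |M| * (K * ((|M| * |s - 1|) ^ n / n.factorial))) ?_ ?_ ?_ ?_
      · exact .of_forall fun N => ((hAN N).comp
          (continuous_id.prodMk (continuous_dyson (hAN N) (xN N) n))).aestronglyMeasurable
      · refine .of_forall fun N => .of_forall fun s _ => ?_
        exact (hM' N s _).trans (mul_le_mul_of_nonneg_left (hbd n N s) (abs_nonneg M))
      · exact Continuous.intervalIntegrable (by fun_prop) _ _
      · refine .of_forall fun s _ => ?_
        -- Split `A_N d_N - A d` as `A_N (d_N - d) + (A_N d - A d)`; uniform boundedness handles the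
        -- first part.
        have h1 : Tendsto (fun N => AN N s (dyson (fun s => AN N s) (xN N) n s
            - dyson (fun s => A s) x n s)) atTop (𝓝 0) := by
          refine squeeze_zero_norm (fun N => hM' N s _) ?_
          have := (tendsto_iff_norm_sub_tendsto_zero.mp (ih s)).const_mul |M|
          simpa using this
        have h2 := h1.add (hlim s (dyson (fun s => A s) x n s))
        simpa using h2
  refine tendsto_tsum_of_dominated_convergence
    (bound := fun n => K * ((|M| * |τ - 1|) ^ n / n.factorial))
    ((Real.summable_pow_div_factorial (|M| * |τ - 1|)).mul_left K) (fun n => hn n τ)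
    (.of_forall fun N n => hbd n N τ)

lemma dyson_sub {A : ℝ → H →L[ℝ] H} (hA : Continuous fun p : ℝ × H => A p.1 p.2) (x x' : H)
    (n : ℕ) (τ : ℝ) : dyson (fun s => A s) (x - x') n τ
      = dyson (fun s => A s) x n τ - dyson (fun s => A s) x' n τ := by
  induction n generalizing τ with
  | zero => rfl
  | succ n ih =>
    have hc : ∀ y, Continuous fun s => A s (dyson (fun s => A s) y n s) := fun y =>
      hA.comp (continuous_id.prodMk (continuous_dyson hA y n))
    simp only [dyson, ih, map_sub]
    exact intervalIntegral.integral_sub ((hc x).intervalIntegrable _ _)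
      ((hc x').intervalIntegrable _ _)

lemma dysonSum_sub {A : ℝ → H →L[ℝ] H} (hA : Continuous fun p : ℝ × H => A p.1 p.2)
    (hM : ∀ s y, ‖A s y‖ ≤ M * ‖y‖) (x x' : H) (τ : ℝ) : dysonSum (fun s => A s) (x - x') τ
      = dysonSum (fun s => A s) x τ - dysonSum (fun s => A s) x' τ := by
  simp only [dysonSum, dyson_sub hA]
  exact (summable_norm_dyson hM x τ).of_norm.tsum_sub (summable_norm_dyson hM x' τ).of_norm

lemma dysonSum_mem {A : ℝ → H →L[ℝ] H} (W : Submodule ℝ H) (hW : IsClosed (W : Set H))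
    (hA : Continuous fun p : ℝ × H => A p.1 p.2) (hM : ∀ s y, ‖A s y‖ ≤ M * ‖y‖)
    (hAW : ∀ s, ∀ y ∈ W, A s y ∈ W) {x : H} (hx : x ∈ W) (τ : ℝ) :
    dysonSum (fun s => A s) x τ ∈ W := by
  have hn : ∀ n τ, dyson (fun s => A s) x n τ ∈ W := by
    intro n
    induction n with
    | zero => exact fun _ => hx
    | succ n ih =>
      intro τ
      rw [dyson]
      have : CompleteSpace W := hW.completeSpace_coe
      have hc : Continuous fun s => (⟨A s (dyson (fun s => A s) x n s), hAW s _ (ih s)⟩ : W) :=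
        (hA.comp (continuous_id.prodMk (continuous_dyson hA x n))).subtype_mk _
      have h := W.subtypeL.intervalIntegral_comp_comm (hc.intervalIntegrable 1 τ (μ := volume))
      rw [show (∫ s in (1 : ℝ)..τ, A s (dyson (fun s => A s) x n s)) = _ from h]
      exact Submodule.coe_mem _
  exact hW.mem_of_tendsto (summable_norm_dyson hM x τ).of_norm.hasSum
    (.of_forall fun t => W.sum_mem fun n _ => hn n τ)

end Dyson

/-! ### Multiplication operators -/

lemma memLp_mul (v : C(S2, ℝ)) (y : L2S) : MemLp (fun θ => (v θ : ℂ) * y θ) 2 surf := by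
  refine MemLp.of_le_mul (c := ‖v‖) (Lp.memLp y) ?_ (.of_forall fun θ => ?_)
  · exact (Complex.continuous_ofReal.comp v.continuous).aestronglyMeasurable.mul
      (Lp.aestronglyMeasurable y)
  · rw [norm_mul, Complex.norm_real]
    exact mul_le_mul_of_nonneg_right (v.norm_coe_le_norm θ) (norm_nonneg _)

/-- Multiplication of a class in `L²(Σ)` by a real continuous function. -/
noncomputable def mulFun (v : C(S2, ℝ)) (y : L2S) : L2S := (memLp_mul v y).toLp

lemma coeFn_mulFun (v : C(S2, ℝ)) (y : L2S) : ⇑(mulFun v y) =ᵐ[surf] fun θ => (v θ : ℂ) * y θ :=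
  MemLp.coeFn_toLp _

lemma mulFun_add_right (v : C(S2, ℝ)) (x y : L2S) :
    mulFun v (x + y) = mulFun v x + mulFun v y := by
  refine Lp.ext ?_
  filter_upwards [coeFn_mulFun v (x + y), coeFn_mulFun v x, coeFn_mulFun v y,
    Lp.coeFn_add x y, Lp.coeFn_add (mulFun v x) (mulFun v y)] with θ h1 h2 h3 h4 h5
  rw [h1, h5, Pi.add_apply, h2, h3, h4, Pi.add_apply, mul_add]

lemma mulFun_smul_right (v : C(S2, ℝ)) (c : ℂ) (y : L2S) :
    mulFun v (c • y) = c • mulFun v y := by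
  refine Lp.ext ?_
  filter_upwards [coeFn_mulFun v (c • y), coeFn_mulFun v y, Lp.coeFn_smul c y,
    Lp.coeFn_smul c (mulFun v y)] with θ h1 h2 h3 h4
  rw [h1, h4, Pi.smul_apply, h2, h3, Pi.smul_apply, mul_smul_comm]

lemma mulFun_add_left (v w : C(S2, ℝ)) (y : L2S) :
    mulFun (v + w) y = mulFun v y + mulFun w y := by
  refine Lp.ext ?_
  filter_upwards [coeFn_mulFun (v + w) y, coeFn_mulFun v y, coeFn_mulFun w y,
    Lp.coeFn_add (mulFun v y) (mulFun w y)] with θ h1 h2 h3 h4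
  rw [h1, h4, Pi.add_apply, h2, h3, ContinuousMap.add_apply, Complex.ofReal_add, add_mul]

lemma mulFun_smul_left (c : ℝ) (v : C(S2, ℝ)) (y : L2S) :
    mulFun (c • v) y = (c : ℂ) • mulFun v y := by
  refine Lp.ext ?_
  filter_upwards [coeFn_mulFun (c • v) y, coeFn_mulFun v y,
    Lp.coeFn_smul (c : ℂ) (mulFun v y)] with θ h1 h2 h3
  rw [h1, h3, Pi.smul_apply, h2, ContinuousMap.smul_apply, smul_eq_mul, Complex.ofReal_mul,
    smul_eq_mul, mul_assoc]

lemma norm_mulFun_le (v : C(S2, ℝ)) (y : L2S) : ‖mulFun v y‖ ≤ ‖v‖ * ‖y‖ := by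
  refine Lp.norm_le_mul_norm_of_ae_le_mul ?_
  filter_upwards [coeFn_mulFun v y] with θ h
  rw [h, norm_mul, Complex.norm_real]
  exact mul_le_mul_of_nonneg_right (v.norm_coe_le_norm θ) (norm_nonneg _)

lemma ofReal_smul_L2 (c : ℝ) (y : L2S) : (c : ℂ) • y = c • y := by
  refine Lp.ext ?_
  filter_upwards [Lp.coeFn_smul (c : ℂ) y, Lp.coeFn_smul c y] with θ h1 h2
  rw [h1, h2, Pi.smul_apply, Pi.smul_apply, Complex.real_smul, smul_eq_mul]

/-- Multiplication by real continuous functions, as a real bilinear map. -/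
noncomputable def mulLin : C(S2, ℝ) →ₗ[ℝ] L2S →ₗ[ℝ] L2S :=
  LinearMap.mk₂ ℝ mulFun mulFun_add_left
    (fun c v y => by rw [mulFun_smul_left, ofReal_smul_L2]) mulFun_add_right
    (fun c v y => by rw [← ofReal_smul_L2, mulFun_smul_right, ofReal_smul_L2])

/-- Multiplication by real continuous functions, as a bounded bilinear map. -/
noncomputable def mulB : C(S2, ℝ) →L[ℝ] L2S →L[ℝ] L2S :=
  mulLin.mkContinuous₂ 1 fun v y => by
    rw [one_mul]
    exact norm_mulFun_le v y

lemma coeFn_mulB (v : C(S2, ℝ)) (y : L2S) : ⇑(mulB v y) =ᵐ[surf] fun θ => (v θ : ℂ) * y θ :=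
  coeFn_mulFun v y

lemma norm_mulB_le (v : C(S2, ℝ)) (y : L2S) : ‖mulB v y‖ ≤ ‖v‖ * ‖y‖ := norm_mulFun_le v y

lemma mulB_smul (v : C(S2, ℝ)) (c : ℂ) (y : L2S) : mulB v (c • y) = c • mulB v y :=
  mulFun_smul_right v c y

lemma inner_mulB (v : C(S2, ℝ)) (x y : L2S) : ⟪mulB v x, y⟫_ℂ = ⟪x, mulB v y⟫_ℂ := by
  rw [L2.inner_def, L2.inner_def]
  refine integral_congr_ae ?_
  filter_upwards [coeFn_mulB v x, coeFn_mulB v y] with θ h1 h2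
  rw [h1, h2, RCLike.inner_apply, RCLike.inner_apply, map_mul, Complex.conj_ofReal]
  ring

lemma inner_toL2_mulB (v : C(S2, ℝ)) (a b : C(S2, ℂ)) :
    ⟪toL2 a, mulB v (toL2 b)⟫_ℂ = ∫ θ, conj (a θ) * ((v θ : ℂ) * b θ) ∂surf := by
  rw [L2.inner_def]
  refine integral_congr_ae ?_
  filter_upwards [coeFn_mulB v (toL2 b), coeFn_toL2 a, coeFn_toL2 b] with θ h1 h2 h3
  rw [h1, h2, h3, RCLike.inner_apply]
  ring

lemma mulL2_eq_mulB {w : S2 → ℝ} {v : C(S2, ℝ)} (h : ∀ θ, v θ = w θ) (y : L2S) :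
    mulL2 w y = mulB v y := by
  obtain rfl : ⇑v = w := funext h
  rw [mulL2, dif_pos (memLp_mul v y)]
  rfl

/-! ### Consequences of Conditions A1 -/

/-- A function satisfying Conditions A1, as a curve in `C(Σ)` with its derivative. -/
structure DecayCurve (F : ℝ → S2 → ℝ) (γ : ℝ) (Fc dF : ℝ → C(S2, ℝ)) (C : ℝ) : Prop where
  continuous : Continuous Fc
  apply : ∀ s, 1 ≤ s → ∀ θ, Fc s θ = F s θ
  norm_le : ∀ s, 1 ≤ s → ‖Fc s‖ ≤ C * s ^ (-γ)
  norm_le_const : ∀ s, ‖Fc s‖ ≤ C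
  hasDerivWithinAt : ∀ s, 1 ≤ s → HasDerivWithinAt Fc (dF s) (Ici s) s
  norm_deriv_le : ∀ s, 1 ≤ s → ‖dF s‖ ≤ C * s ^ (-1 - γ)
  isC2 : ∀ s, 1 ≤ s → IsC2 (F s)

lemma DecayCurve.mono {F : ℝ → S2 → ℝ} {γ : ℝ} {Fc dF : ℝ → C(S2, ℝ)} {C D : ℝ}
    (h : DecayCurve F γ Fc dF C) (hCD : C ≤ D) : DecayCurve F γ Fc dF D where
  continuous := h.continuous
  apply := h.apply
  norm_le s hs := (h.norm_le s hs).trans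
    (mul_le_mul_of_nonneg_right hCD (Real.rpow_nonneg (zero_le_one.trans hs) _))
  norm_le_const s := (h.norm_le_const s).trans hCD
  hasDerivWithinAt := h.hasDerivWithinAt
  norm_deriv_le s hs := (h.norm_deriv_le s hs).trans
    (mul_le_mul_of_nonneg_right hCD (Real.rpow_nonneg (zero_le_one.trans hs) _))
  isC2 := h.isC2

/-- Two applications of the mean value inequality. Applied to each slice with the same `K`, the
bound is uniform over the sphere, which makes the time derivative exist in the sup norm. -/
lemma taylor_bound {f : ℝ → ℝ} (hf : ContDiffOn ℝ 2 f (Ici 1)) {K : ℝ}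
    (hK : ∀ t, 1 ≤ t → |iteratedDerivWithin 2 f (Ici 1) t| ≤ K) {s t : ℝ} (hs : 1 ≤ s)
    (ht : 1 ≤ t) : |f t - f s - (t - s) * derivWithin f (Ici 1) s| ≤ K * |t - s| ^ 2 := by
  have hu : UniqueDiffOn ℝ (Ici (1 : ℝ)) := uniqueDiffOn_Ici 1
  have hd1 : DifferentiableOn ℝ f (Ici 1) := hf.differentiableOn (by norm_num)
  have hd2 : DifferentiableOn ℝ (derivWithin f (Ici 1)) (Ici 1) :=
    (hf.derivWithin hu (m := 1) (by norm_num)).differentiableOn (by norm_num)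
  have hlip : ∀ x, 1 ≤ x → ∀ y, 1 ≤ y →
      |derivWithin f (Ici 1) y - derivWithin f (Ici 1) x| ≤ K * |y - x| := by
    intro x hx y hy
    refine (convex_Ici (1 : ℝ)).norm_image_sub_le_of_norm_derivWithin_le hd2 (fun z hz => ?_) hx hy
    have := hK z hz
    rwa [iteratedDerivWithin_succ, iteratedDerivWithin_one] at this
  set g : ℝ → ℝ := fun z => f z - z * derivWithin f (Ici 1) s with hg
  have hsub : uIcc s t ⊆ Ici 1 := fun z hz => (le_min hs ht).trans hz.1
  have hg' : ∀ z ∈ uIcc s t, HasDerivWithinAt g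
      (derivWithin f (Ici 1) z - 1 * derivWithin f (Ici 1) s) (uIcc s t) z := by
    intro z hz
    exact (((hd1 z (hsub hz)).hasDerivWithinAt).mono hsub).sub
      ((hasDerivWithinAt_id z _).mul_const _)
  have hb : ∀ z ∈ uIcc s t,
      ‖derivWithin f (Ici 1) z - 1 * derivWithin f (Ici 1) s‖ ≤ K * |t - s| := by
    intro z hz
    rw [one_mul]
    refine (hlip s hs z (hsub hz)).trans ?_
    have hK0 : 0 ≤ K := (abs_nonneg _).trans (hK 1 le_rfl)
    exact mul_le_mul_of_nonneg_left (abs_sub_left_of_mem_uIcc hz) hK0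
  have := (convex_uIcc s t).norm_image_sub_le_of_norm_hasDerivWithin_le hg' hb
    left_mem_uIcc right_mem_uIcc
  rw [Real.norm_eq_abs, Real.norm_eq_abs] at this
  calc |f t - f s - (t - s) * derivWithin f (Ici 1) s| = |g t - g s| := by
        rw [hg]
        congr 1
        ring
    _ ≤ _ := this
    _ = _ := by ring

/-- Of the second-derivative condition only boundedness is used, to upgrade pointwise time
derivatives to a derivative in `C(Σ)`. -/
theorem ConditionsA1.exists_decayCurve {F : ℝ → S2 → ℝ} {γ : ℝ} (hF : ConditionsA1 F γ) :
    ∃ Fc dF C, DecayCurve F γ Fc dF C := by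
  obtain ⟨C, hC⟩ := hF.bounds
  have hγ : 0 < γ := lt_trans (by norm_num) hF.half_lt
  have hC0 : 0 ≤ C := by
    have h := (abs_nonneg _).trans_lt (hC 1 le_rfl (toS2 0)).1
    rw [Real.one_rpow, mul_one] at h
    exact h.le
  -- Freezing the time below `1` yields a curve continuous and bounded on all of `ℝ`.
  have hcont : Continuous fun p : ℝ × S2 => F (max p.1 1) p.2 := by
    have h1 : Continuous fun p : ℝ × S2 => (max p.1 1, p.2) := by fun_prop
    exact hF.contMDiffOn.continuousOn.comp_continuous h1 fun p =>
      ⟨mem_Ici.mpr (le_max_right p.1 1), mem_univ _⟩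
  set Fc : ℝ → C(S2, ℝ) := ⇑(ContinuousMap.curry ⟨_, hcont⟩) with hFc
  have hFa : ∀ s θ, Fc s θ = F (max s 1) θ := fun s θ => rfl
  have hFa1 : ∀ s, 1 ≤ s → ∀ θ, Fc s θ = F s θ := fun s hs θ => by rw [hFa, max_eq_left hs]
  have hslice : ∀ θ, ContDiffOn ℝ 2 (fun s => F s θ) (Ici 1) := by
    intro θ
    rw [← contMDiffOn_iff_contDiffOn]
    have h1 : ContMDiffOn 𝓘(ℝ, ℝ) (𝓘(ℝ, ℝ).prod (𝓡 2)) 2 (fun s : ℝ => (s, θ)) (Ici 1) :=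
      contMDiffOn_id.prodMk contMDiffOn_const
    exact hF.contMDiffOn.comp h1 fun s hs => ⟨hs, mem_univ _⟩
  have htay : ∀ θ s t, 1 ≤ s → 1 ≤ t →
      |F t θ - F s θ - (t - s) * derivWithin (fun s => F s θ) (Ici 1) s| ≤ C * |t - s| ^ 2 := by
    intro θ s t hs ht
    refine taylor_bound (hslice θ) (fun z hz => (hC z hz θ).2.2.le.trans ?_) hs ht
    exact mul_le_of_le_one_right hC0 (Real.rpow_le_one_of_one_le_of_nonpos hz (by linarith))
  -- The time derivative is a uniform limit of difference quotients, hence continuous on the sphere.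
  have hdc : ∀ s, 1 ≤ s → Continuous fun θ => derivWithin (fun s => F s θ) (Ici 1) s := by
    intro s hs
    have hlim : TendstoUniformly (fun (n : ℕ) θ => ((n : ℝ) + 1) *
        (Fc (s + 1 / ((n : ℝ) + 1)) θ - Fc s θ))
        (fun θ => derivWithin (fun s => F s θ) (Ici 1) s) atTop := by
      rw [Metric.tendstoUniformly_iff]
      intro ε hε
      have h0 : Tendsto (fun n : ℕ => C * (1 / ((n : ℝ) + 1))) atTop (𝓝 0) := by
        simpa using tendsto_one_div_add_atTop_nhds_zero_nat.const_mul C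
      filter_upwards [h0.eventually_lt_const hε] with n hn θ
      have hn0 : (0 : ℝ) < (n : ℝ) + 1 := by positivity
      have h1 : 1 ≤ s + 1 / ((n : ℝ) + 1) := by
        have : 0 < 1 / ((n : ℝ) + 1) := by positivity
        linarith
      have h2 := htay θ s _ hs h1
      rw [add_sub_cancel_left, abs_of_pos (show 0 < 1 / ((n : ℝ) + 1) by positivity)] at h2
      rw [hFa1 _ h1, hFa1 _ hs, dist_comm, Real.dist_eq]
      refine lt_of_le_of_lt ?_ hn
      have e : ((n : ℝ) + 1) * (F (s + 1 / ((n : ℝ) + 1)) θ - F s θ)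
          - derivWithin (fun s => F s θ) (Ici 1) s = ((n : ℝ) + 1) *
          (F (s + 1 / ((n : ℝ) + 1)) θ - F s θ
            - 1 / ((n : ℝ) + 1) * derivWithin (fun s => F s θ) (Ici 1) s) := by
        field_simp
      rw [e, abs_mul, abs_of_pos hn0]
      calc _ ≤ ((n : ℝ) + 1) * (C * (1 / ((n : ℝ) + 1)) ^ 2) := by gcongr
        _ = _ := by field_simp
    refine hlim.continuous (Frequently.of_forall fun n => ?_)
    exact continuous_const.mul ((Fc _).continuous.sub (Fc s).continuous)
  set dF : ℝ → C(S2, ℝ) := fun s => if hs : 1 ≤ s then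
    ⟨fun θ => derivWithin (fun s => F s θ) (Ici 1) s, hdc s hs⟩ else 0 with hdF
  have hdFa : ∀ s, 1 ≤ s → ∀ θ, dF s θ = derivWithin (fun s => F s θ) (Ici 1) s := by
    intro s hs θ
    simp [dF, hs]
  refine ⟨Fc, dF, C, (ContinuousMap.curry _).continuous, hFa1, ?_, ?_, ?_, ?_, ?_⟩
  · intro s hs
    refine (ContinuousMap.norm_le _ (by positivity)).mpr fun θ => ?_
    rw [hFa1 s hs]
    exact (hC s hs θ).1.le
  · intro s
    refine (ContinuousMap.norm_le _ hC0).mpr fun θ => ?_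
    refine (hC (max s 1) (le_max_right _ _) θ).1.le.trans ?_
    exact mul_le_of_le_one_right hC0
      (Real.rpow_le_one_of_one_le_of_nonpos (le_max_right _ _) (by linarith))
  · intro s hs
    rw [hasDerivWithinAt_iff_isLittleO]
    have h1 : (fun t => Fc t - Fc s - (t - s) • dF s) =O[𝓝[Ici s] s] fun t => (t - s) ^ 2 := by
      refine Asymptotics.IsBigO.of_bound C ?_
      filter_upwards [self_mem_nhdsWithin] with t hst
      have ht : 1 ≤ t := hs.trans hst
      refine (ContinuousMap.norm_le _ (by positivity)).mpr fun θ => ?_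
      have := htay θ s t hs ht
      simp only [ContinuousMap.sub_apply, ContinuousMap.smul_apply, smul_eq_mul, hFa1 t ht,
        hFa1 s hs, hdFa s hs, Real.norm_eq_abs, abs_pow]
      exact this
    refine h1.trans_isLittleO (Asymptotics.IsLittleO.mono ?_ nhdsWithin_le_nhds)
    simpa using Asymptotics.isLittleO_pow_sub_sub s one_lt_two
  · intro s hs
    refine (ContinuousMap.norm_le _ (by positivity)).mpr fun θ => ?_
    rw [hdFa s hs]
    exact (hC s hs θ).2.1.le
  · intro s hs
    refine IsC2.of_contMDiff (n := 2) le_rfl ?_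
    rw [← contMDiffOn_univ]
    have h1 : ContMDiffOn (𝓡 2) (𝓘(ℝ, ℝ).prod (𝓡 2)) 2 (fun θ : S2 => (s, θ)) univ :=
      contMDiffOn_const.prodMk contMDiffOn_id
    exact hF.contMDiffOn.comp h1 fun θ _ => ⟨hs, mem_univ _⟩

section Abstract

/-! ### Estimates for abstract evolution equations -/

/-- A mean value inequality that only needs right derivatives, as available at the initial time. It
is used with a positive exponent `p` for energy growth and a negative one for decay. -/
lemma norm_sub_le_of_deriv_rpow {E : Type*} [NormedAddCommGroup E] [NormedSpace ℝ E]
    {f f' : ℝ → E} {a b K p : ℝ} (ha : 1 ≤ a) (hab : a ≤ b) (hp : p ≠ 0)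
    (hf : ∀ s, 1 ≤ s → ContinuousAt f s)
    (hf' : ∀ s, 1 ≤ s → HasDerivWithinAt f (f' s) (Ici s) s)
    (hK : ∀ s, a ≤ s → ‖f' s‖ ≤ K * s ^ (p - 1)) :
    ‖f b - f a‖ ≤ K / p * (b ^ p - a ^ p) := by
  refine image_norm_le_of_norm_deriv_right_le_deriv_boundary' (f := fun s => f s - f a)
    (f' := f') (a := a) (b := b) (B := fun s => K / p * (s ^ p - a ^ p))
    (B' := fun s => K * s ^ (p - 1)) ?_ ?_ (by simp) ?_ ?_ ?_ ⟨hab, le_rfl⟩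
  · exact fun s hs => ((hf s (ha.trans hs.1)).sub continuousAt_const).continuousWithinAt
  · exact fun s hs => (hf' s (ha.trans hs.1)).sub_const _
  · intro s hs
    have h0 : s ≠ 0 := (zero_lt_one.trans_le (ha.trans hs.1)).ne'
    exact ((((Real.hasDerivAt_rpow_const (p := p) (Or.inl h0)).sub_const _).const_mul
      _).continuousAt).continuousWithinAt
  · intro s hs
    have h0 : s ≠ 0 := (zero_lt_one.trans_le (ha.trans hs.1)).ne'
    refine (((Real.hasDerivAt_rpow_const (p := p) (Or.inl h0)).sub_const
      _).const_mul (K / p)).hasDerivWithinAt.congr_deriv ?_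
    field_simp
  · exact fun s hs => hK s hs.1

variable {H : Type*} [NormedAddCommGroup H] [InnerProductSpace ℂ H]
  {c : ℂ} {W : Submodule ℂ H} [W.HasOrthogonalProjection] {B : H →L[ℂ] H}

lemma inner_starProjection_right_of_mem {x : H} (hx : x ∈ W) (z : H) :
    ⟪x, W.starProjection z⟫_ℂ = ⟪x, z⟫_ℂ := by
  rw [← Submodule.inner_starProjection_left_eq_right, Submodule.starProjection_eq_self_iff.mpr hx]

lemma inner_starProjection_left_of_mem {x : H} (hx : x ∈ W) (z : H) :
    ⟪W.starProjection z, x⟫_ℂ = ⟪z, x⟫_ℂ := by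
  rw [Submodule.inner_starProjection_left_eq_right, Submodule.starProjection_eq_self_iff.mpr hx]

variable [NormedSpace ℝ H]

/-- A curve of bounded symmetric operators decaying like `s ^ (-γ)`. -/
structure OperatorCurve (A dA : ℝ → H →L[ℝ] H) (γ C : ℝ) : Prop where
  continuous : Continuous A
  map_smul : ∀ s (c : ℂ) x, A s (c • x) = c • A s x
  symm : ∀ s x y, ⟪A s x, y⟫_ℂ = ⟪x, A s y⟫_ℂ
  norm_le : ∀ s, 1 ≤ s → ∀ x, ‖A s x‖ ≤ C * s ^ (-γ) * ‖x‖
  hasDerivWithinAt : ∀ s, 1 ≤ s → HasDerivWithinAt A (dA s) (Ici s) s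
  norm_deriv_le : ∀ s, 1 ≤ s → ∀ x, ‖dA s x‖ ≤ C * s ^ (-1 - γ) * ‖x‖

lemma norm_inner_self_apply_le {A dA : ℝ → H →L[ℝ] H} {γ C : ℝ} (hA : OperatorCurve A dA γ C)
    {s : ℝ} (hs : 1 ≤ s) (x y : H) : ‖⟪x, A s y⟫_ℂ‖ ≤ C * s ^ (-γ) * (‖x‖ * ‖y‖) := by
  refine (norm_inner_le_norm _ _).trans ?_
  calc ‖x‖ * ‖A s y‖ ≤ ‖x‖ * (C * s ^ (-γ) * ‖y‖) :=
        mul_le_mul_of_nonneg_left (hA.norm_le s hs y) (norm_nonneg _)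
    _ = _ := by ring

lemma norm_inner_self_deriv_le {A dA : ℝ → H →L[ℝ] H} {γ C : ℝ} (hA : OperatorCurve A dA γ C)
    {s : ℝ} (hs : 1 ≤ s) (x y : H) : ‖⟪x, dA s y⟫_ℂ‖ ≤ C * s ^ (-1 - γ) * (‖x‖ * ‖y‖) := by
  refine (norm_inner_le_norm _ _).trans ?_
  calc ‖x‖ * ‖dA s y‖ ≤ ‖x‖ * (C * s ^ (-1 - γ) * ‖y‖) :=
        mul_le_mul_of_nonneg_left (hA.norm_deriv_le s hs y) (norm_nonneg _)
    _ = _ := by ring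

/-- The equation `y' = c (s⁻² B + P V) y` in a subspace `W`, where `P` is the orthogonal projection
onto `W`. -/
structure ProjectedFlow (c : ℂ) (W : Submodule ℂ H) [W.HasOrthogonalProjection] (B : H →L[ℂ] H)
    (V : ℝ → H → H) (y : ℝ → H) : Prop where
  mem : ∀ s, y s ∈ W
  hasDerivAt : ∀ s, 1 ≤ s → HasDerivAt y
    ((c * (((s ^ 2)⁻¹ : ℝ) : ℂ)) • B (y s) + c • W.starProjection (V s (y s))) s

/-- The factor `c` is imaginary and the operators are symmetric; the projection is invisible in
inner products with vectors of `W`. -/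
lemma ProjectedFlow.norm_eq (hc : conj c = -c) (hB : ∀ x ∈ W, ∀ y ∈ W, ⟪B x, y⟫_ℂ = ⟪x, B y⟫_ℂ)
    {V : ℝ → H → H} (hV : ∀ s x y, ⟪V s x, y⟫_ℂ = ⟪x, V s y⟫_ℂ) {y : ℝ → H}
    (hy : ProjectedFlow c W B V y) {a b : ℝ} (ha : 1 ≤ a) (hab : a ≤ b) : ‖y b‖ = ‖y a‖ := by
  have hd : ∀ s, 1 ≤ s → HasDerivAt (fun s => ⟪y s, y s⟫_ℂ) 0 s := by
    intro s hs
    refine ((hy.hasDerivAt s hs).inner ℂ (hy.hasDerivAt s hs)).congr_deriv ?_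
    simp only [inner_add_left, inner_add_right, inner_smul_left, inner_smul_right, map_mul, hc,
      Complex.conj_ofReal, inner_starProjection_right_of_mem (hy.mem s),
      inner_starProjection_left_of_mem (hy.mem s), hB _ (hy.mem s) _ (hy.mem s), hV]
    ring
  have h := constant_of_has_deriv_right_zero (f := fun s => ⟪y s, y s⟫_ℂ) (a := a) (b := b)
    (fun s hs => (hd s (ha.trans hs.1)).continuousAt.continuousWithinAt)
    (fun s hs => (hd s (ha.trans hs.1)).hasDerivWithinAt) b ⟨hab, le_rfl⟩
  simp only [inner_self_eq_norm_sq_to_K] at h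
  have h2 : ‖y b‖ ^ 2 = ‖y a‖ ^ 2 := by exact_mod_cast h
  exact (sq_eq_sq₀ (norm_nonneg _) (norm_nonneg _)).mp h2

variable [IsScalarTower ℝ ℂ H]

/-- The Hamiltonian rescaled by `s²`, with expectation `⟪y, B y⟫ + s² ⟪y, V y⟫`, changes only
through its explicit time dependence. That is `2s V + s² V'`, of size `s^(1-γ)`, and integrates to
`s^(2-γ)`. -/
lemma ProjectedFlow.norm_inner_le (hc : conj c = -c)
    (hB : ∀ x ∈ W, ∀ y ∈ W, ⟪B x, y⟫_ℂ = ⟪x, B y⟫_ℂ) (hBW : ∀ x, B x ∈ W)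
    {V dV : ℝ → H →L[ℝ] H} {γ C : ℝ} (hγ : γ < 1) (hV : OperatorCurve V dV γ C) (hC : 0 ≤ C)
    {y : ℝ → H} (hy : ProjectedFlow c W B (fun s => V s) y) {s : ℝ} (hs : 1 ≤ s) :
    ‖⟪y s, B (y s)⟫_ℂ‖ ≤ (‖⟪y 1, B (y 1)⟫_ℂ‖ + 5 * C * ‖y 1‖ ^ 2) * s ^ (2 - γ) := by
  set N := ‖y 1‖ ^ 2 with hN
  have hN0 : 0 ≤ N := by positivity
  have hyN : ∀ s, 1 ≤ s → ‖y s‖ * ‖y s‖ = N := fun s hs => by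
    rw [hy.norm_eq hc hB hV.symm le_rfl hs, hN, sq]
  set e : ℝ → ℂ := fun s => ⟪y s, B (y s)⟫_ℂ + ((s ^ 2 : ℝ) : ℂ) * ⟪y s, V s (y s)⟫_ℂ with he
  set e' : ℝ → ℂ := fun s =>
    ((2 * s : ℝ) : ℂ) * ⟪y s, V s (y s)⟫_ℂ + ((s ^ 2 : ℝ) : ℂ) * ⟪y s, dV s (y s)⟫_ℂ with he'
  have hcont : ∀ s, 1 ≤ s → ContinuousAt e s := by
    intro s hs
    have h1 := (hy.hasDerivAt s hs).continuousAt
    have h2 : ContinuousAt (fun s => V s (y s)) s := hV.continuous.continuousAt.clm_apply h1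
    have h3 : ContinuousAt (fun s => B (y s)) s := B.continuous.continuousAt.comp h1
    have h4 : ContinuousAt (fun s : ℝ => ((s ^ 2 : ℝ) : ℂ)) s :=
      Continuous.continuousAt (by fun_prop)
    exact (h1.inner h3).add (h4.mul (h1.inner h2))
  have hd : ∀ s, 1 ≤ s → HasDerivWithinAt e (e' s) (Ici s) s := by
    intro s hs
    have hs0 : (s : ℂ) ≠ 0 := by exact_mod_cast (zero_lt_one.trans_le hs).ne'
    set D := (c * (((s ^ 2)⁻¹ : ℝ) : ℂ)) • B (y s) + c • W.starProjection (V s (y s)) with hD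
    have h1 : HasDerivWithinAt y D (Ici s) s := (hy.hasDerivAt s hs).hasDerivWithinAt
    have h2 : HasDerivWithinAt (fun s => V s (y s)) (dV s (y s) + V s D) (Ici s) s :=
      (hV.hasDerivWithinAt s hs).clm_apply h1
    have h3 : HasDerivWithinAt (fun s => B (y s)) (B D) (Ici s) s :=
      ((B.restrictScalars ℝ).hasFDerivAt.comp_hasDerivWithinAt s h1)
    have h4 : HasDerivWithinAt (fun s : ℝ => ((s ^ 2 : ℝ) : ℂ)) ((2 * s : ℝ) : ℂ) (Ici s) s := by
      simpa using ((hasDerivAt_pow 2 s).ofReal_comp).hasDerivWithinAt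
    refine ((h1.inner ℂ h3).add (h4.mul (h1.inner ℂ h2))).congr_deriv ?_
    have hDW : D ∈ W := W.add_mem (W.smul_mem _ (hBW _))
      (W.smul_mem _ (Submodule.starProjection_apply_mem _ _))
    -- With `D = c s⁻² (B y + s² P V y)`, the terms in which `y` is differentiated sum to twice the
    -- real part of `⟪D, B y + s² P V y⟫`, which vanishes since `c` is imaginary.
    rw [← hB _ (hy.mem s) _ hDW, inner_add_right (y s), ← hV.symm s (y s) D,
      ← inner_starProjection_left_of_mem hDW (V s (y s)),
      ← inner_starProjection_right_of_mem hDW (V s (y s)), he', hD]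
    simp only [inner_add_left, inner_add_right, inner_smul_left, inner_smul_right, map_mul, hc,
      Complex.conj_ofReal]
    push_cast
    field_simp
    ring
  have hb : ∀ s, 1 ≤ s → ‖e' s‖ ≤ 3 * C * N * s ^ ((2 - γ) - 1) := by
    intro s hs
    have hs0 : 0 < s := zero_lt_one.trans_le hs
    have a1 := norm_inner_self_apply_le hV hs (y s) (y s)
    have a2 := norm_inner_self_deriv_le hV hs (y s) (y s)
    rw [hyN s hs] at a1 a2
    have r1 : s * s ^ (-γ) = s ^ ((2 - γ) - 1) := by
      rw [← Real.rpow_one_add' hs0.le (by linarith)]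
      congr 1
      ring
    have r2 : s ^ 2 * s ^ (-1 - γ) = s ^ ((2 - γ) - 1) := by
      rw [← Real.rpow_natCast s 2, ← Real.rpow_add hs0]
      congr 1
      push_cast
      ring
    refine (norm_add_le _ _).trans ?_
    rw [norm_mul, norm_mul, Complex.norm_real, Complex.norm_real, Real.norm_of_nonneg (by positivity),
      Real.norm_of_nonneg (by positivity)]
    calc _ ≤ 2 * s * (C * s ^ (-γ) * N) + s ^ 2 * (C * s ^ (-1 - γ) * N) := by gcongr
      _ = 2 * C * N * (s * s ^ (-γ)) + C * N * (s ^ 2 * s ^ (-1 - γ)) := by ring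
      _ = _ := by
        rw [r1, r2]
        ring
  have h := norm_sub_le_of_deriv_rpow le_rfl hs (by linarith : (2 - γ) ≠ 0) hcont hd hb
  have hs1 : 1 ≤ s ^ (2 - γ) := Real.one_le_rpow hs (by linarith)
  have hdiv : 3 * C * N / (2 - γ) ≤ 3 * C * N := div_le_self (by positivity) (by linarith)
  have a1 := norm_inner_self_apply_le hV le_rfl (y 1) (y 1)
  have a2 := norm_inner_self_apply_le hV hs (y s) (y s)
  rw [hyN 1 le_rfl, Real.one_rpow, mul_one] at a1
  rw [hyN s hs] at a2
  have r1 : s ^ 2 * s ^ (-γ) = s ^ (2 - γ) := by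
    rw [← Real.rpow_natCast s 2, ← Real.rpow_add (zero_lt_one.trans_le hs)]
    congr 1
  have n1 : ‖e 1‖ ≤ ‖⟪y 1, B (y 1)⟫_ℂ‖ + C * N := by
    refine (norm_add_le _ _).trans ?_
    simpa using a1
  have n2 : ‖⟪y s, B (y s)⟫_ℂ‖ ≤ ‖e s‖ + C * N * s ^ (2 - γ) := by
    have : ⟪y s, B (y s)⟫_ℂ = e s - ((s ^ 2 : ℝ) : ℂ) * ⟪y s, V s (y s)⟫_ℂ := by
      rw [he]
      ring
    rw [this]
    refine (norm_sub_le _ _).trans ?_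
    rw [norm_mul, Complex.norm_real, Real.norm_of_nonneg (by positivity), ← r1]
    have := mul_le_mul_of_nonneg_left a2 (sq_nonneg s)
    linarith
  have n3 : ‖e s‖ ≤ ‖e 1‖ + ‖e s - e 1‖ := by
    have := norm_add_le (e 1) (e s - e 1)
    rwa [add_sub_cancel] at this
  rw [Real.one_rpow] at h
  have n4 : ‖e s - e 1‖ ≤ 3 * C * N * s ^ (2 - γ) := by
    refine h.trans ?_
    have : 0 ≤ s ^ (2 - γ) - 1 := by linarith
    calc _ ≤ 3 * C * N * (s ^ (2 - γ) - 1) := mul_le_mul_of_nonneg_right hdiv this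
      _ ≤ _ := mul_le_mul_of_nonneg_left (by linarith) (by positivity)
  have n5 : (‖⟪y 1, B (y 1)⟫_ℂ‖ + C * N) ≤ (‖⟪y 1, B (y 1)⟫_ℂ‖ + C * N) * s ^ (2 - γ) :=
    le_mul_of_one_le_right (by positivity) hs1
  -- The constant `5` is `1` for the potential term at time `1`, `3` for the integrated derivative,
  -- and `1` for the potential term at time `s`.
  linarith

/-- An upper bound for the rate of change of the approximate correlation of perturbed and free
evolutions. -/
noncomputable def correlationBound (κ C N K : ℝ) : ℝ :=
  C * N + κ * C ^ 2 * N + κ * (2 * C ^ 2 * N + 4 * C ^ 2 * K + K)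

/-- The constant in the distance between perturbed and free evolutions. -/
noncomputable def separationBound (κ γ C N K : ℝ) : ℝ :=
  2 * (correlationBound κ C N K / (3 * γ / 2 - 1) + 2 * C * N)

/-- The corrected correlation `⟪z, y⟫ + ⟪z, Q y⟫` has an integrable derivative and the correction
itself decays, so `⟪z, y⟫` stays near its value `N` at time `a`. As both flows keep the squared norm
`N`, the vectors stay close. -/
lemma norm_sub_sq_le_of_flows (hc : conj c = -c)
    (hB : ∀ x ∈ W, ∀ y ∈ W, ⟪B x, y⟫_ℂ = ⟪x, B y⟫_ℂ) (hBW : ∀ x, B x ∈ W)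
    {V dV Q dQ : ℝ → H →L[ℝ] H} {γ C : ℝ} (hγ : 2 / 3 < γ) (hγ1 : γ < 1)
    (hV : OperatorCurve V dV γ C) (hQ : OperatorCurve Q dQ γ C) (hC : 0 ≤ C)
    (hcomm : ∀ s, 1 ≤ s → ∀ u ∈ W, ∀ v ∈ W, ∀ ε : ℝ, 0 < ε →
      ‖((s ^ 2 : ℝ) : ℂ) * ⟪v, V s u⟫_ℂ - ⟪B v, Q s u⟫_ℂ + ⟪v, Q s (B u)⟫_ℂ‖
        ≤ ε * (2 * (C * s ^ (-γ) * (s ^ 2 * (C * s ^ (-γ)))) * ‖v‖ ^ 2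
          + 4 * (C * s ^ (-γ)) ^ 2 * ‖⟪v, B v⟫_ℂ‖) + ε⁻¹ * ‖⟪u, B u⟫_ℂ‖)
    {y z : ℝ → H} (hy : ProjectedFlow c W B (fun s => V s) y)
    (hz : ProjectedFlow c W B (fun _ _ => 0) z) {a b : ℝ} (ha : 1 ≤ a) (hab : a ≤ b)
    (hza : z a = y a) (hzB : ∀ s, ⟪z s, B (z s)⟫_ℂ = ⟪z a, B (z a)⟫_ℂ)
    (hzn : ∀ s, ‖z s‖ = ‖z a‖) :
    ‖y b - z b‖ ^ 2 ≤ separationBound ‖c‖ γ C (‖y 1‖ ^ 2)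
      (‖⟪y 1, B (y 1)⟫_ℂ‖ + 5 * C * ‖y 1‖ ^ 2) * a ^ (-(3 * γ / 2 - 1)) := by
  set N := ‖y 1‖ ^ 2 with hN
  set K := ‖⟪y 1, B (y 1)⟫_ℂ‖ + 5 * C * N with hK
  set L := correlationBound ‖c‖ C N K with hL
  have hN0 : 0 ≤ N := by positivity
  have hK0 : 0 ≤ K := by positivity
  have hL0 : 0 ≤ L := by
    rw [hL, correlationBound]
    positivity
  have hyn : ∀ s, 1 ≤ s → ‖y s‖ = ‖y 1‖ := fun s hs => hy.norm_eq hc hB hV.symm le_rfl hs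
  have hzn' : ∀ s, ‖z s‖ = ‖y 1‖ := fun s => by rw [hzn, hza, hyn a ha]
  have hNz : ∀ s, 1 ≤ s → ‖z s‖ * ‖y s‖ = N := fun s hs => by rw [hzn', hyn s hs, hN, sq]
  have hyB : ∀ s, 1 ≤ s → ‖⟪y s, B (y s)⟫_ℂ‖ ≤ K * s ^ (2 - γ) := fun s hs =>
    hy.norm_inner_le hc hB hBW hγ1 hV hC hs
  set f : ℝ → ℂ := fun s => ⟪z s, y s⟫_ℂ + ⟪z s, Q s (y s)⟫_ℂ with hf
  -- The terms with coefficient `c s⁻²` form exactly the combination bounded by `hcomm`; the others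
  -- decay like `s^(-1-γ)` and `s^(-2γ)`.
  set f' : ℝ → ℂ := fun s => ⟪z s, dQ s (y s)⟫_ℂ + c * ⟪z s, Q s (W.starProjection (V s (y s)))⟫_ℂ
    + c * (((s ^ 2)⁻¹ : ℝ) : ℂ) * (((s ^ 2 : ℝ) : ℂ) * ⟪z s, V s (y s)⟫_ℂ - ⟪B (z s), Q s (y s)⟫_ℂ
      + ⟪z s, Q s (B (y s))⟫_ℂ) with hf'
  have hcont : ∀ s, 1 ≤ s → ContinuousAt f s := by
    intro s hs
    have h1 := (hy.hasDerivAt s hs).continuousAt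
    have h2 : ContinuousAt (fun s => Q s (y s)) s := hQ.continuous.continuousAt.clm_apply h1
    have h3 := (hz.hasDerivAt s hs).continuousAt
    exact (h3.inner h1).add (h3.inner h2)
  have hd : ∀ s, 1 ≤ s → HasDerivWithinAt f (f' s) (Ici s) s := by
    intro s hs
    have hs0 : (s : ℂ) ≠ 0 := by exact_mod_cast (zero_lt_one.trans_le hs).ne'
    have h1 := (hy.hasDerivAt s hs).hasDerivWithinAt (s := Ici s)
    have h2 := (hQ.hasDerivWithinAt s hs).clm_apply h1
    have h3 := (hz.hasDerivAt s hs).hasDerivWithinAt (s := Ici s)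
    refine ((h3.inner ℂ h1).add (h3.inner ℂ h2)).congr_deriv ?_
    simp only [hf', map_zero, smul_zero, add_zero, map_add, hQ.map_smul, inner_add_right, inner_smul_left, inner_smul_right, map_mul, hc, Complex.conj_ofReal,
      inner_starProjection_right_of_mem (hz.mem s), hB _ (hz.mem s) _ (hy.mem s)]
    push_cast
    field_simp
    ring
  have hb : ∀ s, a ≤ s → ‖f' s‖ ≤ L * s ^ (-(3 * γ / 2 - 1) - 1) := by
    intro s has
    have hs : 1 ≤ s := ha.trans has
    have hs0 : 0 < s := zero_lt_one.trans_le hs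
    set r := s ^ (-(3 * γ / 2 - 1) - 1) with hr
    have b1 : ‖⟪z s, dQ s (y s)⟫_ℂ‖ ≤ C * N * r := by
      refine (norm_inner_self_deriv_le hQ hs _ _).trans ?_
      rw [hNz s hs]
      have : s ^ (-1 - γ) ≤ r := Real.rpow_le_rpow_of_exponent_le hs (by linarith)
      calc C * s ^ (-1 - γ) * N = C * N * s ^ (-1 - γ) := by ring
        _ ≤ _ := mul_le_mul_of_nonneg_left this (by positivity)
    have b2 : ‖c * ⟪z s, Q s (W.starProjection (V s (y s)))⟫_ℂ‖ ≤ ‖c‖ * C ^ 2 * N * r := by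
      rw [norm_mul]
      have h1 := norm_inner_self_apply_le hQ hs (z s) (W.starProjection (V s (y s)))
      have h2 : ‖W.starProjection (V s (y s))‖ ≤ C * s ^ (-γ) * ‖y s‖ :=
        (W.norm_starProjection_apply_le _).trans (hV.norm_le s hs _)
      have h3 : s ^ (-γ) * s ^ (-γ) ≤ r := by
        rw [← Real.rpow_add hs0]
        exact Real.rpow_le_rpow_of_exponent_le hs (by linarith)
      have h4 : ‖⟪z s, Q s (W.starProjection (V s (y s)))⟫_ℂ‖ ≤ C ^ 2 * N * r := by
        calc _ ≤ C * s ^ (-γ) * (‖z s‖ * (C * s ^ (-γ) * ‖y s‖)) := h1.trans (by gcongr)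
          _ = C ^ 2 * (‖z s‖ * ‖y s‖) * (s ^ (-γ) * s ^ (-γ)) := by ring
          _ ≤ _ := by
            rw [hNz s hs]
            gcongr
      calc _ ≤ ‖c‖ * (C ^ 2 * N * r) := mul_le_mul_of_nonneg_left h4 (norm_nonneg _)
        _ = _ := by ring
    -- The weight `s^(γ/2)` balances `ε s^(2-2γ)` against `ε⁻¹ s^(2-γ)`; both become `s^(2-3γ/2)`.
    have b3 := hcomm s hs (y s) (hy.mem s) (z s) (hz.mem s) (s ^ (γ / 2)) (by positivity)
    -- The free flow conserves its energy, which at time `a` is that of `y`.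
    have hzK : ‖⟪z s, B (z s)⟫_ℂ‖ ≤ K * s ^ (2 - γ) := by
      rw [hzB, hza]
      refine (hyB a ha).trans (mul_le_mul_of_nonneg_left ?_ hK0)
      exact Real.rpow_le_rpow (by linarith) has (by linarith)
    have b4 : s ^ (γ / 2) * (2 * (C * s ^ (-γ) * (s ^ 2 * (C * s ^ (-γ)))) * ‖z s‖ ^ 2
          + 4 * (C * s ^ (-γ)) ^ 2 * ‖⟪z s, B (z s)⟫_ℂ‖) + (s ^ (γ / 2))⁻¹ * ‖⟪y s, B (y s)⟫_ℂ‖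
        ≤ s ^ 2 * ((2 * C ^ 2 * N + 4 * C ^ 2 * K + K) * r) := by
      have e1 : s ^ (γ / 2) * (s ^ (-γ) * s ^ (-γ)) = r := by
        rw [← Real.rpow_add hs0, ← Real.rpow_add hs0]
        congr 1
        ring
      have e2 : (s ^ (γ / 2))⁻¹ * s ^ (2 - γ) = s ^ 2 * r := by
        rw [← Real.rpow_neg hs0.le, ← Real.rpow_add hs0, ← Real.rpow_natCast s 2,
          ← Real.rpow_add hs0]
        congr 1
        push_cast
        ring
      have e3 : s ^ (2 - γ) ≤ s ^ 2 := by
        rw [← Real.rpow_natCast s 2]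
        exact Real.rpow_le_rpow_of_exponent_le hs (by push_cast; linarith)
      calc _ ≤ s ^ (γ / 2) * (2 * (C * s ^ (-γ) * (s ^ 2 * (C * s ^ (-γ)))) * N
          + 4 * (C * s ^ (-γ)) ^ 2 * (K * s ^ 2)) + (s ^ (γ / 2))⁻¹ * (K * s ^ (2 - γ)) := by
            rw [hzn', ← hN]
            gcongr
            · exact hzK.trans (mul_le_mul_of_nonneg_left e3 hK0)
            · exact hyB s hs
        _ = s ^ 2 * (2 * C ^ 2 * N + 4 * C ^ 2 * K) * (s ^ (γ / 2) * (s ^ (-γ) * s ^ (-γ)))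
            + K * ((s ^ (γ / 2))⁻¹ * s ^ (2 - γ)) := by ring
        _ = _ := by
          rw [e1, e2]
          ring
    have b5 := b3.trans b4
    refine (norm_add₃_le).trans ?_
    have b6 : ‖c * (((s ^ 2)⁻¹ : ℝ) : ℂ) * (((s ^ 2 : ℝ) : ℂ) * ⟪z s, V s (y s)⟫_ℂ
        - ⟪B (z s), Q s (y s)⟫_ℂ + ⟪z s, Q s (B (y s))⟫_ℂ)‖
        ≤ ‖c‖ * ((2 * C ^ 2 * N + 4 * C ^ 2 * K + K) * r) := by
      rw [norm_mul, norm_mul, Complex.norm_real, Real.norm_of_nonneg (by positivity)]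
      calc _ ≤ ‖c‖ * (s ^ 2)⁻¹ * (s ^ 2 * ((2 * C ^ 2 * N + 4 * C ^ 2 * K + K) * r)) :=
            mul_le_mul_of_nonneg_left b5 (by positivity)
        _ = _ := by field_simp
    rw [hL, correlationBound]
    linarith
  set δ := 3 * γ / 2 - 1 with hδ
  have hδ0 : 0 < δ := by linarith
  have h1 := norm_sub_le_of_deriv_rpow ha hab (neg_ne_zero.mpr hδ0.ne') hcont hd hb
  have hb1 : 1 ≤ b := ha.trans hab
  have h2 : ‖f b - f a‖ ≤ L / δ * a ^ (-δ) := by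
    refine h1.trans ?_
    have : L / -δ * (b ^ (-δ) - a ^ (-δ)) = L / δ * a ^ (-δ) - L / δ * b ^ (-δ) := by
      rw [div_neg]
      ring
    rw [this]
    have : 0 ≤ L / δ * b ^ (-δ) := by
      have : 0 ≤ b := by linarith
      positivity
    linarith
  have hQb : ∀ s, a ≤ s → ‖⟪z s, Q s (y s)⟫_ℂ‖ ≤ C * N * a ^ (-δ) := by
    intro s has
    have hs : 1 ≤ s := ha.trans has
    refine (norm_inner_self_apply_le hQ hs _ _).trans ?_
    rw [hNz s hs]
    have : s ^ (-γ) ≤ a ^ (-δ) := by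
      calc s ^ (-γ) ≤ s ^ (-δ) := Real.rpow_le_rpow_of_exponent_le hs (by linarith)
        _ ≤ a ^ (-δ) := Real.rpow_le_rpow_of_nonpos (by linarith) has (by linarith)
    calc C * s ^ (-γ) * N = C * N * s ^ (-γ) := by ring
      _ ≤ _ := mul_le_mul_of_nonneg_left this (by positivity)
  have h3 : ‖⟪z b, y b⟫_ℂ - (N : ℂ)‖ ≤ (L / δ + 2 * C * N) * a ^ (-δ) := by
    have e1 : ⟪z a, y a⟫_ℂ = (N : ℂ) := by
      rw [hza, inner_self_eq_norm_sq_to_K, hyn a ha, hN]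
      push_cast
      rfl
    have e2 : ⟪z b, y b⟫_ℂ - (N : ℂ) = (f b - f a) + (-⟪z b, Q b (y b)⟫_ℂ) + ⟪z a, Q a (y a)⟫_ℂ := by
      rw [hf, ← e1]
      ring
    rw [e2]
    refine norm_add₃_le.trans ?_
    rw [norm_neg]
    have := hQb a le_rfl
    have := hQb b hab
    linarith
  have h4 : ‖y b - z b‖ ^ 2 = 2 * -(⟪z b, y b⟫_ℂ - (N : ℂ)).re := by
    rw [← norm_neg, neg_sub, norm_sub_sq (𝕜 := ℂ), hzn', hyn b hb1, ← hN, Complex.sub_re,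
      Complex.ofReal_re]
    change N - 2 * (⟪z b, y b⟫_ℂ).re + N = _
    ring
  have h5 : -(⟪z b, y b⟫_ℂ - (N : ℂ)).re ≤ ‖⟪z b, y b⟫_ℂ - (N : ℂ)‖ :=
    (neg_le_abs _).trans (Complex.abs_re_le_norm _)
  rw [h4, separationBound]
  linarith

end Abstract

/-! ### The evolution on the sphere in the interaction picture -/

lemma conj_inv_I_mul (k : ℝ) : conj ((Complex.I * k)⁻¹ : ℂ) = -(Complex.I * k)⁻¹ := by
  rw [map_inv₀, map_mul, Complex.conj_I, Complex.conj_ofReal, neg_mul, inv_neg]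

lemma DecayCurve.operatorCurve {F : ℝ → S2 → ℝ} {γ : ℝ} {Fc dF : ℝ → C(S2, ℝ)} {C : ℝ}
    (h : DecayCurve F γ Fc dF C) :
    OperatorCurve (fun s => mulB (Fc s)) (fun s => mulB (dF s)) γ C where
  continuous := mulB.continuous.comp h.continuous
  map_smul _ c x := mulB_smul _ c x
  symm _ x y := inner_mulB _ x y
  norm_le s hs x := (norm_mulB_le _ x).trans
    (mul_le_mul_of_nonneg_right (h.norm_le s hs) (norm_nonneg x))
  hasDerivWithinAt s hs := mulB.hasFDerivAt.comp_hasDerivWithinAt s (h.hasDerivWithinAt s hs)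
  norm_deriv_le s hs x := (norm_mulB_le _ x).trans
    (mul_le_mul_of_nonneg_right (h.norm_deriv_le s hs) (norm_nonneg x))

lemma norm_toL2_sq (a : C(S2, ℂ)) : ‖toL2 a‖ ^ 2 = ∫ θ, ‖a θ‖ ^ 2 ∂surf := by
  have h : ((‖toL2 a‖ ^ 2 : ℝ) : ℂ) = ((∫ θ, ‖a θ‖ ^ 2 ∂surf : ℝ) : ℂ) := by
    have h1 := inner_self_eq_norm_sq_to_K (𝕜 := ℂ) (toL2 a)
    rw [inner_toL2] at h1
    rw [← integral_complex_ofReal]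
    push_cast
    refine Eq.trans h1.symm (integral_congr_ae (.of_forall fun θ => ?_))
    exact Complex.conj_mul' (a θ)
  exact_mod_cast h

lemma norm_inner_lbTrunc_toL2 {n : ℕ} {p : C(S2, ℂ)} (hp : p ∈ polyS n) :
    ‖⟪toL2 p, lbTrunc n (toL2 p)⟫_ℂ‖ = dirichlet p := by
  rw [lbTrunc_toL2 hp, inner_lbC_self (isC2_of_mem_polyS hp), Complex.norm_real,
    Real.norm_of_nonneg (dirichlet_nonneg _)]

/-- Here the relation between `V` and `Q` enters: it identifies `s² V` with `B Q`, which both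
cancels the zeroth-order term and bounds `B Q` by `s²` times the decay of `V`. -/
lemma commutator_bound_polyL2 {V Q : ℝ → S2 → ℝ} {γ C : ℝ} {Vc dV Qc dQ : ℝ → C(S2, ℝ)}
    (hV : DecayCurve V γ Vc dV C) (hQ : DecayCurve Q γ Qc dQ C)
    (hVQ : ∀ τ, 1 ≤ τ → ∀ θ, V τ θ = (τ ^ 2)⁻¹ * LB (Q τ) θ) (n : ℕ) {s : ℝ} (hs : 1 ≤ s)
    {u : L2S} (hu : u ∈ polyL2 n) {v : L2S} (hv : v ∈ polyL2 n) {ε : ℝ} (hε : 0 < ε) :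
    ‖((s ^ 2 : ℝ) : ℂ) * ⟪v, mulB (Vc s) u⟫_ℂ - ⟪lbTrunc n v, mulB (Qc s) u⟫_ℂ
        + ⟪v, mulB (Qc s) (lbTrunc n u)⟫_ℂ‖
      ≤ ε * (2 * (C * s ^ (-γ) * (s ^ 2 * (C * s ^ (-γ)))) * ‖v‖ ^ 2
        + 4 * (C * s ^ (-γ)) ^ 2 * ‖⟪v, lbTrunc n v⟫_ℂ‖) + ε⁻¹ * ‖⟪u, lbTrunc n u⟫_ℂ‖ := by
  obtain ⟨p, hp, rfl⟩ := exists_eq_toL2 hu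
  obtain ⟨q, hq, rfl⟩ := exists_eq_toL2 hv
  have hs0 : s ≠ 0 := (zero_lt_one.trans_le hs).ne'
  have hLB : ∀ θ, LB (Q s) θ = s ^ 2 * V s θ := fun θ => by
    rw [hVQ s hs θ, mul_inv_cancel_left₀ (pow_ne_zero 2 hs0)]
  have hqb : ∀ θ, |Q s θ| ≤ C * s ^ (-γ) := fun θ => by
    rw [← hQ.apply s hs]
    exact ((Qc s).norm_coe_le_norm θ).trans (hQ.norm_le s hs)
  have hvb : ∀ θ, |LB (Q s) θ| ≤ s ^ 2 * (C * s ^ (-γ)) := fun θ => by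
    rw [hLB, abs_mul, abs_of_nonneg (sq_nonneg s), ← hV.apply s hs]
    exact mul_le_mul_of_nonneg_left
      (((Vc s).norm_coe_le_norm θ).trans (hV.norm_le s hs)) (sq_nonneg s)
  have h := commutator_bound (isC2_of_mem_polyS hp) (isC2_of_mem_polyS hq) (hQ.isC2 s hs)
    hqb hvb hε
  rw [← norm_inner_lbTrunc_toL2 hp, ← norm_inner_lbTrunc_toL2 hq, ← norm_toL2_sq] at h
  have e1 : ((s ^ 2 : ℝ) : ℂ) * ⟪toL2 q, mulB (Vc s) (toL2 p)⟫_ℂ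
      = ∫ θ, conj (q θ) * (((LB (Q s) θ : ℝ) : ℂ) * p θ) ∂surf := by
    rw [inner_toL2_mulB, ← integral_const_mul]
    refine integral_congr_ae (.of_forall fun θ => ?_)
    simp only [hLB, hV.apply s hs]
    push_cast
    ring
  have e2 : ⟪lbTrunc n (toL2 q), mulB (Qc s) (toL2 p)⟫_ℂ
      = ∫ θ, conj (LB q θ) * ((Q s θ : ℂ) * p θ) ∂surf := by
    rw [lbTrunc_toL2 hq, inner_toL2_mulB]
    refine integral_congr_ae (.of_forall fun θ => ?_)
    simp only [lbC_apply (isC2_of_mem_polyS hq), hQ.apply s hs]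
  have e3 : ⟪toL2 q, mulB (Qc s) (lbTrunc n (toL2 p))⟫_ℂ
      = ∫ θ, conj (q θ) * ((Q s θ : ℂ) * LB p θ) ∂surf := by
    rw [lbTrunc_toL2 hp, inner_toL2_mulB]
    refine integral_congr_ae (.of_forall fun θ => ?_)
    simp only [lbC_apply (isC2_of_mem_polyS hp), hQ.apply s hs]
  rwa [← e1, ← e2, ← e3] at h

/-- The generator of the evolution in the interaction picture, with a cutoff `T` after the
potential. -/
noncomputable def interGen (k : ℝ) (T : L2S →L[ℂ] L2S) (Vc : ℝ → C(S2, ℝ)) (s : ℝ) :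
    L2S →L[ℝ] L2S :=
  ((Complex.I * k)⁻¹ • (group k (max s 1)⁻¹).toContinuousLinearMap ∘L T).restrictScalars ℝ ∘L
    mulB (Vc s) ∘L (group k (-(max s 1)⁻¹)).toContinuousLinearMap.restrictScalars ℝ

lemma interGen_apply (k : ℝ) (T : L2S →L[ℂ] L2S) (Vc : ℝ → C(S2, ℝ)) (s : ℝ) (y : L2S) :
    interGen k T Vc s y = (Complex.I * k)⁻¹ •
      group k (max s 1)⁻¹ (T (mulB (Vc s) (group k (-(max s 1)⁻¹) y))) := by
  rw [interGen]
  rfl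

attribute [irreducible] interGen

lemma continuous_interGen (k : ℝ) (T : L2S →L[ℂ] L2S) {Vc : ℝ → C(S2, ℝ)} (hVc : Continuous Vc) :
    Continuous fun p : ℝ × L2S => interGen k T Vc p.1 p.2 := by
  have h0 : Continuous fun p : ℝ × L2S => (max p.1 1)⁻¹ :=
    (continuous_fst.max continuous_const).inv₀ fun p =>
      (zero_lt_one.trans_le (le_max_right p.1 1)).ne'
  have h0' : Continuous fun p : ℝ × L2S => -(max p.1 1)⁻¹ := h0.neg
  have h1 := (continuous_group k).comp
    (h0'.prodMk (continuous_snd : Continuous fun p : ℝ × L2S => p.2))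
  have h2 := mulB.continuous₂.comp ((hVc.comp continuous_fst).prodMk h1)
  have h3 := (continuous_group k).comp (h0.prodMk (T.continuous.comp h2))
  simp only [interGen_apply]
  exact h3.const_smul (Complex.I * k : ℂ)⁻¹

lemma norm_interGen_le (k : ℝ) {T : L2S →L[ℂ] L2S} (hT : ∀ y, ‖T y‖ ≤ ‖y‖) {Vc : ℝ → C(S2, ℝ)}
    {C : ℝ} (hVc : ∀ s, ‖Vc s‖ ≤ C) (s : ℝ) (y : L2S) :
    ‖interGen k T Vc s y‖ ≤ ‖(Complex.I * k : ℂ)⁻¹‖ * C * ‖y‖ := by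
  rw [interGen_apply, norm_smul, (group k _).norm_map, mul_assoc]
  refine mul_le_mul_of_nonneg_left ((hT _).trans ((norm_mulB_le _ _).trans ?_)) (norm_nonneg _)
  rw [(group k _).norm_map]
  exact mul_le_mul_of_nonneg_right (hVc s) (norm_nonneg y)

/-- The evolution in the interaction picture. -/
noncomputable def interFlow (k : ℝ) (T : L2S →L[ℂ] L2S) (Vc : ℝ → C(S2, ℝ)) (x : L2S) (τ : ℝ) :
    L2S :=
  dysonSum (fun s => interGen k T Vc s) x τ

/-! ### Polynomial truncations, and the limit of the flow in the interaction picture. -/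

section Truncated

variable {V : ℝ → S2 → ℝ} {γ C : ℝ} {Vc dV : ℝ → C(S2, ℝ)}

lemma interFlow_mem (k : ℝ) (hV : DecayCurve V γ Vc dV C) {n : ℕ} {x : L2S} (hx : x ∈ polyL2 n)
    (τ : ℝ) : interFlow k (polyL2 n).starProjection Vc x τ ∈ polyL2 n := by
  refine dysonSum_mem ((polyL2 n).restrictScalars ℝ) (polyL2 n).closed_of_finiteDimensional
    (continuous_interGen k _ hV.continuous)
    (norm_interGen_le k (polyL2 n).norm_starProjection_apply_le hV.norm_le_const) ?_ hx τ
  intro s y _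
  rw [Submodule.restrictScalars_mem, interGen_apply]
  exact (polyL2 n).smul_mem _ (group_mem k _ (Submodule.starProjection_apply_mem _ _))

/-- Undoing the interaction picture cancels the conjugating groups and restores the term `s⁻² B`. -/
lemma projectedFlow_interFlow (k : ℝ) (hV : DecayCurve V γ Vc dV C) {n : ℕ} {x : L2S}
    (hx : x ∈ polyL2 n) :
    ProjectedFlow (Complex.I * k : ℂ)⁻¹ (polyL2 n) (lbTrunc n) (fun s => mulB (Vc s))
      (fun s => group k (-s⁻¹) (interFlow k (polyL2 n).starProjection Vc x s)) where
  mem s := group_mem k _ (interFlow_mem k hV hx s)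
  hasDerivAt s hs := by
    have hs0 : s ≠ 0 := (zero_lt_one.trans_le hs).ne'
    have h1 : HasDerivAt (fun s : ℝ => -s⁻¹) ((s ^ 2)⁻¹) s := by
      simpa using (hasDerivAt_inv hs0).fun_neg
    have h2 := hasDerivAt_dysonSum (continuous_interGen k (polyL2 n).starProjection hV.continuous)
      (norm_interGen_le k (polyL2 n).norm_starProjection_apply_le hV.norm_le_const) x s
    refine (hasDerivAt_group k h1 h2 (interFlow_mem k hV hx) ?_).congr_deriv ?_
    · rw [interGen_apply]
      exact (polyL2 n).smul_mem _ (group_mem k _ (Submodule.starProjection_apply_mem _ _))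
    · rw [interGen_apply, max_eq_left hs, map_smul, group_neg_group]
      rfl

lemma norm_interFlow_starProjection (k : ℝ) (hV : DecayCurve V γ Vc dV C) {n : ℕ} {x : L2S}
    (hx : x ∈ polyL2 n) {τ : ℝ} (hτ : 1 ≤ τ) :
    ‖interFlow k (polyL2 n).starProjection Vc x τ‖ = ‖x‖ := by
  have h := (projectedFlow_interFlow k hV hx).norm_eq (conj_inv_I_mul k)
    (fun x hx y hy => inner_lbTrunc_comm hx hy) hV.operatorCurve.symm le_rfl hτ
  rw [(group k _).norm_map, (group k _).norm_map] at h
  rw [h, interFlow, dysonSum_one]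

/-- The comparison flow is the free evolution of the frozen vector `w a`. The constant involves the
initial datum only through its norm and energy, since `group` preserves both. -/
lemma norm_interFlow_sub_sq_le (k : ℝ) (hγ : 2 / 3 < γ) (hγ1 : γ < 1) (hC : 0 ≤ C)
    (hV : DecayCurve V γ Vc dV C) {Q : ℝ → S2 → ℝ} {Qc dQ : ℝ → C(S2, ℝ)}
    (hQ : DecayCurve Q γ Qc dQ C)
    (hVQ : ∀ τ, 1 ≤ τ → ∀ θ, V τ θ = (τ ^ 2)⁻¹ * LB (Q τ) θ) {n : ℕ} {x : L2S}
    (hx : x ∈ polyL2 n) {a b : ℝ} (ha : 1 ≤ a) (hab : a ≤ b) :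
    ‖interFlow k (polyL2 n).starProjection Vc x b
        - interFlow k (polyL2 n).starProjection Vc x a‖ ^ 2
      ≤ separationBound ‖(Complex.I * k : ℂ)⁻¹‖ γ C (‖x‖ ^ 2)
        (‖⟪x, lbTrunc n x⟫_ℂ‖ + 5 * C * ‖x‖ ^ 2) * a ^ (-(3 * γ / 2 - 1)) := by
  set w := interFlow k (polyL2 n).starProjection Vc x with hw
  have hw1 : w 1 = x := dysonSum_one _ x
  have hwm : ∀ s, w s ∈ polyL2 n := interFlow_mem k hV hx
  have hy := projectedFlow_interFlow k hV hx
  rw [← hw] at hy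
  have hz : ProjectedFlow (Complex.I * k : ℂ)⁻¹ (polyL2 n) (lbTrunc n) (fun _ _ => 0)
      (fun s => group k (-s⁻¹) (w a)) :=
    { mem := fun s => group_mem k _ (hwm a)
      hasDerivAt := fun s hs => by
        have hs0 : s ≠ 0 := (zero_lt_one.trans_le hs).ne'
        have h1 : HasDerivAt (fun s : ℝ => -s⁻¹) ((s ^ 2)⁻¹) s := by
          simpa using (hasDerivAt_inv hs0).fun_neg
        refine (hasDerivAt_group k h1 (hasDerivAt_const s (w a)) (fun _ => hwm a)
          (zero_mem _)).congr_deriv ?_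
        rw [map_zero, map_zero, smul_zero] }
  have hin : ∀ t, ∀ x ∈ polyL2 n,
      ⟪group k t x, lbTrunc n (group k t x)⟫_ℂ = ⟪x, lbTrunc n x⟫_ℂ := by
    intro t x hx
    rw [← group_lbTrunc k t hx, (group k t).inner_map_map]
  have h := norm_sub_sq_le_of_flows (conj_inv_I_mul k) (fun x hx y hy => inner_lbTrunc_comm hx hy)
    (lbTrunc_mem n) hγ hγ1 hV.operatorCurve hQ.operatorCurve hC
    (fun s hs u hu v hv ε hε => commutator_bound_polyL2 hV hQ hVQ n hs hu hv hε) hy hz ha hab rfl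
    (fun s => by rw [hin _ _ (hwm a), hin _ _ (hwm a)])
    (fun s => by rw [(group k _).norm_map, (group k _).norm_map])
  rwa [← map_sub, (group k _).norm_map, (group k _).norm_map, hin _ _ (hwm 1), hw1] at h

lemma tendsto_interFlow (k : ℝ) (hV : DecayCurve V γ Vc dV C) {x : L2S} {xN : ℕ → L2S}
    (hx : Tendsto xN atTop (𝓝 x)) {K : ℝ} (hK : ∀ N, ‖xN N‖ ≤ K) (τ : ℝ) :
    Tendsto (fun N => interFlow k (polyL2 N).starProjection Vc (xN N) τ) atTop
      (𝓝 (interFlow k (.id ℂ L2S) Vc x τ)) := by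
  refine tendsto_dysonSum (fun N => continuous_interGen k _ hV.continuous)
    (fun N => norm_interGen_le k (polyL2 N).norm_starProjection_apply_le hV.norm_le_const) ?_ hx hK τ
  intro s y
  have h := ((group k (max s 1)⁻¹).continuous.tendsto _).comp
    (tendsto_starProjection_polyL2 (mulB (Vc s) (group k (-(max s 1)⁻¹) y)))
  simp only [interGen_apply]
  exact h.const_smul (Complex.I * k : ℂ)⁻¹

/-- The truncated flows are isometric for times at least `1`; the bound follows in the limit. -/
lemma norm_interFlow_le (k : ℝ) (hV : DecayCurve V γ Vc dV C) (x : L2S) {τ : ℝ} (hτ : 1 ≤ τ) :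
    ‖interFlow k (.id ℂ L2S) Vc x τ‖ ≤ ‖x‖ := by
  refine le_of_tendsto (tendsto_interFlow k hV (tendsto_starProjection_polyL2 x)
    (fun N => (polyL2 N).norm_starProjection_apply_le x) τ).norm (.of_forall fun N => ?_)
  rw [norm_interFlow_starProjection k hV (Submodule.starProjection_apply_mem _ x) hτ]
  exact (polyL2 N).norm_starProjection_apply_le x

lemma interFlow_sub (k : ℝ) (hV : DecayCurve V γ Vc dV C) (x x' : L2S) (τ : ℝ) :
    interFlow k (.id ℂ L2S) Vc (x - x') τ
      = interFlow k (.id ℂ L2S) Vc x τ - interFlow k (.id ℂ L2S) Vc x' τ := by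
  unfold interFlow
  exact dysonSum_sub (A := interGen k (.id ℂ L2S) Vc)
    (continuous_interGen k (.id ℂ L2S) hV.continuous)
    (norm_interGen_le k (T := .id ℂ L2S) (fun _ => le_rfl) hV.norm_le_const) x x' τ

lemma exists_norm_interFlow_sub_lt (k : ℝ) (hγ : 2 / 3 < γ) (hγ1 : γ < 1) (hC : 0 ≤ C)
    (hV : DecayCurve V γ Vc dV C) {Q : ℝ → S2 → ℝ} {Qc dQ : ℝ → C(S2, ℝ)}
    (hQ : DecayCurve Q γ Qc dQ C)
    (hVQ : ∀ τ, 1 ≤ τ → ∀ θ, V τ θ = (τ ^ 2)⁻¹ * LB (Q τ) θ) {m : ℕ} {x : L2S}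
    (hx : x ∈ polyL2 m) {ε : ℝ} (hε : 0 < ε) :
    ∃ a, 1 ≤ a ∧ ∀ b, a ≤ b →
      ‖interFlow k (.id ℂ L2S) Vc x b - interFlow k (.id ℂ L2S) Vc x a‖ < ε := by
  set K := separationBound ‖(Complex.I * k : ℂ)⁻¹‖ γ C (‖x‖ ^ 2)
        (‖⟪x, lbTrunc m x⟫_ℂ‖ + 5 * C * ‖x‖ ^ 2) with hK
  have hlim : Tendsto (fun a : ℝ => K * a ^ (-(3 * γ / 2 - 1))) atTop (𝓝 0) := by
    simpa using (tendsto_rpow_neg_atTop (show 0 < 3 * γ / 2 - 1 by linarith)).const_mul K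
  obtain ⟨a, ha, ha1⟩ := ((hlim.eventually_lt_const (show 0 < ε ^ 2 by positivity)).and
    (eventually_ge_atTop 1)).exists
  refine ⟨a, ha1, fun b hab => lt_of_pow_lt_pow_left₀ 2 hε.le (lt_of_le_of_lt ?_ ha)⟩
  have ht : ∀ τ, Tendsto (fun N => interFlow k (polyL2 N).starProjection Vc x τ) atTop
      (𝓝 (interFlow k (.id ℂ L2S) Vc x τ)) :=
    fun τ => tendsto_interFlow k hV tendsto_const_nhds (fun _ => le_rfl) τ
  -- For `N ≥ m` the energy of `x` does not depend on the truncation, so one bound holds along the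
  -- whole sequence.
  refine le_of_tendsto ((((ht b).sub (ht a)).norm).pow 2) ?_
  filter_upwards [eventually_ge_atTop m] with N hN
  rw [hK, ← lbTrunc_eq_of_le hN hx]
  exact norm_interFlow_sub_sq_le k hγ hγ1 hC hV hQ hVQ (polyL2_mono hN hx) ha1 hab

/-- An `ε/3` argument: the flow is a contraction in the initial datum, so the Cauchy property
extends from polynomials to `L²`. -/
theorem exists_tendsto_interFlow (k : ℝ) (hγ : 2 / 3 < γ) (hγ1 : γ < 1) (hC : 0 ≤ C)
    (hV : DecayCurve V γ Vc dV C) {Q : ℝ → S2 → ℝ} {Qc dQ : ℝ → C(S2, ℝ)}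
    (hQ : DecayCurve Q γ Qc dQ C)
    (hVQ : ∀ τ, 1 ≤ τ → ∀ θ, V τ θ = (τ ^ 2)⁻¹ * LB (Q τ) θ) (x : L2S) :
    ∃ g, Tendsto (interFlow k (.id ℂ L2S) Vc x) atTop (𝓝 g) := by
  refine cauchySeq_tendsto_of_complete (Metric.cauchySeq_iff'.mpr fun ε hε => ?_)
  obtain ⟨x', hx', hd⟩ := Metric.mem_closure_iff.mp (dense_iUnion_polyL2 x) (ε / 3) (by positivity)
  obtain ⟨m, hm⟩ := mem_iUnion.mp hx'
  obtain ⟨a, ha, h⟩ := exists_norm_interFlow_sub_lt k hγ hγ1 hC hV hQ hVQ hm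
    (show 0 < ε / 3 by positivity)
  have happrox : ∀ τ, 1 ≤ τ → dist (interFlow k (.id ℂ L2S) Vc x τ)
      (interFlow k (.id ℂ L2S) Vc x' τ) < ε / 3 := by
    intro τ hτ
    rw [dist_eq_norm, ← interFlow_sub k hV]
    exact (norm_interFlow_le k hV _ hτ).trans_lt (by rwa [← dist_eq_norm])
  refine ⟨a, fun b hab => ?_⟩
  have h1 := happrox b (ha.trans hab)
  have h2 := happrox a ha
  rw [dist_comm] at h2
  have h3 := h b hab
  rw [← dist_eq_norm] at h3
  refine (dist_triangle4 _ _ _ _).trans_lt (lt_of_lt_of_eq (add_lt_add (add_lt_add h1 h3) h2) ?_)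
  ring

end Truncated

/-! ### From the Dyson series back to the Duhamel expansion. -/

section Duhamel

variable {k : ℝ} {V : ℝ → S2 → ℝ} {γ C : ℝ} {Vc dV : ℝ → C(S2, ℝ)}

lemma U0_mulL2_group (hk : k ≠ 0) (hV : DecayCurve V γ Vc dV C) {s τ : ℝ} (hs : 1 ≤ s)
    (hτ : 1 ≤ τ) (y : L2S) : U0 k s τ (mulL2 (V s) (group k (-s⁻¹) y))
      = (Complex.I * k) • group k (-τ⁻¹) (interGen k (.id ℂ L2S) Vc s y) := by
  have hc : (Complex.I * k : ℂ) ≠ 0 :=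
    mul_ne_zero Complex.I_ne_zero (Complex.ofReal_ne_zero.mpr hk)
  rw [U0_eq_group k (zero_lt_one.trans_le hs).ne' (zero_lt_one.trans_le hτ).ne',
    mulL2_eq_mulB (hV.apply s hs), interGen_apply, max_eq_left hs, map_smul, smul_smul,
    mul_inv_cancel₀ hc, one_smul]
  rfl

/-- Each inner group at time `s` cancels against the outer free evolution. The Dyson datum is `group
k 1 f` because `s⁻¹ = 1` at the initial time. -/
lemma duhamelTerm_eq (hk : k ≠ 0) (hV : DecayCurve V γ Vc dV C) (f : L2S) (n : ℕ) {τ : ℝ}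
    (hτ : 1 ≤ τ) : duhamelTerm k V 1 f n τ
      = group k (-τ⁻¹) (dyson (fun s => interGen k (.id ℂ L2S) Vc s) (group k 1 f) n τ) := by
  have hc : (Complex.I * k : ℂ) ≠ 0 :=
    mul_ne_zero Complex.I_ne_zero (Complex.ofReal_ne_zero.mpr hk)
  induction n generalizing τ with
  | zero =>
    rw [duhamelTerm, dyson, U0_eq_group k one_ne_zero (zero_lt_one.trans_le hτ).ne', inv_one]
  | succ n ih =>
    set d := dyson (fun s => interGen k (.id ℂ L2S) Vc s) (group k 1 f) n with hd
    have hA := continuous_interGen k (.id ℂ L2S) hV.continuous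
    have hint : IntervalIntegrable (fun s => interGen k (.id ℂ L2S) Vc s (d s)) volume 1 τ :=
      (hA.comp (continuous_id.prodMk (continuous_dyson hA _ n))).intervalIntegrable _ _
    have e : ∫ s in (1 : ℝ)..τ, U0 k s τ (mulL2 (V s) (duhamelTerm k V 1 f n s))
        = ∫ s in (1 : ℝ)..τ, (Complex.I * k) •
          (group k (-τ⁻¹)).toContinuousLinearMap (interGen k (.id ℂ L2S) Vc s (d s)) := by
      refine intervalIntegral.integral_congr fun s hs => ?_
      rw [uIcc_of_le hτ] at hs
      beta_reduce
      rw [ih hs.1, U0_mulL2_group hk hV hs.1 hτ]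
      rfl
    rw [duhamelTerm, e, intervalIntegral.integral_smul, smul_smul, inv_mul_cancel₀ hc, one_smul,
      ContinuousLinearMap.intervalIntegral_comp_comm _ hint]
    rfl

lemma duhamelConverges (hk : k ≠ 0) (hV : DecayCurve V γ Vc dV C) (f : L2S) {τ : ℝ}
    (hτ : 1 ≤ τ) : DuhamelConverges k V 1 τ f := by
  have hA := continuous_interGen k (.id ℂ L2S) hV.continuous
  constructor
  · intro n
    have h : Continuous fun s => (Complex.I * k : ℂ) • group k (-τ⁻¹) (interGen k (.id ℂ L2S) Vc s
        (dyson (fun s => interGen k (.id ℂ L2S) Vc s) (group k 1 f) n s)) :=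
      Continuous.const_smul (g := fun s => group k (-τ⁻¹) (interGen k (.id ℂ L2S) Vc s
        (dyson (fun s => interGen k (.id ℂ L2S) Vc s) (group k 1 f) n s)))
        ((group k (-τ⁻¹)).continuous.comp
          (hA.comp (continuous_id.prodMk (continuous_dyson hA _ n)))) (Complex.I * k : ℂ)
    refine (h.intervalIntegrable 1 τ).congr fun s hs => ?_
    rw [uIoc_of_le hτ] at hs
    beta_reduce
    rw [duhamelTerm_eq hk hV f n hs.1.le, U0_mulL2_group hk hV hs.1.le hτ]
  · refine (summable_norm_dyson (norm_interGen_le k (T := .id ℂ L2S) (fun _ => le_rfl)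
      hV.norm_le_const) (group k 1 f) τ).congr fun n => ?_
    rw [duhamelTerm_eq hk hV f n hτ, (group k _).norm_map]

lemma U_eq (hk : k ≠ 0) (hV : DecayCurve V γ Vc dV C) (f : L2S) {τ : ℝ} (hτ : 1 ≤ τ) :
    U k V 1 τ f = group k (-τ⁻¹) (interFlow k (.id ℂ L2S) Vc (group k 1 f) τ) := by
  have hs := (summable_norm_dyson (norm_interGen_le k (T := .id ℂ L2S) (fun _ => le_rfl)
      hV.norm_le_const) (group k 1 f) τ).of_norm
  have h := (group k (-τ⁻¹)).toContinuousLinearMap.map_tsum hs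
  refine Eq.trans ?_ h.symm
  exact tsum_congr fun n => duhamelTerm_eq hk hV f n hτ

end Duhamel

end SphereEvolution

open SphereEvolution in
theorem lemma4 (k : ℝ) (hk : k ≠ 0) (γ : ℝ) (hγ : 2 / 3 < γ)
    (V Q : ℝ → SphereEvolution.S2 → ℝ)
    (hV : SphereEvolution.ConditionsA1 V γ) (hQ : SphereEvolution.ConditionsA1 Q γ)
    (hVQ : ∀ τ : ℝ, 1 ≤ τ → ∀ θ : SphereEvolution.S2,
      V τ θ = (τ ^ 2)⁻¹ * SphereEvolution.LB (Q τ) θ)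
    (f : SphereEvolution.L2S) :
    (∀ τ : ℝ, 1 ≤ τ → SphereEvolution.DuhamelConverges k V 1 τ f) ∧
    ∃ g : SphereEvolution.L2S,
      Tendsto (fun τ : ℝ => SphereEvolution.U k V 1 τ f) atTop (𝓝 g) := by
  obtain ⟨Vc, dV, C₁, hV₁⟩ := hV.exists_decayCurve
  obtain ⟨Qc, dQ, C₂, hQ₁⟩ := hQ.exists_decayCurve
  have hV₂ := hV₁.mono (le_max_left C₁ C₂)
  have hQ₂ := hQ₁.mono (le_max_right C₁ C₂)
  have hC : 0 ≤ max C₁ C₂ := (norm_nonneg _).trans (hV₂.norm_le_const 1)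
  refine ⟨fun τ hτ => duhamelConverges hk hV₁ f hτ, ?_⟩
  obtain ⟨g, hg⟩ := exists_tendsto_interFlow k hγ hV.lt_one hC hV₂ hQ₂ hVQ (group k 1 f)
  refine ⟨g, ?_⟩
  -- The free phase converges as `τ → ∞`, so joint continuity of `group` gives `U` the same limit as
  -- the interaction-picture flow.
  have h0 : Tendsto (fun τ : ℝ => -τ⁻¹) atTop (𝓝 0) := by
    simpa using (tendsto_inv_atTop_zero (𝕜 := ℝ)).neg
  have h := ((continuous_group k).tendsto (0, g)).comp (h0.prodMk_nhds hg)
  simp only [group_zero] at h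
  refine h.congr' ?_
  filter_upwards [eventually_ge_atTop 1] with τ hτ
  exact (U_eq hk hV₁ f hτ).symm
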